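/- Let $n,p,k\in\mathbb R$ with $n\neq 1$, $p\neq 0$, $k\neq 0$, and consider the radial gNLS equation $$ i u_t = u_{rr} + (n-1)u_r/r + k|u|^p u ,\qquad u=u(t,r)\in\mathbb C,\ r>0. \tag{E}$$ Let $c_1,\dots,c_6$ denote arbitrary real constants. Each of the following functions is a classical ($C^2$) solution of (E), under the listed conditions, on the open set of all $(t,r)$ with $r>0$ at which the stated expressions are defined. Except in items 4, 5, 17, 19, each function has the form $u=A\,e^{i\Phi}$ with real $A$ (the factor in front of the exponential) and real $\Phi$, and the solution is asserted where $A>0$; quantities raised to non-integer powers and arguments of logarithms, Bessel and Coulomb functions are positive. In items 4, 5, 17, 19 the base carrying the exponent $n-2$, $(2-n)/(3-n)$, $-n/2$, $-2/3$, respectively (and the constant prefactor with $\pm$), may be any nonzero real number, powers being principal values. Integrals are assumed to converge, with nonzero denominators at the upper limit. 1. $u=(c_2/k)^{1/p}\exp(ic_1-ic_2t)$; $c_2/k>0$. 2. $u=(c_2+c_3t)^{-n/2}\exp\big(ic_1-\frac{ic_3r^2}{4(c_2+c_3t)}+\frac{2ik}{c_3(np-2)}(c_2+c_3t)^{1-np/2}\big)$;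 $p\ne2/n$, $n\neq0$, $c_3\ne0$, where $c_2+c_3t>0$. 3. $u=(c_2+c_3t)^{-n/2}\exp\big(ic_1-\frac{ic_3r^2}{4(c_2+c_3t)}-\frac{ik}{c_3}\ln|c_2+c_3t|\big)$; $p=2/n$, $n\ne0$, $c_3\ne0$, where $c_2+c_3t>0$. 4. $u=\big(\pm\sqrt{n(n-2)/(2k)}\big)^{2-n}\big((c_2+(n-4)t)/r\big)^{n-2}\exp\big(ic_1+i(1-n/2)r^2/(c_2+(n-4)t)\big)$; $p=2/(2-n)$, $n(n-2)/k>0$, $n\ne2$. 5. $u=\big(k(n-3)^2/(2-n)^3\big)^{(2-n)/(6-2n)}\big(r+c_2r^{3-n}\big)^{(2-n)/(3-n)}\exp(ic_1)$; $p=2(3-n)/(n-2)$, $k(2-n)>0$, $n\ne2,3$. 6. $u=\big(c_2^2(n-2)^2/k\big)^{(n-2)/(6-2n)}r^{2-n}\exp(ic_1+ic_2r^{n-2})$; $p=2(3-n)/(n-2)$, $k>0$, $n\neq2,3$, $c_2\neq0$. 7. $u=\Big(-k/c_6+r^{1-n/2}Z(r)\big(1+c_5\int_{c_4}^r z^{-1}Z(z)^{-2}dz\big)\Big)\exp(ic_1+ic_6t)$,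 $Z(z)=c_2J_{|1-n/2|}(\sqrt{c_6}z)+c_3Y_{|1-n/2|}(\sqrt{c_6}z)$; $p=-1$, $c_6>0$. 8. $u=\Big(k/c_6+r^{1-n/2}Z(r)\big(1+c_5\int_{c_4}^r z^{-1}Z(z)^{-2}dz\big)\Big)\exp(ic_1-ic_6t)$, $Z(z)=c_2I_{|1-n/2|}(\sqrt{c_6}z)+c_3K_{|1-n/2|}(\sqrt{c_6}z)$; $p=-1$, $c_6>0$. 9. $u=(-kr^2/(2n)+c_3r^{2-n}+c_2)\exp(ic_1)$; $p=-1$, $n\ne0,2$. 10. $u=(c_2/(rt^{1/2}))\exp\big(ic_1-ir^2/(4t)-2ikrt^{3/2}/(5c_2)+ik^2t^4/(25c_2^2)\big)$; $p=-1$, $n=3$, $c_2>0$, $t>0$. 11. $u=(c_2/r)\exp\big(ic_1-iktr/c_2+ik^2t^3/(3c_2^2)\big)$; $p=-1$, $n=3$, $c_2>0$. 12. $u=(-kr^2/4+c_3\ln r+c_2)\exp(ic_1)$; $p=-1$, $n=2$. 13. $u=(-(k/2)r^2\ln r+c_3r^2+c_2)\exp(ic_1)$; $p=-1$, $n=0$.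 14. $u=\big((k/8)r^2+c_3r^6/t^4+c_2t^2\big)\exp(ic_1-ir^2/(4t))$; $p=-1$, $n=-4$, $t\ne0$. 15. $u=\Big(-(k/c_6)t^2+(r^3/t)Z(r/t)\big(1+c_5\int_{c_4}^{r/t}z^{-1}Z(z)^{-2}dz\big)\Big)\exp\big(ic_1-ic_6/t-ir^2/(4t)\big)$, $Z(z)=c_2J_3(\sqrt{c_6}z)+c_3Y_3(\sqrt{c_6}z)$; $p=-1$, $n=-4$, $c_6>0$, $t>0$. 16. $u=\Big((k/c_6)t^2+(r^3/t)Z(r/t)\big(1+c_5\int_{c_4}^{r/t}z^{-1}Z(z)^{-2}dz\big)\Big)\exp\big(ic_1+ic_6/t-ir^2/(4t)\big)$, $Z(z)=c_2I_3(\sqrt{c_6}z)+c_3K_3(\sqrt{c_6}z)$; $p=-1$, $n=-4$, $c_6>0$, $t>0$. 17. $u=\big(\pm'\sqrt{-k(1+3/n)/2}\big)^{-n/2}\big(r+c_2t^{-1+4/n}r^{2(1-2/n)}\big)^{-n/2}\exp(ic_1-ir^2/(4t))$; $p=8/(1\pm\sqrt{17})=(\pm\sqrt{17}-1)/2$, $n=(1\pm\sqrt{17})/2$,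 $kn<0$, $t>0$ (the sign $\pm'$ is independent of $\pm$). 18. $u=\big(c_2^2(8-3n)/k\big)^{n/4}r^{2-n}t^{-2+n/2}\exp\big(ic_1-ir^2/(4t)+ic_2r^{n-2}t^{2-n}\big)$; $p=8/(1\pm\sqrt{17})=(\pm\sqrt{17}-1)/2$, $n=(1\pm\sqrt{17})/2$, $k>0$, $c_2\ne0$, $t>0$. 19. $u=(-16k)^{-1/3}r^{2/3}(t(1+c_2t))^{-2/3}\exp\big(ic_1-ir^2(1+2c_2t)/(8t(1+c_2t))\big)$; $p=3$, $n=4/3$, $k<0$, $t(1+c_2t)\neq 0$. 20. $u=\frac k8\big((c_2r^2+8c_3t)\cos\frac{r^2}{8t}+(c_3r^2-8c_2t)\sin\frac{r^2}{8t}\big)\int_{c_4}^{r^2/(8t)}\frac{\xi^2(c_2\mathrm{Si}(\xi)-c_3\mathrm{Ci}(\xi))+(c_3\xi-c_2)\sin\xi+(c_2\xi+c_3)\cos\xi}{((c_2-c_3\xi)\sin\xi-(c_3+c_2\xi)\cos\xi)^2}d\xi\;\exp\big(ic_1-ir^2/(8t)\big)$; $p=-1$, $n=-4$, $t\ne0$.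 21. $u=-\frac{kr^2}4\big(c_3F_1(c_2,\tfrac{r^2}{8t})+c_4G_1(c_2,\tfrac{r^2}{8t})\big)\int_{c_5}^{r^2/(8t)}\frac{c_3Fi_1(c_2,\xi)+c_4Gi_1(c_2,\xi)}{(c_3F_1(c_2,\xi)+c_4G_1(c_2,\xi))^2}d\xi\;\exp\big(ic_1-ir^2/(8t)-ic_2\ln t\big)$; $p=-1$, $n=-4$, $c_2\ne0$, $t>0$, where $Fi_L(\rho,\xi)=\int_{c_6}^\xi z^{-2}F_L(\rho,z)dz$, $Gi_L(\rho,\xi)=\int_{c_6}^\xi z^{-2}G_L(\rho,z)dz$, $c_6>0$, $c_5\ge0$. In 7, 8, 15, 16 the lower limit satisfies $c_4\ge0$, and for $c_5=0$ the integral is absent (no condition on $Z$ or $c_4$). Here $J,Y,I,K$ are the Bessel and modified Bessel functions, $\mathrm{Si}(x)=\int_0^x\frac{\sin s}{s}ds$, $\mathrm{Ci}(x)=\gamma+\ln|x|+\int_0^x\frac{\cos s-1}{s}ds$, and $F_L(\eta,\rho),G_L(\eta,\rho)$ are the regular and irregular Coulomb wave functions. Moreover, these solutions arise from group-resolving systems: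 near every point of its domain, each $u$ satisfies the pair of first-order equations stating that the two differential invariants below equal $G(x,v)$, $H(x,v)$, where $(G,H)$ is a phase-equivariant solution, for all $v\ne0$ and $x$ in an open set, of the associated system, of the form $G=g(x,|v|)v$, $H=(h_1(x)+h_2(x)|v|^{2a})v$ with $a\neq0$. (Subscripts $v,\bar v$ are Wirtinger derivatives.) * Time-translation (items 1–9, 12, 13): $x=r$, $v=u$; $G=u_t$, $H=u_r$; system $G_x+HG_v-GH_v+\bar HG_{\bar v}-\bar GH_{\bar v}=0$, $iG-(n-1)H/x-H_x-HH_v-\bar HH_{\bar v}=k|v|^pv$. * Scaling (items 10, 11, 20, 21): $x=t/r^2$, $v=r^{2/p}u$; $G=r^{2+2/p}u_t$, $H=r^{1+2/p}u_r$; system $2(1+\frac1p)G+H_x+2xG_x-\frac2p(vG_v+\bar vG_{\bar v})+GH_v-HG_v+\bar GH_{\bar v}-\bar HG_{\bar v}=0$, $iG+(2-n+\frac2p)H+2xH_x-\frac2p(vH_v+\bar vH_{\bar v})-HH_v-\bar HH_{\bar v}=k|v|^pv$. * Inversion, $p=4/n$ (items 14–19): $x=t/r$, $v=r^{n/2}e^{ir^2/(4t)}u$;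 $G=r^{2+n/2}e^{ir^2/(4t)}\big(u_t+\frac rtu_r+(\frac n{2t}+\frac{ir^2}{4t^2})u\big)$, $H=r^{1+n/2}e^{ir^2/(4t)}\big(u_r+\frac{ir}{2t}u\big)$; system $(2+\frac n2)G+xG_x-\frac n2(vG_v+\bar vG_{\bar v})+GH_v-HG_v+\bar GH_{\bar v}-\bar HG_{\bar v}=0$, $iG+(2-\frac n2)H+xH_x-\frac n2(vH_v+\bar vH_{\bar v})-HH_v-\bar HH_{\bar v}=k|v|^{4/n}v$. -/

import Mathlib

open MeasureTheory Topology Filter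

noncomputable section

namespace GNLS

/-! ### Special functions -/

/-- Bessel function of the first kind `J_ν(x)`, `x > 0`, `ν ≥ 0`. -/
def besselJ (ν x : ℝ) : ℝ :=
  (x / 2) ^ ν * ∑' m : ℕ, (-1) ^ m / ((m.factorial : ℝ) * Real.Gamma (m + ν + 1)) * (x / 2) ^ (2 * m)

/-- Modified Bessel function of the first kind `I_ν(x)`, `x > 0`, `ν ≥ 0`. -/
def besselI (ν x : ℝ) : ℝ :=
  (x / 2) ^ ν * ∑' m : ℕ, 1 / ((m.factorial : ℝ) * Real.Gamma (m + ν + 1)) * (x / 2) ^ (2 * m)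

/-- Bessel function of the second kind `Y_ν(x)`, `x > 0`, by Schläfli's integral, which covers
integer and non-integer orders alike. -/
def besselY (ν x : ℝ) : ℝ :=
  (1 / Real.pi) * (∫ θ in (0 : ℝ)..Real.pi, Real.sin (x * Real.sin θ - ν * θ))
    - (1 / Real.pi) * ∫ s in Set.Ioi (0 : ℝ),
        (Real.exp (ν * s) + Real.exp (-(ν * s)) * Real.cos (ν * Real.pi)) *
          Real.exp (-(x * Real.sinh s))

/-- Modified Bessel function of the second kind `K_ν(x)`, `x > 0`. -/
def besselK (ν x : ℝ) : ℝ :=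
  ∫ s in Set.Ioi (0 : ℝ), Real.exp (-(x * Real.cosh s)) * Real.cosh (ν * s)

/-- Sine integral `Si(x) = ∫₀ˣ (sin s)/s ds`. -/
def sinIntegral (x : ℝ) : ℝ := ∫ s in (0 : ℝ)..x, Real.sin s / s

/-- Cosine integral `Ci(x) = γ + ln |x| + ∫₀ˣ (cos s - 1)/s ds`
(`Real.log x` is `ln |x|`). -/
def cosIntegral (x : ℝ) : ℝ :=
  Real.eulerMascheroniConstant + Real.log x + ∫ s in (0 : ℝ)..x, (Real.cos s - 1) / s

/-- Gamow normalisation `C_L(η) = 2^L e^{-πη/2} |Γ(L+1+iη)| / (2L+1)!` of the Coulomb functions. -/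
def coulombC (L : ℕ) (η : ℝ) : ℝ :=
  2 ^ L * Real.exp (-(Real.pi * η / 2)) * ‖Complex.Gamma (L + 1 + Complex.I * η)‖ /
    ((2 * L + 1).factorial : ℝ)

/-- Common prefactor `e^{-πη} ρ^{L+1} / ((2L+1)! C_L(η))` in the integral representation
`F_L + i G_L = (i e^{-πη} ρ^{L+1} / ((2L+1)! C_L(η)))
  ∫₀^∞ [(1+s²)^L exp(-ρ s + 2 η arctan s) - i sech^{2L+2}(s) exp(-i(ρ tanh s - 2 η s))] ds`
of the Coulomb wave functions. -/
def coulombPrefactor (L : ℕ) (η ρ : ℝ) : ℝ :=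
  Real.exp (-(Real.pi * η)) * ρ ^ (L + 1) / (((2 * L + 1).factorial : ℝ) * coulombC L η)

/-- Regular Coulomb wave function `F_L(η, ρ)`, `ρ > 0`. -/
def coulombF (L : ℕ) (η ρ : ℝ) : ℝ :=
  coulombPrefactor L η ρ * ∫ s in Set.Ioi (0 : ℝ),
    Real.cos (ρ * Real.tanh s - 2 * η * s) / Real.cosh s ^ (2 * L + 2)

/-- Irregular Coulomb wave function `G_L(η, ρ)`, `ρ > 0`. -/
def coulombG (L : ℕ) (η ρ : ℝ) : ℝ :=
  coulombPrefactor L η ρ * ∫ s in Set.Ioi (0 : ℝ),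
    ((1 + s ^ 2) ^ L * Real.exp (-(ρ * s) + 2 * η * Real.arctan s)
      - Real.sin (ρ * Real.tanh s - 2 * η * s) / Real.cosh s ^ (2 * L + 2))

/-! ### The radial equation -/

/-- `u` is a classical (`C²`) solution of `i u_t = u_rr + (n-1) u_r / r + k |u|^p u`
on the open set `Ω` of points `(t, r)`, `r > 0`. -/
structure IsRadialSolution (n p k : ℝ) (Ω : Set (ℝ × ℝ)) (u : ℝ → ℝ → ℂ) : Prop where
  isOpen : IsOpen Ω
  pos : ∀ t r : ℝ, (t, r) ∈ Ω → 0 < r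
  contDiff : ContDiffOn ℝ 2 (fun z : ℝ × ℝ => u z.1 z.2) Ω
  eqn : ∀ t r : ℝ, (t, r) ∈ Ω →
    Complex.I * deriv (fun s => u s r) t =
      deriv (deriv (u t)) r + ((n - 1 : ℝ) : ℂ) * deriv (u t) r / (r : ℂ)
        + (k : ℂ) * ((‖u t r‖ ^ p : ℝ) : ℂ) * u t r

/-! ### Group-resolving systems

The unknowns `G`, `H` are functions of `(x, v, v̄)`, i.e. of a real `x` and a complex `v`.
The combination `w f_v + w̄ f_v̄` of Wirtinger derivatives is the real derivative of `f` in the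
direction `w`. -/

/-- `∂f/∂x` at `(x, v)`. -/
def dx (f : ℝ × ℂ → ℂ) (x : ℝ) (v : ℂ) : ℂ := fderiv ℝ f (x, v) (1, 0)

/-- `w f_v + w̄ f_v̄` at `(x, v)`. -/
def dv (f : ℝ × ℂ → ℂ) (x : ℝ) (v w : ℂ) : ℂ := fderiv ℝ f (x, v) (0, w)

/-- The three one-dimensional symmetry groups used for the group foliations. -/
inductive SymmetryGroup
  | timeTranslation
  | scaling
  | inversion

/-- The group-resolving system at the point `(x, v)`.
For the inversion group it is used with `p = 4/n`. -/
def ResolvingSystem (S : SymmetryGroup) (n p k : ℝ) (G H : ℝ × ℂ → ℂ) (x : ℝ) (v : ℂ) : Prop :=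
  match S with
  | .timeTranslation =>
      dx G x v + dv G x v (H (x, v)) - dv H x v (G (x, v)) = 0 ∧
      Complex.I * G (x, v) - ((n - 1 : ℝ) : ℂ) * H (x, v) / (x : ℂ) - dx H x v
          - dv H x v (H (x, v)) =
        (k : ℂ) * ((‖v‖ ^ p : ℝ) : ℂ) * v
  | .scaling =>
      ((2 * (1 + 1 / p) : ℝ) : ℂ) * G (x, v) + dx H x v + 2 * (x : ℂ) * dx G x v
          - ((2 / p : ℝ) : ℂ) * dv G x v v
          + dv H x v (G (x, v)) - dv G x v (H (x, v)) = 0 ∧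
      Complex.I * G (x, v) + ((2 - n + 2 / p : ℝ) : ℂ) * H (x, v) + 2 * (x : ℂ) * dx H x v
          - ((2 / p : ℝ) : ℂ) * dv H x v v - dv H x v (H (x, v)) =
        (k : ℂ) * ((‖v‖ ^ p : ℝ) : ℂ) * v
  | .inversion =>
      ((2 + n / 2 : ℝ) : ℂ) * G (x, v) + (x : ℂ) * dx G x v - ((n / 2 : ℝ) : ℂ) * dv G x v v
          + dv H x v (G (x, v)) - dv G x v (H (x, v)) = 0 ∧
      Complex.I * G (x, v) + ((2 - n / 2 : ℝ) : ℂ) * H (x, v) + (x : ℂ) * dx H x v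
          - ((n / 2 : ℝ) : ℂ) * dv H x v v - dv H x v (H (x, v)) =
        (k : ℂ) * ((‖v‖ ^ (4 / n) : ℝ) : ℂ) * v

/-- `(G, H)` is a phase-equivariant solution of the group-resolving system on `x ∈ X`, `v ≠ 0`,
of the separable power form `H = h₁(x) v + h₂(x) |v|^{2a} v`, `a ≠ 0`. -/
def IsSeparableSolution (S : SymmetryGroup) (n p k : ℝ) (X : Set ℝ) (G H : ℝ × ℂ → ℂ) : Prop :=
  (∃ (h₁ h₂ : ℝ → ℂ) (a : ℝ), a ≠ 0 ∧
    ∀ x ∈ X, ∀ v : ℂ, v ≠ 0 → H (x, v) = (h₁ x + h₂ x * ((‖v‖ ^ (2 * a) : ℝ) : ℂ)) * v) ∧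
  (∃ g : ℝ → ℝ → ℂ, ∀ x ∈ X, ∀ v : ℂ, v ≠ 0 → G (x, v) = g x ‖v‖ * v) ∧
  ∀ x ∈ X, ∀ v : ℂ, v ≠ 0 →
    DifferentiableAt ℝ G (x, v) ∧ DifferentiableAt ℝ H (x, v) ∧ ResolvingSystem S n p k G H x v

/-- The invariant `x` of the group as a function of `(t, r)`. -/
def invX (S : SymmetryGroup) (t r : ℝ) : ℝ :=
  match S with
  | .timeTranslation => r
  | .scaling => t / r ^ 2
  | .inversion => t / r

/-- The first-order equations which relate `u` to `(G, H)` at `(t, r)`: the differential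
invariants of the group, evaluated on `u`, are `G(x, v)` and `H(x, v)`. -/
def FirstOrderEquations (S : SymmetryGroup) (n p : ℝ) (G H : ℝ × ℂ → ℂ) (u : ℝ → ℝ → ℂ)
    (t r : ℝ) : Prop :=
  let ut : ℂ := deriv (fun s => u s r) t
  let ur : ℂ := deriv (u t) r
  match S with
  | .timeTranslation => ut = G (r, u t r) ∧ ur = H (r, u t r)
  | .scaling =>
      let v : ℂ := ((r ^ (2 / p) : ℝ) : ℂ) * u t r
      ((r ^ (2 + 2 / p) : ℝ) : ℂ) * ut = G (t / r ^ 2, v) ∧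
      ((r ^ (1 + 2 / p) : ℝ) : ℂ) * ur = H (t / r ^ 2, v)
  | .inversion =>
      let E : ℂ := Complex.exp (Complex.I * ((r ^ 2 / (4 * t) : ℝ) : ℂ))
      let v : ℂ := ((r ^ (n / 2) : ℝ) : ℂ) * E * u t r
      ((r ^ (2 + n / 2) : ℝ) : ℂ) * E *
          (ut + ((r / t : ℝ) : ℂ) * ur
            + (((n / (2 * t) : ℝ) : ℂ) + Complex.I * ((r ^ 2 / (4 * t ^ 2) : ℝ) : ℂ)) * u t r) =
        G (t / r, v) ∧
      ((r ^ (1 + n / 2) : ℝ) : ℂ) * E * (ur + Complex.I * ((r / (2 * t) : ℝ) : ℂ) * u t r) =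
        H (t / r, v)

/-- Near every point of `Ω`, `u` is an integral of the first-order equations given by a
phase-equivariant separable solution of the group-resolving system. -/
def ArisesFrom (S : SymmetryGroup) (n p k : ℝ) (Ω : Set (ℝ × ℝ)) (u : ℝ → ℝ → ℂ) : Prop :=
  ∀ z ∈ Ω, ∃ (X : Set ℝ) (G H : ℝ × ℂ → ℂ), IsOpen X ∧ IsSeparableSolution S n p k X G H ∧
    ∀ᶠ y : ℝ × ℝ in 𝓝 z, invX S y.1 y.2 ∈ X ∧ u y.1 y.2 ≠ 0 ∧ FirstOrderEquations S n p G H u y.1 y.2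

/-- `u` solves the radial equation on `Ω` and arises from the group-resolving system of `S`. -/
def ExactSolution (S : SymmetryGroup) (n p k : ℝ) (Ω : Set (ℝ × ℝ)) (u : ℝ → ℝ → ℂ) : Prop :=
  IsRadialSolution n p k Ω u ∧ ArisesFrom S n p k Ω u

/-- `u = A exp(i Φ)` is an exact solution where `A > 0` in `Ω`. -/
def PolarSolution (S : SymmetryGroup) (n p k : ℝ) (Ω : Set (ℝ × ℝ)) (A Φ : ℝ → ℝ → ℝ) : Prop :=
  ExactSolution S n p k {z | z ∈ Ω ∧ 0 < A z.1 z.2}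
    (fun t r => (A t r : ℂ) * Complex.exp (Complex.I * (Φ t r : ℂ)))

/-! ### Integrals occurring in the solutions -/

/-- `f(x) (1 + c₅ ∫_{c₄}^x z⁻¹ f(z)⁻² dz)`. -/
def quadForm (f : ℝ → ℝ) (c₄ c₅ x : ℝ) : ℝ :=
  f x * (1 + c₅ * ∫ z in c₄..x, z⁻¹ * ((f z) ^ 2)⁻¹)

/-- The expression `f(x) (1 + c₅ ∫_{c₄}^x z⁻¹ f(z)⁻² dz)` makes sense at `x`: the integral
converges and `f(x) ≠ 0`, unless the integral is absent. -/
def QuadFormDefined (f : ℝ → ℝ) (c₄ c₅ x : ℝ) : Prop :=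
  c₅ = 0 ∨ (0 ≤ c₄ ∧ f x ≠ 0 ∧
    IntervalIntegrable (fun z => z⁻¹ * ((f z) ^ 2)⁻¹) volume c₄ x)

/-- `c₂ J_ν(√c₆ z) + c₃ Y_ν(√c₆ z)` as a function of `z`. -/
def cylJY (ν c₂ c₃ c₆ z : ℝ) : ℝ :=
  c₂ * besselJ ν (Real.sqrt c₆ * z) + c₃ * besselY ν (Real.sqrt c₆ * z)

/-- `c₂ I_ν(√c₆ z) + c₃ K_ν(√c₆ z)` as a function of `z`. -/
def cylIK (ν c₂ c₃ c₆ z : ℝ) : ℝ :=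
  c₂ * besselI ν (Real.sqrt c₆ * z) + c₃ * besselK ν (Real.sqrt c₆ * z)

/-- `(c₂ - c₃ ξ) sin ξ - (c₃ + c₂ ξ) cos ξ`. -/
def trigDen (c₂ c₃ ξ : ℝ) : ℝ :=
  (c₂ - c₃ * ξ) * Real.sin ξ - (c₃ + c₂ * ξ) * Real.cos ξ

/-- `(ξ²(c₂ Si ξ - c₃ Ci ξ) + (c₃ ξ - c₂) sin ξ + (c₂ ξ + c₃) cos ξ) / ((c₂ - c₃ ξ) sin ξ -
(c₃ + c₂ ξ) cos ξ)²`. -/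
def trigIntegrand (c₂ c₃ ξ : ℝ) : ℝ :=
  (ξ ^ 2 * (c₂ * sinIntegral ξ - c₃ * cosIntegral ξ) + (c₃ * ξ - c₂) * Real.sin ξ
      + (c₂ * ξ + c₃) * Real.cos ξ) / (trigDen c₂ c₃ ξ) ^ 2

/-- `Fi_L(η, ξ) = ∫_{c₆}^ξ z⁻² F_L(η, z) dz`. -/
def coulombFi (c₆ : ℝ) (L : ℕ) (η ξ : ℝ) : ℝ := ∫ z in c₆..ξ, (z ^ 2)⁻¹ * coulombF L η z

/-- `Gi_L(η, ξ) = ∫_{c₆}^ξ z⁻² G_L(η, z) dz`. -/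
def coulombGi (c₆ : ℝ) (L : ℕ) (η ξ : ℝ) : ℝ := ∫ z in c₆..ξ, (z ^ 2)⁻¹ * coulombG L η z

/-- `c₃ F₁(c₂, ξ) + c₄ G₁(c₂, ξ)`. -/
def coulombComb (c₂ c₃ c₄ ξ : ℝ) : ℝ := c₃ * coulombF 1 c₂ ξ + c₄ * coulombG 1 c₂ ξ

/-- `(c₃ Fi₁(c₂, ξ) + c₄ Gi₁(c₂, ξ)) / (c₃ F₁(c₂, ξ) + c₄ G₁(c₂, ξ))²`. -/
def coulombIntegrand (c₂ c₃ c₄ c₆ ξ : ℝ) : ℝ :=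
  (c₃ * coulombFi c₆ 1 c₂ ξ + c₄ * coulombGi c₆ 1 c₂ ξ) / (coulombComb c₂ c₃ c₄ ξ) ^ 2

end GNLS

end

open GNLS

/-! Everything is reduced to algebra with real functions of `x` and `ρ = |v|`. Write `G = (c + i d)
v` and `H = (a + i b) v` with real coefficients depending on `(x, ρ)`. Phase equivariance turns the
resolving system into four real equations (`ScalarSystem`), and for `u = A exp(iΦ)` the first-order
equations say that the logarithmic derivatives of `A` and the derivatives of `Φ` are given by `a`,
`b`, `c`, `d`. The radial equation then comes for free: differentiating the equation for `u_r` along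
a line `t = const` and inserting the second resolving equation produces it
(`radialEquation_of_firstOrder`). One local criterion, `IsExactAt.of_polar`, therefore serves every
family.

In the closed-form families the remaining dependence is expressed through a power `ρ^e` with a
constant `C`; once `k` is written in terms of `C`, the system is a polynomial identity in `ρ^e`.
Some families are pseudo-conformal images of others, which exist when the power required by the
original equals `4/n`: the condition `2(3-n)/(n-2) = 4/n` reads `n² = n + 4` (whence the square root
of 17), and `2/(2-n) = 4/n` reads `n = 4/3`.

For `p = -1` the nonlinearity `k u/|u|` is `k` times a phase, so in most of these families the
amplitude obeys a linear inhomogeneous second-order equation. With `a = α(x) + β(x)/ρ` the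
expression `a (a + ρ ∂a/∂ρ)` is affine in `1/ρ`, so the system splits into a Riccati equation for
`α` and a linear first-order equation for `β`. Any local solution `α` will do, and `β` is then
determined by the amplitude. This gives standing waves, their pseudo-conformal images for `n = -4`,
and self-similar solutions for `n = -4` (`isExactAt_standingWave`, `isExactAt_conformalWave`,
`isExactAt_selfSimilar`).

It remains to solve these linear equations. The amplitudes come from Bessel or Coulomb functions by
reduction of order and variation of constants. The equations of the special functions are proved
from their definitions: by power series for `J` and `I`, and for the others by differentiating under
the integral sign, where the differential operator turns the integrand into a total derivative whose
boundary terms vanish or cancel. -/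

namespace GNLS

/-! ### Local form of the notion of exact solution -/

/-- The radial equation at the point `(t, r)`. -/
def RadialEquation (n p k : ℝ) (u : ℝ → ℝ → ℂ) (t r : ℝ) : Prop :=
  Complex.I * deriv (fun s => u s r) t =
      deriv (deriv (u t)) r + ((n - 1 : ℝ) : ℂ) * deriv (u t) r / (r : ℂ)
        + (k : ℂ) * ((‖u t r‖ ^ p : ℝ) : ℂ) * u t r

/-- The local content of `ExactSolution` at a point. -/
structure IsExactAt (S : SymmetryGroup) (n p k : ℝ) (u : ℝ → ℝ → ℂ) (z : ℝ × ℝ) : Prop where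
  pos : 0 < z.2
  contDiffAt : ContDiffAt ℝ 2 (fun y : ℝ × ℝ => u y.1 y.2) z
  eqn : RadialEquation n p k u z.1 z.2
  arises : ∃ (X : Set ℝ) (G H : ℝ × ℂ → ℂ), IsOpen X ∧ IsSeparableSolution S n p k X G H ∧
    ∀ᶠ y : ℝ × ℝ in 𝓝 z,
      invX S y.1 y.2 ∈ X ∧ u y.1 y.2 ≠ 0 ∧ FirstOrderEquations S n p G H u y.1 y.2

/-- All clauses are local, openness of the domain included, so signs of bases and auxiliary
solutions of differential equations may be chosen afresh at each point. -/
theorem ExactSolution.of_isExactAt {S : SymmetryGroup} {n p k : ℝ} {Ω : Set (ℝ × ℝ)}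
    {u : ℝ → ℝ → ℂ} (h : ∀ z ∈ Ω, (∀ᶠ y in 𝓝 z, y ∈ Ω) ∧ IsExactAt S n p k u z) :
    ExactSolution S n p k Ω u :=
  ⟨⟨isOpen_iff_eventually.2 fun z hz => (h z hz).1, fun _ _ hz => (h _ hz).2.pos,
    fun z hz => (h z hz).2.contDiffAt.contDiffWithinAt, fun _ _ hz => (h _ hz).2.eqn⟩,
    fun z hz => (h z hz).2.arises⟩

theorem eventually_slice_left {P : ℝ × ℝ → Prop} {t r : ℝ} (h : ∀ᶠ y in 𝓝 (t, r), P y) :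
    ∀ᶠ s in 𝓝 t, P (s, r) :=
  (Continuous.prodMk_left r).continuousAt (x := t) |>.eventually h

theorem eventually_slice_right {P : ℝ × ℝ → Prop} {t r : ℝ} (h : ∀ᶠ y in 𝓝 (t, r), P y) :
    ∀ᶠ s in 𝓝 r, P (t, s) :=
  (Continuous.prodMk_right t).continuousAt (x := r) |>.eventually h

theorem IsExactAt.congr {S : SymmetryGroup} {n p k : ℝ} {u u' : ℝ → ℝ → ℂ} {z : ℝ × ℝ}
    (h : IsExactAt S n p k u z) (e : ∀ᶠ y in 𝓝 z, u' y.1 y.2 = u y.1 y.2) :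
    IsExactAt S n p k u' z := by
  -- First derivatives must agree at all points near `z`, not only at `z`: the second radial
  -- derivative and the first-order equations both need it.
  have key : ∀ᶠ y in 𝓝 z, u' y.1 y.2 = u y.1 y.2 ∧
      deriv (fun s => u' s y.2) y.1 = deriv (fun s => u s y.2) y.1 ∧
      deriv (u' y.1) y.2 = deriv (u y.1) y.2 := by
    filter_upwards [e.eventually_nhds] with y hy
    exact ⟨hy.self_of_nhds,
      Filter.EventuallyEq.deriv_eq (eventually_slice_left (t := y.1) (r := y.2) hy),
      Filter.EventuallyEq.deriv_eq (eventually_slice_right (t := y.1) (r := y.2) hy)⟩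
  refine ⟨h.pos, h.contDiffAt.congr_of_eventuallyEq e, ?_, ?_⟩
  · obtain ⟨k0, k1, k2⟩ := key.self_of_nhds
    have k3 : deriv (deriv (u' z.1)) z.2 = deriv (deriv (u z.1)) z.2 :=
      Filter.EventuallyEq.deriv_eq ((eventually_slice_right (t := z.1) (r := z.2) key).mono
        fun s hs => hs.2.2)
    have := h.eqn
    simp only [RadialEquation] at this ⊢
    rw [k0, k1, k2, k3, this]
  · obtain ⟨X, G, H, hX, hs, he⟩ := h.arises
    refine ⟨X, G, H, hX, hs, ?_⟩
    filter_upwards [he, key] with y hy hk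
    refine ⟨hy.1, hk.1 ▸ hy.2.1, ?_⟩
    have := hy.2.2
    simp only [FirstOrderEquations] at this ⊢
    rw [hk.1, hk.2.1, hk.2.2]
    exact this

/-! ### The radial equation follows from the resolving system -/

theorem fderiv_apply_eq (H : ℝ × ℂ → ℂ) (x a : ℝ) (v w : ℂ) :
    fderiv ℝ H (x, v) (a, w) = (a : ℂ) * dx H x v + dv H x v w := by
  have : ((a, w) : ℝ × ℂ) = a • ((1, 0) : ℝ × ℂ) + (0, w) := by simp
  rw [this, map_add, map_smul, dx, dv, Complex.real_smul]

theorem dv_add (H : ℝ × ℂ → ℂ) (x : ℝ) (v w w' : ℂ) :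
    dv H x v (w + w') = dv H x v w + dv H x v w' := by
  have : ((0, w + w') : ℝ × ℂ) = (0, w) + (0, w') := by simp
  rw [dv, this, map_add, dv, dv]

theorem dv_smul (H : ℝ × ℂ → ℂ) (x a : ℝ) (v w : ℂ) :
    dv H x v ((a : ℂ) * w) = (a : ℂ) * dv H x v w := by
  have : ((0, (a : ℂ) * w) : ℝ × ℂ) = a • ((0, w) : ℝ × ℂ) := by
    ext <;> simp
  rw [dv, this, map_smul, dv, Complex.real_smul]

theorem hasDerivAt_comp_pair {H : ℝ × ℂ → ℂ} {X : ℝ → ℝ} {V : ℝ → ℂ} {r X' : ℝ} {V' : ℂ}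
    (hH : DifferentiableAt ℝ H (X r, V r)) (hX : HasDerivAt X X' r) (hV : HasDerivAt V V' r) :
    HasDerivAt (fun s => H (X s, V s)) ((X' : ℂ) * dx H (X r) (V r) + dv H (X r) (V r) V') r := by
  have := hH.hasFDerivAt.comp_hasDerivAt_of_eq r (hX.prodMk hV) rfl
  rwa [fderiv_apply_eq] at this

theorem hasDerivAt_ofReal_rpow {r : ℝ} (hr : 0 < r) (q : ℝ) :
    HasDerivAt (fun s : ℝ => ((s ^ q : ℝ) : ℂ)) ((q * r ^ (q - 1) : ℝ) : ℂ) r :=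
  (Real.hasDerivAt_rpow_const (Or.inl hr.ne')).ofReal_comp

/-- Along the line `t = const` the equation for `u_r` is an identity in `r`, so it can be
differentiated. The chain rule expresses `u_rr` by `H_x` and by directional derivatives of `H` along
`v` and `H`; the second resolving equation trades exactly these for `iG`, that is, for `i u_t`. -/
theorem radialEquation_of_firstOrder {S : SymmetryGroup} {n p k : ℝ} {u : ℝ → ℝ → ℂ} {t r : ℝ}
    (hp : p ≠ 0) (hinv : S = .inversion → p = 4 / n) (ht : S = .inversion → t ≠ 0) (hr : 0 < r)
    (hu : ContDiffAt ℝ 2 (fun y : ℝ × ℝ => u y.1 y.2) (t, r))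
    {X : Set ℝ} {G H : ℝ × ℂ → ℂ} (hs : IsSeparableSolution S n p k X G H)
    (he : ∀ᶠ y : ℝ × ℝ in 𝓝 (t, r),
      invX S y.1 y.2 ∈ X ∧ u y.1 y.2 ≠ 0 ∧ FirstOrderEquations S n p G H u y.1 y.2) :
    RadialEquation n p k u t r := by
  have hu2 : ContDiffAt ℝ 2 (u t) r :=
    ContDiffAt.comp (f := fun s : ℝ => (t, s)) r hu (contDiffAt_const.prodMk contDiffAt_id)
  have hD : HasDerivAt (u t) (deriv (u t) r) r := (hu2.differentiableAt (by norm_num)).hasDerivAt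
  have hDD : HasDerivAt (deriv (u t)) (deriv (deriv (u t)) r) r := by
    have h1 : ContDiffAt ℝ 1 (deriv (u t)) r := by
      have := (hu2.fderiv_right (m := 1) (by norm_num)).clm_apply (contDiffAt_const (c := (1 : ℝ)))
      simpa using this
    exact (h1.differentiableAt (by norm_num)).hasDerivAt
  have hrC : (r : ℂ) ≠ 0 := by exact_mod_cast hr.ne'
  have hline := eventually_slice_right he
  have h0 := he.self_of_nhds
  cases S with
  | timeTranslation =>
    obtain ⟨hx, hne, h1, h2⟩ := h0
    change r ∈ X at hx
    obtain ⟨-, dH, -, e2⟩ := hs.2.2 _ hx _ hne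
    have hc := hasDerivAt_comp_pair (X := fun s => s) dH (hasDerivAt_id r) hD
    have hev : deriv (u t) =ᶠ[𝓝 r] fun s => H (s, u t s) := by
      filter_upwards [hline] with s hs using hs.2.2.2
    have := (hc.congr_of_eventuallyEq hev).unique hDD
    simp only [RadialEquation]
    rw [← this, h1, h2]
    push_cast at e2 ⊢
    linear_combination e2
  | scaling =>
    obtain ⟨hx, hne, h1, h2⟩ := h0
    change t / r ^ 2 ∈ X at hx
    have hQ0 : 0 < r ^ (2 / p) := Real.rpow_pos_of_pos hr _
    have hQ : ((r ^ (2 / p) : ℝ) : ℂ) ≠ 0 := by exact_mod_cast hQ0.ne'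
    obtain ⟨-, dH, -, e2⟩ := hs.2.2 _ hx (((r ^ (2 / p) : ℝ) : ℂ) * u t r) (mul_ne_zero hQ hne)
    have hX : HasDerivAt (fun s : ℝ => t / s ^ 2) (-2 * (t / r ^ 2) / r) r := by
      refine ((hasDerivAt_const r t).div ((hasDerivAt_id r).pow 2)
        (by simp [hr.ne'])).congr_deriv ?_
      simp; field_simp
    have hV := (hasDerivAt_ofReal_rpow hr (2 / p)).mul hD
    have hc := hasDerivAt_comp_pair (X := fun s => t / s ^ 2) dH hX hV
    have hl := (hasDerivAt_ofReal_rpow hr (1 + 2 / p)).mul hDD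
    have hev : (fun s => ((s ^ (1 + 2 / p) : ℝ) : ℂ) * deriv (u t) s) =ᶠ[𝓝 r]
        fun s => H (t / s ^ 2, ((s ^ (2 / p) : ℝ) : ℂ) * u t s) := by
      filter_upwards [hline] with s hs using hs.2.2.2
    have hE := (hc.congr_of_eventuallyEq hev).unique hl
    have p1 : r ^ (1 + 2 / p) = r * r ^ (2 / p) := by rw [Real.rpow_add hr, Real.rpow_one]
    have p2 : r ^ (2 + 2 / p) = r ^ 2 * r ^ (2 / p) := by
      rw [Real.rpow_add hr]; norm_num
    have p3 : r ^ (2 / p - 1) = r ^ (2 / p) / r := Real.rpow_sub_one hr.ne' _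
    have p4 : r ^ (1 + 2 / p - 1) = r ^ (2 / p) := by congr 1; ring
    -- The weight `2/p` is chosen so that the nonlinearity acquires the factor `r²`, the same as the
    -- other terms.
    have p5 : ‖((r ^ (2 / p) : ℝ) : ℂ) * u t r‖ ^ p = r ^ 2 * ‖u t r‖ ^ p := by
      rw [norm_mul, Complex.norm_real, Real.norm_of_nonneg hQ0.le,
        Real.mul_rpow hQ0.le (norm_nonneg _), ← Real.rpow_mul hr.le]
      congr 1
      rw [div_mul_cancel₀ _ hp]; norm_num
    rw [p1] at h2
    rw [p2] at h1
    rw [p5, ← h1, ← h2] at e2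
    -- The derivative of `v` along the line is `((2/p) v + H)/r`, so its image under the derivative
    -- of `H` consists of the Euler term and the quadratic term of the system.
    have hV' : ((2 / p * r ^ (2 / p - 1) : ℝ) : ℂ) * u t r + ((r ^ (2 / p) : ℝ) : ℂ) * deriv (u t) r
        = ((r⁻¹ : ℝ) : ℂ) * (((2 / p : ℝ) : ℂ) * (((r ^ (2 / p) : ℝ) : ℂ) * u t r)
          + ((r * r ^ (2 / p) : ℝ) : ℂ) * deriv (u t) r) := by
      rw [p3]; push_cast; field_simp
    rw [hV', dv_smul, dv_add, dv_smul, p4, p1] at hE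
    simp only [RadialEquation]
    generalize dv H (t / r ^ 2) (↑(r ^ (2 / p)) * u t r)
      (↑(r * r ^ (2 / p)) * deriv (u t) r) = a1 at *
    generalize dv H (t / r ^ 2) (↑(r ^ (2 / p)) * u t r) (↑(r ^ (2 / p)) * u t r) = a2 at *
    generalize dx H (t / r ^ 2) (↑(r ^ (2 / p)) * u t r) = a3 at *
    generalize t / r ^ 2 = x at *
    generalize r ^ (2 / p) = Q at *
    generalize 2 / p = q at *
    generalize ‖u t r‖ ^ p = N at *
    have hm : (r : ℂ) ^ 2 * (Q : ℂ) ≠ 0 := mul_ne_zero (pow_ne_zero 2 hrC) hQ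
    apply mul_left_cancel₀ hm
    push_cast at e2 hE ⊢
    have hi : (r : ℂ) * (r : ℂ)⁻¹ = 1 := mul_inv_cancel₀ hrC
    simp only [div_eq_mul_inv] at hE ⊢
    linear_combination e2 + (r : ℂ) * hE - (-2 * x * a3 + q * a2 + a1) * hi
      - r * Q * (n - 1) * deriv (u t) r * hi
  | inversion =>
    obtain ⟨hx, hne, h1, h2⟩ := h0
    change t / r ∈ X at hx
    have ht0 := ht rfl
    have htC : (t : ℂ) ≠ 0 := by exact_mod_cast ht0
    have hp4 := hinv rfl
    have hn0 : n ≠ 0 := by rintro rfl; simp [hp4] at hp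
    have hQ0 : 0 < r ^ (n / 2) := Real.rpow_pos_of_pos hr _
    have hQ : ((r ^ (n / 2) : ℝ) : ℂ) ≠ 0 := by exact_mod_cast hQ0.ne'
    set E : ℝ → ℂ := fun s => Complex.exp (Complex.I * ((s ^ 2 / (4 * t) : ℝ) : ℂ)) with hEdef
    have hEr : HasDerivAt E (E r * (Complex.I * ((r / (2 * t) : ℝ) : ℂ))) r := by
      have h1 : HasDerivAt (fun s : ℝ => s ^ 2 / (4 * t)) (r / (2 * t)) r := by
        refine (((hasDerivAt_id r).pow 2).div_const (4 * t)).congr_deriv ?_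
        simp; field_simp; norm_num
      exact (h1.ofReal_comp.const_mul Complex.I).cexp
    have hnE : E r ≠ 0 := Complex.exp_ne_zero _
    have hnormE : ‖E r‖ = 1 := by
      simp only [hEdef]; rw [mul_comm, Complex.norm_exp_ofReal_mul_I]
    obtain ⟨-, dH, -, e2⟩ := hs.2.2 _ hx (((r ^ (n / 2) : ℝ) : ℂ) * E r * u t r)
      (mul_ne_zero (mul_ne_zero hQ hnE) hne)
    have hX : HasDerivAt (fun s : ℝ => t / s) (-(t / r) / r) r := by
      refine ((hasDerivAt_const r t).div (hasDerivAt_id r) (by simp [hr.ne'])).congr_deriv ?_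
      simp; field_simp
    have hV := ((hasDerivAt_ofReal_rpow hr (n / 2)).mul hEr).mul hD
    have hc := hasDerivAt_comp_pair (X := fun s => t / s) dH hX hV
    have hlin : HasDerivAt (fun s : ℝ => Complex.I * ((s / (2 * t) : ℝ) : ℂ))
        (Complex.I * ((1 / (2 * t) : ℝ) : ℂ)) r :=
      (((hasDerivAt_id r).div_const (2 * t)).ofReal_comp).const_mul Complex.I
    have hl := ((hasDerivAt_ofReal_rpow hr (1 + n / 2)).mul hEr).mul (hDD.add (hlin.mul hD))
    have hev : (fun s => ((s ^ (1 + n / 2) : ℝ) : ℂ) * E s *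
        (deriv (u t) s + Complex.I * ((s / (2 * t) : ℝ) : ℂ) * u t s)) =ᶠ[𝓝 r]
        fun s => H (t / s, ((s ^ (n / 2) : ℝ) : ℂ) * E s * u t s) := by
      filter_upwards [hline] with s hs using hs.2.2.2
    have hE := (hc.congr_of_eventuallyEq hev).unique hl
    have p1 : r ^ (1 + n / 2) = r * r ^ (n / 2) := by rw [Real.rpow_add hr, Real.rpow_one]
    have p2 : r ^ (2 + n / 2) = r ^ 2 * r ^ (n / 2) := by
      rw [Real.rpow_add hr]; norm_num
    have p3 : r ^ (n / 2 - 1) = r ^ (n / 2) / r := Real.rpow_sub_one hr.ne' _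
    have p4 : r ^ (1 + n / 2 - 1) = r ^ (n / 2) := by congr 1; ring
    have p5 : ‖((r ^ (n / 2) : ℝ) : ℂ) * E r * u t r‖ ^ (4 / n) = r ^ 2 * ‖u t r‖ ^ p := by
      rw [norm_mul, norm_mul, hnormE, mul_one, Complex.norm_real, Real.norm_of_nonneg hQ0.le,
        Real.mul_rpow hQ0.le (norm_nonneg _), ← Real.rpow_mul hr.le, hp4]
      congr 1
      have : n / 2 * (4 / n) = 2 := by field_simp; norm_num
      rw [this]; norm_num
    rw [p1] at h2
    rw [p2] at h1
    change _ = G (t / r, ((r ^ (n / 2) : ℝ) : ℂ) * E r * u t r) at h1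
    change _ = H (t / r, ((r ^ (n / 2) : ℝ) : ℂ) * E r * u t r) at h2
    rw [p5, ← h1, ← h2] at e2
    change _ * E r * _ = _ at h1 h2
    -- As in the scaling case; the derivative of the phase `E` completes `u_r` to the invariant
    -- combination `u_r + (i r/2t) u`.
    have hV' : (((n / 2 * r ^ (n / 2 - 1) : ℝ) : ℂ) * E r + ((r ^ (n / 2) : ℝ) : ℂ) *
          (E r * (Complex.I * ((r / (2 * t) : ℝ) : ℂ)))) * u t r
          + ((r ^ (n / 2) : ℝ) : ℂ) * E r * deriv (u t) r
        = ((r⁻¹ : ℝ) : ℂ) * (((n / 2 : ℝ) : ℂ) * (((r ^ (n / 2) : ℝ) : ℂ) * E r * u t r)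
          + ((r * r ^ (n / 2) : ℝ) : ℂ) * E r *
            (deriv (u t) r + Complex.I * ((r / (2 * t) : ℝ) : ℂ) * u t r)) := by
      rw [p3]; push_cast; field_simp; ring
    simp only [Pi.mul_apply, Pi.add_apply] at hE
    rw [hV', dv_smul, dv_add, dv_smul, p4, p1] at hE
    simp only [RadialEquation]
    change _ * (_ * E r * _) + _ * (_ * E r * _) + _ - _ - _ = _ at e2
    generalize dv H (t / r) (↑(r ^ (n / 2)) * E r * u t r) (↑(r * r ^ (n / 2)) * E r *
      (deriv (u t) r + Complex.I * ((r / (2 * t) : ℝ) : ℂ) * u t r)) = a1 at *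
    generalize dv H (t / r) (↑(r ^ (n / 2)) * E r * u t r) (↑(r ^ (n / 2)) * E r * u t r) = a2 at *
    generalize dx H (t / r) (↑(r ^ (n / 2)) * E r * u t r) = a3 at *
    generalize r ^ (n / 2) = Q at *
    generalize E r = Er at *
    generalize ‖u t r‖ ^ p = N at *
    have hm : (r : ℂ) ^ 2 * (Q : ℂ) * Er ≠ 0 := mul_ne_zero (mul_ne_zero (pow_ne_zero 2 hrC) hQ) hnE
    apply mul_left_cancel₀ hm
    push_cast at e2 hE ⊢
    have hi : (r : ℂ) * (r : ℂ)⁻¹ = 1 := mul_inv_cancel₀ hrC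
    simp only [div_eq_mul_inv, mul_inv] at e2 hE ⊢
    linear_combination e2 + (r : ℂ) * hE - (-(t * (r : ℂ)⁻¹) * a3 + n * 2⁻¹ * a2 + a1) * hi
      - r * Q * Er * (n - 1) * deriv (u t) r * hi

/-! ### Reduction of the resolving system to real functions of `x` and `|v|` -/

/-- `f` is differentiable at `(x, ρ)` with value `j₀`, `∂f/∂x = jx` and `ρ ∂f/∂ρ = je`. -/
structure HasJet (f : ℝ → ℝ → ℝ) (x ρ j₀ jx je : ℝ) : Prop where
  val : f x ρ = j₀
  hasFDerivAt : HasFDerivAt (fun y : ℝ × ℝ => f y.1 y.2)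
    (jx • ContinuousLinearMap.fst ℝ ℝ ℝ + (je / ρ) • ContinuousLinearMap.snd ℝ ℝ ℝ) (x, ρ)

theorem HasJet.of_hasDerivAt {f : ℝ → ℝ} {f' x ρ : ℝ} (h : HasDerivAt f f' x) :
    HasJet (fun x _ => f x) x ρ (f x) f' 0 := by
  refine ⟨rfl, ?_⟩
  have := h.hasFDerivAt.comp (x, ρ) (hasFDerivAt_fst (𝕜 := ℝ) (E := ℝ) (F := ℝ) (p := (x, ρ)))
  refine this.congr_fderiv ?_
  ext <;> simp

theorem HasJet.mul_rpow {f : ℝ → ℝ} {f' x ρ : ℝ} (h : HasDerivAt f f' x) (hρ : 0 < ρ) (b : ℝ) :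
    HasJet (fun x ρ => f x * ρ ^ b) x ρ (f x * ρ ^ b) (f' * ρ ^ b) (b * f x * ρ ^ b) := by
  refine ⟨rfl, ?_⟩
  have h1 := h.hasFDerivAt.comp (x, ρ) (hasFDerivAt_fst (𝕜 := ℝ) (E := ℝ) (F := ℝ) (p := (x, ρ)))
  have h2 := (Real.hasDerivAt_rpow_const (x := ρ) (p := b)
    (Or.inl hρ.ne')).hasFDerivAt.comp (x, ρ)
    (hasFDerivAt_snd (𝕜 := ℝ) (E := ℝ) (F := ℝ) (p := (x, ρ)))
  refine (h1.mul h2).congr_fderiv ?_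
  ext
  · simp [mul_comm]
  · simp [Real.rpow_sub_one hρ.ne']; field_simp

theorem HasJet.add {f g : ℝ → ℝ → ℝ} {x ρ f₀ fx fe g₀ gx ge : ℝ} (hf : HasJet f x ρ f₀ fx fe)
    (hg : HasJet g x ρ g₀ gx ge) :
    HasJet (fun x ρ => f x ρ + g x ρ) x ρ (f₀ + g₀) (fx + gx) (fe + ge) := by
  refine ⟨by simp [hf.val, hg.val], (hf.hasFDerivAt.add hg.hasFDerivAt).congr_fderiv ?_⟩
  ext
  · simp
  · simp [add_div]

/-- The function `(f(x, |v|) + i g(x, |v|)) v`. -/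
noncomputable def equivariant (f g : ℝ → ℝ → ℝ) (y : ℝ × ℂ) : ℂ :=
  ((f y.1 ‖y.2‖ : ℂ) + Complex.I * (g y.1 ‖y.2‖ : ℂ)) * y.2

/-- Differentiating `‖w‖²` in two ways and cancelling `2‖v‖` gives the derivative of the norm.
Directions are written `ω v` because every direction in the resolving system is a complex multiple
of `v`. -/
theorem exists_hasFDerivAt_norm {v : ℂ} (hv : v ≠ 0) : ∃ N : ℂ →L[ℝ] ℝ,
    HasFDerivAt (fun w : ℂ => ‖w‖) N v ∧ ∀ ω : ℂ, N (ω * v) = ω.re * ‖v‖ := by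
  have hd : DifferentiableAt ℝ (fun w : ℂ => ‖w‖) v :=
    (contDiffAt_norm (n := 1) ℝ hv).differentiableAt (by norm_num)
  refine ⟨_, hd.hasFDerivAt, fun ω => ?_⟩
  have h1 := (hasStrictFDerivAt_norm_sq (F := ℂ) v).hasFDerivAt
  have h2 := hd.hasFDerivAt.pow 2
  have h3 := congrArg (fun L : ℂ →L[ℝ] ℝ => L (ω * v)) (h2.unique h1)
  have hn : ‖v‖ ≠ 0 := norm_ne_zero_iff.2 hv
  simp [Complex.inner] at h3
  have h4 : ‖v‖ ^ 2 = v.re * v.re + v.im * v.im := by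
    rw [← Complex.normSq_eq_norm_sq, Complex.normSq_apply]
  apply mul_left_cancel₀ hn
  linear_combination h3 / 2 - ω.re * h4

/-- For `(f + i g) v` a displacement `ω v` moves the factor `v` by `ω v` and changes `ρ = |v|` at
the relative rate `Re ω`, which multiplies the Euler derivatives. -/
theorem equivariant_deriv {f g : ℝ → ℝ → ℝ} {x f₀ fx fe g₀ gx ge : ℝ} {v : ℂ} (hv : v ≠ 0)
    (hf : HasJet f x ‖v‖ f₀ fx fe) (hg : HasJet g x ‖v‖ g₀ gx ge) :
    DifferentiableAt ℝ (equivariant f g) (x, v) ∧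
    equivariant f g (x, v) = (f₀ + Complex.I * g₀) * v ∧
    dx (equivariant f g) x v = (fx + Complex.I * gx) * v ∧
    ∀ ω : ℂ, dv (equivariant f g) x v (ω * v) =
      ((f₀ + Complex.I * g₀) * ω + (fe + Complex.I * ge) * ω.re) * v := by
  obtain ⟨N, hN, hNω⟩ := exists_hasFDerivAt_norm hv
  have hn : ‖v‖ ≠ 0 := norm_ne_zero_iff.2 hv
  have hnC : (‖v‖ : ℂ) ≠ 0 := by exact_mod_cast hn
  have hpair : HasFDerivAt (fun y : ℝ × ℂ => (y.1, ‖y.2‖))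
      ((ContinuousLinearMap.fst ℝ ℝ ℂ).prod (N.comp (ContinuousLinearMap.snd ℝ ℝ ℂ))) (x, v) :=
    hasFDerivAt_fst.prodMk (hN.comp (x, v) hasFDerivAt_snd)
  have h1 := (Complex.ofRealCLM.hasFDerivAt).comp (x, v) (hf.hasFDerivAt.comp (x, v) hpair)
  have h2 := (Complex.ofRealCLM.hasFDerivAt).comp (x, v) (hg.hasFDerivAt.comp (x, v) hpair)
  have h3 := (h1.add (h2.const_mul Complex.I)).mul
    (hasFDerivAt_snd (𝕜 := ℝ) (E := ℝ) (F := ℂ) (p := (x, v)))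
  have h4 : HasFDerivAt (equivariant f g) _ (x, v) := h3
  refine ⟨h4.differentiableAt, by simp [equivariant, hf.val, hg.val], ?_, fun ω => ?_⟩
  · rw [dx, h4.fderiv]
    simp
    ring
  · rw [dv, h4.fderiv]
    simp [hf.val, hg.val, hNω]
    field_simp

/-- Coefficients of the three resolving systems in a common form. -/
noncomputable def coeffScale : SymmetryGroup → ℝ
  | .timeTranslation => 0
  | .scaling => 2
  | .inversion => 2

/-- The coefficient of `H_x` in the first equation of the resolving system. -/
noncomputable def coeffMixed : SymmetryGroup → ℝ
  | .timeTranslation => 0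
  | .scaling => 1
  | .inversion => 0

/-- The coefficient of `H_x` in the second equation of the resolving system. -/
noncomputable def coeffX : SymmetryGroup → ℝ → ℝ
  | .timeTranslation, _ => -1
  | .scaling, x => 2 * x
  | .inversion, x => x

/-- The coefficient of the Euler operator in the resolving system. -/
noncomputable def coeffEuler : SymmetryGroup → ℝ → ℝ → ℝ
  | .timeTranslation, _, _ => 0
  | .scaling, _, p => 2 / p
  | .inversion, n, _ => n / 2

/-- The coefficient of `η` in the second equation for `H = η v`. -/
noncomputable def coeffRadial : SymmetryGroup → ℝ → ℝ → ℝ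
  | .timeTranslation, n, x => -(n - 1) / x
  | .scaling, n, _ => 2 - n
  | .inversion, n, _ => 2 - n

/-- The resolving system at `|v| = ρ` for `G = (c + i d) v`, `H = (a + i b) v`; the letters with
indices `x` and `e` stand for the derivatives `∂/∂x` and `ρ ∂/∂ρ`. -/
structure ScalarSystem (S : SymmetryGroup) (n p k x ρ a ax ae b bx be c cx ce d dx' de : ℝ) :
    Prop where
  compat_re : coeffScale S * c + coeffMixed S * ax + coeffX S x * cx - coeffEuler S n p * ce
    + c * ae - a * ce = 0
  compat_im : coeffScale S * d + coeffMixed S * bx + coeffX S x * dx' - coeffEuler S n p * de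
    + c * be - a * de = 0
  eqn_re : -d + coeffRadial S n x * a + coeffX S x * ax - coeffEuler S n p * ae
    - (a ^ 2 - b ^ 2) - a * ae = k * ρ ^ p
  eqn_im : c + coeffRadial S n x * b + coeffX S x * bx - coeffEuler S n p * be
    - 2 * a * b - a * be = 0

/-- Dividing by `v` and separating real and imaginary parts gives the four equations. In the
compatibility equation the products of the coefficients of `G` and `H` cancel by commutativity, so
only Euler derivatives survive in the bracket. -/
theorem ScalarSystem.resolving {S : SymmetryGroup} {n p k x : ℝ} {v : ℂ}
    (hinv : S = .inversion → p = 4 / n) (hv : v ≠ 0)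
    {a b c d : ℝ → ℝ → ℝ} {a₀ ax ae b₀ bx be c₀ cx ce d₀ dx' de : ℝ}
    (ha : HasJet a x ‖v‖ a₀ ax ae) (hb : HasJet b x ‖v‖ b₀ bx be)
    (hc : HasJet c x ‖v‖ c₀ cx ce) (hd : HasJet d x ‖v‖ d₀ dx' de)
    (h : ScalarSystem S n p k x ‖v‖ a₀ ax ae b₀ bx be c₀ cx ce d₀ dx' de) :
    DifferentiableAt ℝ (equivariant c d) (x, v) ∧ DifferentiableAt ℝ (equivariant a b) (x, v) ∧
      ResolvingSystem S n p k (equivariant c d) (equivariant a b) x v := by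
  obtain ⟨hG1, hG2, hG3, hG4⟩ := equivariant_deriv hv hc hd
  obtain ⟨hH1, hH2, hH3, hH4⟩ := equivariant_deriv hv ha hb
  refine ⟨hG1, hH1, ?_⟩
  -- Taking `ω = 1` evaluates the Euler operator on `v`. Besides the `ρ ∂/∂ρ` terms it returns the
  -- undifferentiated coefficients, which is why `coeffScale` is `2` and `coeffRadial` is `2 - n`
  -- for both scaling and inversion.
  have hG5 := hG4 1
  have hH5 := hH4 1
  rw [one_mul] at hG5 hH5
  obtain ⟨e1, e2, e3, e4⟩ := h
  have f1 := congrArg (fun y : ℝ => (y : ℂ)) e1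
  have f2 := congrArg (fun y : ℝ => (y : ℂ)) e2
  have f3 := congrArg (fun y : ℝ => (y : ℂ)) e3
  have f4 := congrArg (fun y : ℝ => (y : ℂ)) e4
  cases S with
  | timeTranslation =>
    simp only [coeffScale, coeffMixed, coeffX, coeffEuler, coeffRadial] at f1 f2 f3 f4
    simp only [ResolvingSystem, hG2, hH2, hG3, hH3, hG4, hH4]
    simp
    push_cast at f1 f2 f3 f4
    constructor
    -- For time translations the common form is the negative of the first resolving equation, since
    -- `coeffX` is `-1`.
    · linear_combination (-v) * f1 - Complex.I * v * f2
    · linear_combination v * f3 + Complex.I * v * f4 + v * (d₀ - b₀ ^ 2) * (Complex.I_sq)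
  | scaling =>
    simp only [coeffScale, coeffMixed, coeffX, coeffEuler, coeffRadial] at f1 f2 f3 f4
    simp only [ResolvingSystem, hG2, hH2, hG3, hH3, hG4, hH4, hG5, hH5]
    simp
    push_cast at f1 f2 f3 f4
    constructor
    · linear_combination v * f1 + Complex.I * v * f2
    · linear_combination v * f3 + Complex.I * v * f4 + v * (d₀ - b₀ ^ 2) * (Complex.I_sq)
  | inversion =>
    rw [hinv rfl] at f3
    simp only [coeffScale, coeffMixed, coeffX, coeffEuler, coeffRadial] at f1 f2 f3 f4
    simp only [ResolvingSystem, hG2, hH2, hG3, hH3, hG4, hH4, hG5, hH5]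
    simp
    push_cast at f1 f2 f3 f4
    constructor
    · linear_combination v * f1 + Complex.I * v * f2
    · linear_combination v * f3 + Complex.I * v * f4 + v * (d₀ - b₀ ^ 2) * (Complex.I_sq)

/-- The first-order equations for `u = A exp(iΦ)` given by `G = (c + i d) v`, `H = (a + i b) v`. -/
noncomputable def PolarFirstOrder (S : SymmetryGroup) (n p : ℝ) (a b c d A Φ : ℝ → ℝ → ℝ) (t r : ℝ) : Prop :=
  ∃ At Ar Φt Φr : ℝ, HasDerivAt (fun s => A s r) At t ∧ HasDerivAt (A t) Ar r ∧
    HasDerivAt (fun s => Φ s r) Φt t ∧ HasDerivAt (Φ t) Φr r ∧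
    match S with
    | .timeTranslation =>
        At = c r (A t r) * A t r ∧ Φt = d r (A t r) ∧ Ar = a r (A t r) * A t r ∧ Φr = b r (A t r)
    | .scaling =>
        let x := t / r ^ 2
        let ρ := r ^ (2 / p) * A t r
        r ^ 2 * At = c x ρ * A t r ∧ r ^ 2 * Φt = d x ρ ∧ r * Ar = a x ρ * A t r ∧ r * Φr = b x ρ
    | .inversion =>
        let x := t / r
        let ρ := r ^ (n / 2) * A t r
        r ^ 2 * (At + r / t * Ar + n / (2 * t) * A t r) = c x ρ * A t r ∧
        r ^ 2 * (Φt + r / t * Φr + r ^ 2 / (4 * t ^ 2)) = d x ρ ∧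
        r * Ar = a x ρ * A t r ∧ r * (Φr + r / (2 * t)) = b x ρ

/-- The common factor `exp(iΦ)` has modulus one, and `A > 0`, so `|v|` is the real quantity `ρ` at
which the coefficients are evaluated; the rest is the product rule. -/
theorem PolarFirstOrder.firstOrderEquations {S : SymmetryGroup} {n p : ℝ}
    {a b c d A Φ : ℝ → ℝ → ℝ} {t r : ℝ} (hr : 0 < r) (hA : 0 < A t r)
    (h : PolarFirstOrder S n p a b c d A Φ t r) :
    FirstOrderEquations S n p (equivariant c d) (equivariant a b)
      (fun t r => (A t r : ℂ) * Complex.exp (Complex.I * (Φ t r : ℂ))) t r := by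
  obtain ⟨At, Ar, Φt, Φr, hAt, hAr, hΦt, hΦr, h⟩ := h
  have dt := (hAt.ofReal_comp.mul (hΦt.ofReal_comp.const_mul Complex.I).cexp).deriv
  have dr := (hAr.ofReal_comp.mul (hΦr.ofReal_comp.const_mul Complex.I).cexp).deriv
  have dt' : deriv (fun s => (A s r : ℂ) * Complex.exp (Complex.I * (Φ s r : ℂ))) t = _ := dt
  have dr' : deriv (fun s => (A t s : ℂ) * Complex.exp (Complex.I * (Φ t s : ℂ))) r = _ := dr
  have hE : ‖Complex.exp (Complex.I * (Φ t r : ℂ))‖ = 1 := by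
    rw [mul_comm, Complex.norm_exp_ofReal_mul_I]
  have hA' : ‖(A t r : ℂ)‖ = A t r := by rw [Complex.norm_real, Real.norm_of_nonneg hA.le]
  simp only [FirstOrderEquations]
  rw [dt', dr']
  generalize Complex.exp (Complex.I * (Φ t r : ℂ)) = E at *
  cases S with
  | timeTranslation =>
    simp only at h
    obtain ⟨h1, h2, h3, h4⟩ := h
    simp only [equivariant, norm_mul, hE, hA', mul_one]
    rw [← h2, ← h4, h1, h3]
    push_cast
    constructor <;> ring
  | scaling =>
    simp only at h
    obtain ⟨h1, h2, h3, h4⟩ := h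
    have hQ0 : 0 < r ^ (2 / p) := Real.rpow_pos_of_pos hr _
    have hQ : ‖((r ^ (2 / p) : ℝ) : ℂ)‖ = r ^ (2 / p) := by
      rw [Complex.norm_real, Real.norm_of_nonneg hQ0.le]
    have p1 : r ^ (1 + 2 / p) = r * r ^ (2 / p) := by rw [Real.rpow_add hr, Real.rpow_one]
    have p2 : r ^ (2 + 2 / p) = r ^ 2 * r ^ (2 / p) := by
      rw [Real.rpow_add hr]; norm_num
    simp only [equivariant, norm_mul, hE, hA', hQ, mul_one]
    rw [p1, p2, ← h2, ← h4]
    have f1 := congrArg (fun y : ℝ => (y : ℂ)) h1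
    have f3 := congrArg (fun y : ℝ => (y : ℂ)) h3
    generalize r ^ (2 / p) = Q at *
    push_cast at f1 f3 ⊢
    constructor
    · linear_combination Q * E * f1
    · linear_combination Q * E * f3
  | inversion =>
    simp only at h
    obtain ⟨h1, h2, h3, h4⟩ := h
    have hQ0 : 0 < r ^ (n / 2) := Real.rpow_pos_of_pos hr _
    have hQ : ‖((r ^ (n / 2) : ℝ) : ℂ)‖ = r ^ (n / 2) := by
      rw [Complex.norm_real, Real.norm_of_nonneg hQ0.le]
    have hE' : ‖Complex.exp (Complex.I * ((r ^ 2 / (4 * t) : ℝ) : ℂ))‖ = 1 := by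
      rw [mul_comm, Complex.norm_exp_ofReal_mul_I]
    generalize Complex.exp (Complex.I * ((r ^ 2 / (4 * t) : ℝ) : ℂ)) = F at *
    have p1 : r ^ (1 + n / 2) = r * r ^ (n / 2) := by rw [Real.rpow_add hr, Real.rpow_one]
    have p2 : r ^ (2 + n / 2) = r ^ 2 * r ^ (n / 2) := by
      rw [Real.rpow_add hr]; norm_num
    simp only [equivariant, norm_mul, hE, hE', hA', hQ, mul_one]
    rw [p1, p2, ← h2, ← h4]
    have f1 := congrArg (fun y : ℝ => (y : ℂ)) h1
    have f3 := congrArg (fun y : ℝ => (y : ℂ)) h3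
    generalize r ^ (n / 2) = Q at *
    push_cast at f1 f3 ⊢
    constructor
    · linear_combination Q * E * F * f1
    · linear_combination Q * E * F * f3

theorem continuousAt_invX {S : SymmetryGroup} {z : ℝ × ℝ} (hz : 0 < z.2) :
    ContinuousAt (fun y : ℝ × ℝ => invX S y.1 y.2) z := by
  cases S with
  | timeTranslation => exact continuousAt_snd
  | scaling => exact continuousAt_fst.div (continuousAt_snd.pow 2) (by positivity)
  | inversion => exact continuousAt_fst.div continuousAt_snd hz.ne'

/-- The criterion used for all solutions: `u = A exp(iΦ)` is an exact solution near `z` if its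
logarithmic derivatives are given by a separable solution of the scalar system. -/
theorem IsExactAt.of_polar {S : SymmetryGroup} {n p k : ℝ} {A Φ : ℝ → ℝ → ℝ} {z : ℝ × ℝ}
    (hp : p ≠ 0) (hinv : S = .inversion → p = 4 / n ∧ z.1 ≠ 0) (hz : 0 < z.2)
    (hA0 : 0 < A z.1 z.2)
    (hA : ContDiffAt ℝ 2 (fun y : ℝ × ℝ => A y.1 y.2) z)
    (hΦ : ContDiffAt ℝ 2 (fun y : ℝ × ℝ => Φ y.1 y.2) z)
    (a₁ a₂ b₁ b₂ : ℝ → ℝ) (c d : ℝ → ℝ → ℝ) {e : ℝ} (he : e ≠ 0)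
    (hsys : ∀ᶠ x in 𝓝 (invX S z.1 z.2), ∀ ρ : ℝ, 0 < ρ →
      ∃ ax ae bx be c₀ cx ce d₀ dx' de : ℝ,
        HasJet (fun x ρ => a₁ x + a₂ x * ρ ^ e) x ρ (a₁ x + a₂ x * ρ ^ e) ax ae ∧
        HasJet (fun x ρ => b₁ x + b₂ x * ρ ^ e) x ρ (b₁ x + b₂ x * ρ ^ e) bx be ∧
        HasJet c x ρ c₀ cx ce ∧ HasJet d x ρ d₀ dx' de ∧
        ScalarSystem S n p k x ρ (a₁ x + a₂ x * ρ ^ e) ax ae (b₁ x + b₂ x * ρ ^ e) bx be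
          c₀ cx ce d₀ dx' de)
    (hfo : ∀ᶠ y in 𝓝 z, PolarFirstOrder S n p (fun x ρ => a₁ x + a₂ x * ρ ^ e)
      (fun x ρ => b₁ x + b₂ x * ρ ^ e) c d A Φ y.1 y.2) :
    IsExactAt S n p k
      (fun t r => (A t r : ℂ) * Complex.exp (Complex.I * (Φ t r : ℂ))) z := by
  have hu : ContDiffAt ℝ 2 (fun y : ℝ × ℝ =>
      (A y.1 y.2 : ℂ) * Complex.exp (Complex.I * (Φ y.1 y.2 : ℂ))) z :=
    (Complex.ofRealCLM.contDiff.contDiffAt.comp z hA).mul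
      ((contDiffAt_const.mul (Complex.ofRealCLM.contDiff.contDiffAt.comp z hΦ)).cexp)
  obtain ⟨X, hX, hXo, hzX⟩ := eventually_nhds_iff.1 hsys
  have hsep : IsSeparableSolution S n p k X (equivariant c d)
      (equivariant (fun x ρ => a₁ x + a₂ x * ρ ^ e) (fun x ρ => b₁ x + b₂ x * ρ ^ e)) := by
    -- The exponent is halved because the separable form is stated with `|v|^{2a}`.
    refine ⟨⟨fun x => a₁ x + Complex.I * b₁ x, fun x => a₂ x + Complex.I * b₂ x, e / 2,
      by simpa using he, fun x _ v _ => ?_⟩, ⟨fun x ρ => c x ρ + Complex.I * d x ρ,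
      fun x _ v _ => rfl⟩, fun x hx v hv => ?_⟩
    · simp only [equivariant]
      rw [mul_div_cancel₀ e (two_ne_zero)]
      push_cast
      ring
    · obtain ⟨ax, ae, bx, be, c₀, cx, ce, d₀, dx', de, h1, h2, h3, h4, h5⟩ :=
        hX x hx ‖v‖ (norm_pos_iff.2 hv)
      exact h5.resolving (fun h => (hinv h).1) hv h1 h2 h3 h4
  have hev : ∀ᶠ y : ℝ × ℝ in 𝓝 z, invX S y.1 y.2 ∈ X ∧
      (A y.1 y.2 : ℂ) * Complex.exp (Complex.I * (Φ y.1 y.2 : ℂ)) ≠ 0 ∧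
      FirstOrderEquations S n p (equivariant c d)
        (equivariant (fun x ρ => a₁ x + a₂ x * ρ ^ e) (fun x ρ => b₁ x + b₂ x * ρ ^ e))
        (fun t r => (A t r : ℂ) * Complex.exp (Complex.I * (Φ t r : ℂ))) y.1 y.2 := by
    filter_upwards [(continuousAt_invX hz).eventually (hXo.mem_nhds hzX),
      continuousAt_snd.eventually (lt_mem_nhds hz), hA.continuousAt.eventually (lt_mem_nhds hA0),
      hfo] with y h1 h2 h3 h4
    exact ⟨h1, mul_ne_zero (by exact_mod_cast h3.ne') (Complex.exp_ne_zero _),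
      h4.firstOrderEquations h2 h3⟩
  exact ⟨hz, hu, radialEquation_of_firstOrder hp (fun h => (hinv h).1) (fun h => (hinv h).2) hz hu
    hsep hev, X, _, _, hXo, hsep, hev⟩

/-! ### Linear second-order equations near a point -/

/-- Near `x₀`, `y'' = P y' + Q y + R`. -/
def SolvesNear (P Q R y : ℝ → ℝ) (x₀ : ℝ) : Prop :=
  ∃ y' : ℝ → ℝ, ∀ᶠ x in 𝓝 x₀,
    HasDerivAt y (y' x) x ∧ HasDerivAt y' (P x * y' x + Q x * y x + R x) x

theorem contDiffAt_one_of_hasDerivAt {f f' : ℝ → ℝ} {x₀ : ℝ}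
    (h : ∀ᶠ x in 𝓝 x₀, HasDerivAt f (f' x) x) (hc : ∀ᶠ x in 𝓝 x₀, ContinuousAt f' x) :
    ContDiffAt ℝ 1 f x₀ := by
  rw [contDiffAt_one_iff]
  refine ⟨fun x => ContinuousLinearMap.toSpanSingleton ℝ (f' x), _, h.and hc, ?_, ?_⟩
  · intro x hx
    exact ((ContinuousLinearMap.toSpanSingletonCLE (𝕜 := ℝ) (E := ℝ)).continuous.continuousAt.comp
      hx.2).continuousWithinAt
  · intro x hx
    exact hx.1.hasFDerivAt

theorem contDiffAt_two_of_hasDerivAt {f f' : ℝ → ℝ} {x₀ : ℝ}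
    (h : ∀ᶠ x in 𝓝 x₀, HasDerivAt f (f' x) x) (hc : ContDiffAt ℝ 1 f' x₀) :
    ContDiffAt ℝ 2 f x₀ := by
  have : (2 : WithTop ℕ∞) = ((1 : ℕ) : WithTop ℕ∞) + 1 := by norm_num
  rw [this, contDiffAt_succ_iff_hasFDerivAt]
  refine ⟨fun x => ContinuousLinearMap.toSpanSingleton ℝ (f' x),
    ⟨_, h, fun x hx => hx.hasFDerivAt⟩, ?_⟩
  exact (ContinuousLinearMap.toSpanSingletonCLE (𝕜 := ℝ) (E := ℝ)).contDiff.contDiffAt.comp x₀ hc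

/-- The equation writes `y''` as a combination of continuous functions, so regularity follows from
the equation itself. -/
theorem SolvesNear.contDiffAt {P Q R y : ℝ → ℝ} {x₀ : ℝ} (h : SolvesNear P Q R y x₀)
    (hP : ∀ᶠ x in 𝓝 x₀, ContinuousAt P x) (hQ : ∀ᶠ x in 𝓝 x₀, ContinuousAt Q x)
    (hR : ∀ᶠ x in 𝓝 x₀, ContinuousAt R x) : ContDiffAt ℝ 2 y x₀ := by
  obtain ⟨y', hy⟩ := h
  refine contDiffAt_two_of_hasDerivAt (hy.mono fun _ h => h.1)
    (contDiffAt_one_of_hasDerivAt (hy.mono fun _ h => h.2) ?_)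
  filter_upwards [hy, hP, hQ, hR] with x hx h1 h2 h3
  exact ((h1.mul hx.2.continuousAt).add (h2.mul hx.1.continuousAt)).add h3

/-- Local existence for a scalar first-order equation. -/
theorem exists_eventually_hasDerivAt {F : ℝ × ℝ → ℝ} {x₀ a₀ : ℝ} (hF : ContDiffAt ℝ 1 F (x₀, a₀)) :
    ∃ α : ℝ → ℝ, ∀ᶠ x in 𝓝 x₀, HasDerivAt α (F (x, α x)) x := by
  -- The equation becomes autonomous when `x` is adjoined as an unknown of speed one; afterwards the
  -- first component is identified with the parameter.
  have hf : ContDiffAt ℝ 1 (fun y : ℝ × ℝ => ((1 : ℝ), F y)) (x₀, a₀) := contDiffAt_const.prodMk hF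
  obtain ⟨r, hr, ε, hε, h⟩ :=
    hf.exists_forall_mem_closedBall_exists_eq_forall_mem_Ioo_hasDerivAt x₀
  obtain ⟨γ, hγ0, hγ⟩ := h (x₀, a₀) (Metric.mem_closedBall_self hr.le)
  have h1 : ∀ t ∈ Set.Ioo (x₀ - ε) (x₀ + ε), HasDerivAt (fun s => (γ s).1) 1 t := fun t ht =>
    (hasFDerivAt_fst (𝕜 := ℝ) (E := ℝ) (F := ℝ)).comp_hasDerivAt t (hγ t ht)
  have h2 : ∀ t ∈ Set.Ioo (x₀ - ε) (x₀ + ε), HasDerivAt (fun s => (γ s).2) (F (γ t)) t :=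
    fun t ht => (hasFDerivAt_snd (𝕜 := ℝ) (E := ℝ) (F := ℝ)).comp_hasDerivAt t (hγ t ht)
  have hmem : x₀ ∈ Set.Ioo (x₀ - ε) (x₀ + ε) := ⟨by linarith, by linarith⟩
  have h3 : ∀ t ∈ Set.Ioo (x₀ - ε) (x₀ + ε), (γ t).1 = t := by
    intro t ht
    have hd : ∀ s ∈ Set.Ioo (x₀ - ε) (x₀ + ε), HasDerivAt (fun s => (γ s).1 - s) 0 s := fun s hs =>
      ((h1 s hs).sub (hasDerivAt_id s)).congr_deriv (by ring)
    have := (convex_Ioo (x₀ - ε) (x₀ + ε)).is_const_of_fderivWithin_eq_zero (𝕜 := ℝ)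
      (f := fun s => (γ s).1 - s)
      (fun s hs => (hd s hs).differentiableAt.differentiableWithinAt)
      (fun s hs => by
        rw [fderivWithin_of_isOpen isOpen_Ioo hs, (hd s hs).hasFDerivAt.fderiv]; ext; simp) ht hmem
    simp only [hγ0] at this
    linarith
  refine ⟨fun s => (γ s).2, ?_⟩
  filter_upwards [isOpen_Ioo.mem_nhds hmem] with t ht
  have := h2 t ht
  rwa [show γ t = (t, (γ t).2) from Prod.ext (h3 t ht) rfl] at this

theorem eventually_fst {P : ℝ → Prop} {z : ℝ × ℝ} (h : ∀ᶠ x in 𝓝 z.1, P x) :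
    ∀ᶠ y in 𝓝 z, P y.1 := continuousAt_fst.eventually h

theorem eventually_snd {P : ℝ → Prop} {z : ℝ × ℝ} (h : ∀ᶠ x in 𝓝 z.2, P x) :
    ∀ᶠ y in 𝓝 z, P y.2 := continuousAt_snd.eventually h

/-! ### Solutions with `p = -1` from linear second-order equations -/

/-- Standing waves `A(r) exp(i(c₁ + c t))` with `A'' + (n-1)A'/r + c A + k = 0`. -/
theorem isExactAt_standingWave {n k c c₁ : ℝ} {A : ℝ → ℝ} {z : ℝ × ℝ} (hz : 0 < z.2)
    (hA0 : 0 < A z.2)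
    (hA : SolvesNear (fun r => -(n - 1) / r) (fun _ => -c) (fun _ => -k) A z.2) :
    IsExactAt .timeTranslation n (-1) k
      (fun t r => ((A r : ℝ) : ℂ) * Complex.exp (Complex.I * ((c₁ + c * t : ℝ) : ℂ))) z := by
  have hne : ∀ᶠ r in 𝓝 z.2, r ≠ 0 := eventually_ne_nhds hz.ne'
  have hC2 : ContDiffAt ℝ 2 A z.2 := hA.contDiffAt
    (hne.mono fun r hr => continuousAt_const.div continuousAt_id hr)
    (Eventually.of_forall fun _ => continuousAt_const)
    (Eventually.of_forall fun _ => continuousAt_const)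
  obtain ⟨A', hA⟩ := hA
  -- The right side is the Riccati equation of the homogeneous amplitude equation, the `ρ⁰` part of
  -- the real radial equation. The initial value `0` is arbitrary.
  have hF : ContDiffAt ℝ 1 (fun y : ℝ × ℝ => -y.2 ^ 2 - (n - 1) * y.2 / y.1 - c) (z.2, 0) := by
    have : z.2 ≠ 0 := hz.ne'
    fun_prop (disch := assumption)
  obtain ⟨α, hα⟩ := exists_eventually_hasDerivAt hF
  refine IsExactAt.of_polar (A := fun _ r => A r) (Φ := fun t _ => c₁ + c * t) (by norm_num)
    (by simp) hz hA0 (hC2.comp z contDiffAt_snd) (by fun_prop)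
    -- With `β = A' - αA` one has `(α + β/A) A = A'`, and the `1/ρ` part of the system is the
    -- amplitude equation after the Riccati equation is used.
    α (fun r => A' r - α r * A r) (fun _ => 0) (fun _ => 0) (fun _ _ => 0) (fun _ _ => c)
    (e := -1) (by norm_num) ?_ ?_
  · simp only [invX]
    filter_upwards [hne, hα, hA] with x hx hα hA ρ hρ
    have hβ := hA.2.sub (hα.mul hA.1)
    refine ⟨_, _, _, _, _, _, _, _, _, _, (HasJet.of_hasDerivAt hα).add (HasJet.mul_rpow hβ hρ _),
      (HasJet.of_hasDerivAt (hasDerivAt_const x 0)).add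
        (HasJet.mul_rpow (hasDerivAt_const x 0) hρ _),
      HasJet.of_hasDerivAt (hasDerivAt_const x 0), HasJet.of_hasDerivAt (hasDerivAt_const x c), ?_⟩
    constructor <;> simp only [coeffScale, coeffMixed, coeffX, coeffEuler, coeffRadial,
      Pi.sub_apply, Pi.mul_apply] <;> ring
  · filter_upwards [eventually_snd hA,
      eventually_snd (hC2.continuousAt.eventually (lt_mem_nhds hA0))] with y hA hpos
    have hp0 := hpos.ne'
    refine ⟨_, _, _, _, hasDerivAt_const _ _, hA.1,
      ((hasDerivAt_id y.1).const_mul c).const_add c₁, hasDerivAt_const _ _, ?_⟩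
    simp only [Real.rpow_neg_one]
    refine ⟨by simp, by simp, by field_simp; ring, by simp⟩

/-- Pseudo-conformal images of standing waves for `n = -4`. -/
theorem isExactAt_conformalWave {k c c₁ : ℝ} {B : ℝ → ℝ} {z : ℝ × ℝ} (hz : 0 < z.2)
    (ht : z.1 ≠ 0) (hB0 : 0 < z.1 ^ 2 * B (z.2 / z.1))
    (hB : SolvesNear (fun y => 5 / y) (fun _ => -c) (fun _ => -k) B (z.2 / z.1)) :
    IsExactAt .inversion (-4) (-1) k
      (fun t r => ((t ^ 2 * B (r / t) : ℝ) : ℂ) *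
        Complex.exp (Complex.I * ((c₁ - c / t - r ^ 2 / (4 * t) : ℝ) : ℂ))) z := by
  have hy0 : z.2 / z.1 ≠ 0 := div_ne_zero hz.ne' ht
  have hne : ∀ᶠ r in 𝓝 (z.2 / z.1), r ≠ 0 := eventually_ne_nhds hy0
  have hC2 : ContDiffAt ℝ 2 B (z.2 / z.1) := hB.contDiffAt
    (hne.mono fun r hr => continuousAt_const.div continuousAt_id hr)
    (Eventually.of_forall fun _ => continuousAt_const)
    (Eventually.of_forall fun _ => continuousAt_const)
  obtain ⟨B', hB⟩ := hB
  have hx0 : z.1 / z.2 ≠ 0 := div_ne_zero ht hz.ne'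
  -- The same Riccati splitting in the inversion variable `x = t/r = 1/y`; the `6` is `2 - n`, and
  -- `c/x²` is the value of `d` inherited from the frequency of the preimage.
  have hF : ContDiffAt ℝ 1 (fun y : ℝ × ℝ => (y.2 ^ 2 - 6 * y.2 + c / y.1 ^ 2) / y.1)
      (z.1 / z.2, 0) := by
    have h : z.1 / z.2 ≠ 0 := hx0
    have : (z.1 / z.2) ^ 2 ≠ 0 := pow_ne_zero 2 hx0
    fun_prop (disch := assumption)
  obtain ⟨α, hα⟩ := exists_eventually_hasDerivAt hF
  have hcy : ContinuousAt (fun y : ℝ × ℝ => y.2 / y.1) z := continuousAt_snd.div continuousAt_fst ht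
  have hAc : ContDiffAt ℝ 2 (fun y : ℝ × ℝ => y.1 ^ 2 * B (y.2 / y.1)) z :=
    (contDiffAt_fst.pow 2).mul (ContDiffAt.comp z (f := fun y : ℝ × ℝ => y.2 / y.1) hC2
      (contDiffAt_snd.div contDiffAt_fst ht))
  have hinv : (z.1 / z.2)⁻¹ = z.2 / z.1 := inv_div _ _
  have hBx : ∀ᶠ x in 𝓝 (z.1 / z.2), HasDerivAt B (B' x⁻¹) x⁻¹ ∧
      HasDerivAt B' (5 / x⁻¹ * B' x⁻¹ + -c * B x⁻¹ + -k) x⁻¹ :=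
    (continuousAt_inv₀ hx0).eventually (p := fun y => HasDerivAt B (B' y) y ∧
      HasDerivAt B' (5 / y * B' y + -c * B y + -k) y) (hinv ▸ hB)
  refine IsExactAt.of_polar (A := fun t r => t ^ 2 * B (r / t))
    (Φ := fun t r => c₁ - c / t - r ^ 2 / (4 * t)) (by norm_num)
    (fun _ => ⟨by norm_num, ht⟩) hz hB0 hAc (by
      have : 4 * z.1 ≠ 0 := by simpa using ht
      fun_prop (disch := assumption))
    -- Here `ρ = r⁻² A = x² B(1/x)`, and `β` is `(r A_r / A - α) ρ`.
    α (fun x => x * B' x⁻¹ - α x * (B x⁻¹ * x ^ 2)) (fun _ => 0) (fun _ => 0) (fun _ _ => 0)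
    (fun x _ => c / x ^ 2) (e := -1) (by norm_num) ?_ ?_
  · simp only [invX]
    filter_upwards [eventually_ne_nhds hx0, hα, hBx] with x hx hα hB ρ hρ
    have hix := hasDerivAt_inv hx
    have d1 := hB.1.comp x hix
    have d2 := hB.2.comp x hix
    have hβ := ((hasDerivAt_id x).mul d2).sub (hα.mul (d1.mul ((hasDerivAt_id x).pow 2)))
    have hd : HasDerivAt (fun x : ℝ => c / x ^ 2) (-2 * c / x ^ 3) x := by
      refine ((hasDerivAt_const x c).div ((hasDerivAt_id x).pow 2) (by simp [hx])).congr_deriv ?_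
      simp; field_simp
    refine ⟨_, _, _, _, _, _, _, _, _, _, (HasJet.of_hasDerivAt hα).add (HasJet.mul_rpow hβ hρ _),
      (HasJet.of_hasDerivAt (hasDerivAt_const x 0)).add
        (HasJet.mul_rpow (hasDerivAt_const x 0) hρ _),
      HasJet.of_hasDerivAt (hasDerivAt_const x 0), HasJet.of_hasDerivAt hd, ?_⟩
    constructor <;> simp only [coeffScale, coeffMixed, coeffX, coeffEuler, coeffRadial] <;>
      simp <;> field_simp <;> ring
  · filter_upwards [hcy.eventually hB, eventually_fst (eventually_ne_nhds ht),
      eventually_snd (lt_mem_nhds hz),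
      hAc.continuousAt.eventually (lt_mem_nhds hB0)] with y hB ht hr hpos
    have hr0 := hr.ne'
    have hp0 := hpos.ne'
    have hBn : B (y.2 / y.1) ≠ 0 := right_ne_zero_of_mul hp0
    have e1 : HasDerivAt (fun s => y.2 / s) (-y.2 / y.1 ^ 2) y.1 := by
      refine ((hasDerivAt_const y.1 y.2).div (hasDerivAt_id y.1) ht).congr_deriv ?_
      simp
    have e2 : HasDerivAt (fun s => s / y.1) (1 / y.1) y.2 := (hasDerivAt_id y.2).div_const y.1
    have d1 := ((hasDerivAt_id y.1).pow 2).mul (hB.1.comp y.1 e1)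
    have d2 := (hB.1.comp y.2 e2).const_mul (y.1 ^ 2)
    have d3 : HasDerivAt (fun s => c₁ - c / s - y.2 ^ 2 / (4 * s))
        (c / y.1 ^ 2 + y.2 ^ 2 / (4 * y.1 ^ 2)) y.1 := by
      refine ((((hasDerivAt_const y.1 c).div (hasDerivAt_id y.1) ht).const_sub c₁).sub
        ((hasDerivAt_const y.1 (y.2 ^ 2)).div ((hasDerivAt_id y.1).const_mul 4)
          (by simpa using ht))).congr_deriv ?_
      simp; field_simp; ring
    have d4 : HasDerivAt (fun s => c₁ - c / y.1 - s ^ 2 / (4 * y.1)) (-(y.2 / (2 * y.1))) y.2 := by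
      refine ((((hasDerivAt_id y.2).pow 2).div_const (4 * y.1)).const_sub _).congr_deriv ?_
      simp; field_simp; norm_num
    refine ⟨_, _, _, _, d1, d2, d3, d4, ?_⟩
    have hq : y.2 ^ ((-4 : ℝ) / 2) = (y.2 ^ 2)⁻¹ := by
      rw [show (-4 : ℝ) / 2 = -(2 : ℕ) by norm_num, Real.rpow_neg hr.le, Real.rpow_natCast]
    simp only [Real.rpow_neg_one, hq, inv_div, mul_inv_rev, inv_inv]
    refine ⟨?_, ?_, ?_, ?_⟩
    · simp; field_simp; right; ring
    · field_simp; ring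
    · simp; field_simp; ring
    · simp

/-- Self-similar solutions for `n = -4`. -/
theorem isExactAt_selfSimilar {k c c₁ : ℝ} {B : ℝ → ℝ} {z : ℝ × ℝ} (hz : 0 < z.2)
    (ht : z.1 ≠ 0) (hB0 : 0 < z.1 * B (z.2 ^ 2 / (8 * z.1)))
    (hB : SolvesNear (fun ξ => 2 / ξ) (fun ξ => -(1 - 2 * c / ξ)) (fun ξ => -(2 * k) / ξ) B
      (z.2 ^ 2 / (8 * z.1))) :
    IsExactAt .scaling (-4) (-1) k
      (fun t r => ((t * B (r ^ 2 / (8 * t)) : ℝ) : ℂ) *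
        Complex.exp (Complex.I * ((c₁ - r ^ 2 / (8 * t) - c * Real.log t : ℝ) : ℂ))) z := by
  have ht8 : 8 * z.1 ≠ 0 := by simpa using ht
  have hy0 : z.2 ^ 2 / (8 * z.1) ≠ 0 := div_ne_zero (pow_ne_zero 2 hz.ne') ht8
  have hne : ∀ᶠ r in 𝓝 (z.2 ^ 2 / (8 * z.1)), r ≠ 0 := eventually_ne_nhds hy0
  have hC2 : ContDiffAt ℝ 2 B (z.2 ^ 2 / (8 * z.1)) := hB.contDiffAt
    (hne.mono fun r hr => continuousAt_const.div continuousAt_id hr)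
    (hne.mono fun r hr => (continuousAt_const.sub (continuousAt_const.div continuousAt_id hr)).neg)
    (hne.mono fun r hr => continuousAt_const.div continuousAt_id hr)
  obtain ⟨B', hB⟩ := hB
  have hx0 : z.1 / z.2 ^ 2 ≠ 0 := div_ne_zero ht (pow_ne_zero 2 hz.ne')
  -- The Riccati equation of the `ρ⁰` part; `1/(16x²) - c/x` is `d - b²` for the prescribed phase.
  have hF : ContDiffAt ℝ 1 (fun y : ℝ × ℝ =>
      (y.2 ^ 2 - 6 * y.2 + 1 / (16 * y.1 ^ 2) - c / y.1) / (2 * y.1)) (z.1 / z.2 ^ 2, 0) := by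
    have h0 : z.1 / z.2 ^ 2 ≠ 0 := hx0
    have h1 : 16 * (z.1 / z.2 ^ 2) ^ 2 ≠ 0 := mul_ne_zero (by norm_num) (pow_ne_zero 2 hx0)
    have h2 : 2 * (z.1 / z.2 ^ 2) ≠ 0 := mul_ne_zero (by norm_num) hx0
    fun_prop (disch := assumption)
  obtain ⟨α, hα⟩ := exists_eventually_hasDerivAt hF
  have hcξ : ContDiffAt ℝ 2 (fun y : ℝ × ℝ => y.2 ^ 2 / (8 * y.1)) z :=
    (contDiffAt_snd.pow 2).div (contDiffAt_const.mul contDiffAt_fst) ht8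
  have hAc : ContDiffAt ℝ 2 (fun y : ℝ × ℝ => y.1 * B (y.2 ^ 2 / (8 * y.1))) z :=
    contDiffAt_fst.mul (ContDiffAt.comp z (f := fun y : ℝ × ℝ => y.2 ^ 2 / (8 * y.1)) hC2 hcξ)
  have hinv : (8 * (z.1 / z.2 ^ 2))⁻¹ = z.2 ^ 2 / (8 * z.1) := by field_simp
  have hct : Tendsto (fun x : ℝ => (8 * x)⁻¹) (𝓝 (z.1 / z.2 ^ 2)) (𝓝 (z.2 ^ 2 / (8 * z.1))) :=
    hinv ▸ ((continuousAt_const.mul continuousAt_id).inv₀ (mul_ne_zero (by norm_num) hx0) :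
      ContinuousAt (fun x : ℝ => (8 * x)⁻¹) (z.1 / z.2 ^ 2)).tendsto
  have hBx : ∀ᶠ x in 𝓝 (z.1 / z.2 ^ 2), HasDerivAt B (B' (8 * x)⁻¹) (8 * x)⁻¹ ∧
      HasDerivAt B' (2 / (8 * x)⁻¹ * B' (8 * x)⁻¹ + -(1 - 2 * c / (8 * x)⁻¹) * B (8 * x)⁻¹ +
        -(2 * k) / (8 * x)⁻¹) (8 * x)⁻¹ :=
    hct.eventually hB
  refine IsExactAt.of_polar (A := fun t r => t * B (r ^ 2 / (8 * t)))
    (Φ := fun t r => c₁ - r ^ 2 / (8 * t) - c * Real.log t) (by norm_num)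
    (by simp) hz hB0 hAc ((contDiffAt_const.sub hcξ).sub
      (contDiffAt_const.mul (contDiffAt_fst.log ht)))
    α (fun x => B' (8 * x)⁻¹ / 4 - α x * (x * B (8 * x)⁻¹)) (fun x => -1 / (4 * x)) (fun _ => 0)
    -- The amplitude is homogeneous: `2t A_t + r A_r = 2A`. Hence `c = (2 - a)/(2x)`, with no
    -- further unknown.
    (fun x ρ => (2 - α x) / (2 * x) +
      -(B' (8 * x)⁻¹ / 4 - α x * (x * B (8 * x)⁻¹)) / (2 * x) * ρ ^ (-1 : ℝ))
    (fun x _ => 1 / (8 * x ^ 2) - c / x) (e := -1) (by norm_num) ?_ ?_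
  · simp only [invX]
    filter_upwards [eventually_ne_nhds hx0, hα, hBx] with x hx hα hB ρ hρ
    have h8 : 8 * x ≠ 0 := by simpa using hx
    have hix : HasDerivAt (fun x : ℝ => (8 * x)⁻¹) (-1 / (8 * x ^ 2)) x := by
      refine (((hasDerivAt_id x).const_mul 8).inv (by simpa using hx)).congr_deriv ?_
      simp; field_simp
    have d1 := hB.1.comp x hix
    have d2 := hB.2.comp x hix
    have hβ := (d2.div_const 4).sub (hα.mul ((hasDerivAt_id x).mul d1))
    have h2x : HasDerivAt (fun x : ℝ => 2 * x) 2 x := by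
      simpa using (hasDerivAt_id x).const_mul (2 : ℝ)
    have h2x0 : 2 * x ≠ 0 := by simpa using hx
    have hb : HasDerivAt (fun x : ℝ => -1 / (4 * x)) (1 / (4 * x ^ 2)) x := by
      refine ((hasDerivAt_const x (-1 : ℝ)).div ((hasDerivAt_id x).const_mul 4)
        (by simpa using hx)).congr_deriv ?_
      simp; field_simp
    have hd : HasDerivAt (fun x : ℝ => 1 / (8 * x ^ 2) - c / x) (-1 / (4 * x ^ 3) + c / x ^ 2) x := by
      refine (((hasDerivAt_const x (1 : ℝ)).div (((hasDerivAt_id x).pow 2).const_mul 8)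
        (by simpa using hx)).sub ((hasDerivAt_const x c).div (hasDerivAt_id x) hx)).congr_deriv ?_
      simp; field_simp; ring
    refine ⟨_, _, _, _, _, _, _, _, _, _, (HasJet.of_hasDerivAt hα).add (HasJet.mul_rpow hβ hρ _),
      (HasJet.of_hasDerivAt hb).add (HasJet.mul_rpow (hasDerivAt_const x 0) hρ _),
      (HasJet.of_hasDerivAt ((hα.const_sub 2).div h2x h2x0)).add
        (HasJet.mul_rpow (hβ.neg.div h2x h2x0) hρ _), HasJet.of_hasDerivAt hd, ?_⟩
    constructor <;> simp only [coeffScale, coeffMixed, coeffX, coeffEuler, coeffRadial] <;>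
      simp <;> field_simp <;> ring
  · filter_upwards [hcξ.continuousAt.eventually hB, eventually_fst (eventually_ne_nhds ht),
      eventually_snd (lt_mem_nhds hz),
      hAc.continuousAt.eventually (lt_mem_nhds hB0)] with y hB ht hr hpos
    have hr0 := hr.ne'
    have hp0 := hpos.ne'
    have hBn : B (y.2 ^ 2 / (8 * y.1)) ≠ 0 := right_ne_zero_of_mul hp0
    have e1 : HasDerivAt (fun s => y.2 ^ 2 / (8 * s)) (-y.2 ^ 2 / (8 * y.1 ^ 2)) y.1 := by
      refine ((hasDerivAt_const y.1 (y.2 ^ 2)).div ((hasDerivAt_id y.1).const_mul 8)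
        (by simpa using ht)).congr_deriv ?_
      simp; field_simp
    have e2 : HasDerivAt (fun s => s ^ 2 / (8 * y.1)) (y.2 / (4 * y.1)) y.2 := by
      refine (((hasDerivAt_id y.2).pow 2).div_const (8 * y.1)).congr_deriv ?_
      simp; field_simp; norm_num
    have d1 := (hasDerivAt_id y.1).mul (hB.1.comp y.1 e1)
    have d2 := (hB.1.comp y.2 e2).const_mul y.1
    have d3 := (e1.const_sub c₁).sub ((Real.hasDerivAt_log ht).const_mul c)
    have d4 := (e2.const_sub c₁).sub_const (c * Real.log y.1)
    refine ⟨_, _, _, _, d1, d2, d3, d4, ?_⟩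
    have hq : y.2 ^ ((2 : ℝ) / (-1)) = (y.2 ^ 2)⁻¹ := by
      rw [show (2 : ℝ) / (-1) = -(2 : ℕ) by norm_num, Real.rpow_neg hr.le, Real.rpow_natCast]
    have h8 : (8 * (y.1 / y.2 ^ 2))⁻¹ = y.2 ^ 2 / (8 * y.1) := by field_simp
    simp only [Real.rpow_neg_one, hq, h8, mul_inv_rev, inv_inv]
    refine ⟨?_, ?_, ?_, ?_⟩
    · simp; field_simp; ring
    · field_simp
    · generalize B (y.2 ^ 2 / (8 * y.1)) = B₀ at hBn ⊢
      field_simp; ring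
    · field_simp; ring

/-! ### Solutions in closed form -/

/-- Lets two powers of `ρ` with exponents in ratio two be treated as one indeterminate and its
square, so that the scalar system becomes a polynomial identity. -/
theorem rpow_eq_sq_rpow {ρ p e : ℝ} (hρ : 0 < ρ) (h : p = e * 2) : ρ ^ p = (ρ ^ e) ^ 2 := by
  rw [h, Real.rpow_mul hρ.le]; norm_num

/-- `f^m` has logarithmic derivative `m f'/f`. -/
theorem HasDerivAt.const_mul_rpow {f : ℝ → ℝ} {f' x : ℝ} (K m : ℝ) (h : HasDerivAt f f' x)
    (hf : 0 < f x) :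
    HasDerivAt (fun s => K * f s ^ m) (m * (f' / f x) * (K * f x ^ m)) x := by
  refine ((h.rpow_const (Or.inl hf.ne')).const_mul K).congr_deriv ?_
  rw [Real.rpow_sub_one hf.ne']
  field_simp

theorem isExactAt_planeWave {n p k a c c₁ : ℝ} {z : ℝ × ℝ} (hp : p ≠ 0) (hz : 0 < z.2)
    (ha : 0 < a) (hak : k * a ^ p = c) :
    IsExactAt .timeTranslation n p k
      (fun t _ => ((a : ℝ) : ℂ) * Complex.exp (Complex.I * ((c₁ - c * t : ℝ) : ℂ))) z := by
  refine IsExactAt.of_polar (A := fun _ _ => a) (Φ := fun t _ => c₁ - c * t) hp (by simp) hz ha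
    contDiffAt_const (by fun_prop) (fun _ => 0) (fun _ => 0) (fun _ => 0) (fun _ => 0)
    -- Here `H = 0`, so the exponent `e` only has to be nonzero.
    (fun _ _ => 0) (fun _ ρ => -k * ρ ^ p) (e := 1) (by norm_num) ?_ ?_
  · refine Eventually.of_forall fun x ρ hρ => ⟨_, _, _, _, _, _, _, _, _, _,
      (HasJet.of_hasDerivAt (hasDerivAt_const x 0)).add
        (HasJet.mul_rpow (hasDerivAt_const x 0) hρ _),
      (HasJet.of_hasDerivAt (hasDerivAt_const x 0)).add
        (HasJet.mul_rpow (hasDerivAt_const x 0) hρ _),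
      HasJet.of_hasDerivAt (hasDerivAt_const x 0), HasJet.mul_rpow (hasDerivAt_const x (-k)) hρ p,
      ?_⟩
    constructor <;> simp only [coeffScale, coeffMixed, coeffX, coeffEuler, coeffRadial] <;> ring
  · refine Eventually.of_forall fun y => ⟨_, _, _, _, hasDerivAt_const _ _, hasDerivAt_const _ _,
      ((hasDerivAt_id y.1).const_mul c).const_sub c₁, hasDerivAt_const _ _, ?_⟩
    simp [← hak]

/-- Time is eliminated through the modulus: `1/(c₂ + c₃ t) = ρ^{2/n}`. The quadratic phase and the
amplitude account for the linear part of the equation, and the nonlinearity only drives the purely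
temporal phase `φ`. Keeping `φ` abstract covers a power and a logarithmic primitive together. -/
theorem isExactAt_chirped {n p k c₁ c₂ c₃ : ℝ} {φ : ℝ → ℝ} {z : ℝ × ℝ} (hp : p ≠ 0) (hn : n ≠ 0)
    (hz : 0 < z.2) (hτ : 0 < c₂ + c₃ * z.1) (hφ : ContDiffAt ℝ 2 φ z.1)
    (hφ' : ∀ t, 0 < c₂ + c₃ * t → HasDerivAt φ (-k * ((c₂ + c₃ * t) ^ (-n / 2)) ^ p) t) :
    IsExactAt .timeTranslation n p k
      (fun t r => (((c₂ + c₃ * t) ^ (-n / 2) : ℝ) : ℂ) * Complex.exp (Complex.I *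
        ((c₁ - c₃ * r ^ 2 / (4 * (c₂ + c₃ * t)) + φ t : ℝ) : ℂ))) z := by
  have hτ0 := hτ.ne'
  have h4τ : 4 * (c₂ + c₃ * z.1) ≠ 0 := mul_ne_zero (by norm_num) hτ0
  have hc : ContDiffAt ℝ 2 (fun y : ℝ × ℝ => c₂ + c₃ * y.1) z := by fun_prop
  refine IsExactAt.of_polar (A := fun t _ => (c₂ + c₃ * t) ^ (-n / 2))
    (Φ := fun t r => c₁ - c₃ * r ^ 2 / (4 * (c₂ + c₃ * t)) + φ t) hp (by simp) hz
    (Real.rpow_pos_of_pos hτ _) (hc.rpow_const_of_ne hτ0)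
    ((by fun_prop (disch := assumption) :
      ContDiffAt ℝ 2 (fun y : ℝ × ℝ => c₁ - c₃ * y.2 ^ 2 / (4 * (c₂ + c₃ * y.1))) z).add
      (hφ.comp z contDiffAt_fst))
    (fun _ => 0) (fun _ => 0) (fun _ => 0) (fun x => -(c₃ / 2) * x)
    (fun _ ρ => -(n * c₃ / 2) * ρ ^ (2 / n))
    (fun x ρ => c₃ ^ 2 / 4 * x ^ 2 * ρ ^ (4 / n) + -k * ρ ^ p) (e := 2 / n)
    (div_ne_zero two_ne_zero hn) ?_ ?_
  · filter_upwards [eventually_ne_nhds hz.ne'] with x hx ρ hρ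
    refine ⟨_, _, _, _, _, _, _, _, _, _,
      (HasJet.of_hasDerivAt (hasDerivAt_const x 0)).add
        (HasJet.mul_rpow (hasDerivAt_const x 0) hρ _),
      (HasJet.of_hasDerivAt (hasDerivAt_const x 0)).add
        (HasJet.mul_rpow ((hasDerivAt_id x).const_mul _) hρ _),
      HasJet.mul_rpow (hasDerivAt_const x _) hρ _,
      (HasJet.mul_rpow (((hasDerivAt_id x).pow 2).const_mul _) hρ _).add
        (HasJet.mul_rpow (hasDerivAt_const x (-k)) hρ p), ?_⟩
    have hR : ρ ^ (4 / n) = (ρ ^ (2 / n)) ^ 2 := rpow_eq_sq_rpow hρ (by ring)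
    constructor <;> simp only [coeffScale, coeffMixed, coeffX, coeffEuler, coeffRadial] <;>
      simp [hR] <;> field_simp <;> ring
  · filter_upwards [eventually_fst ((by fun_prop : Continuous fun t : ℝ => c₂ + c₃ * t
      ).continuousAt.eventually (lt_mem_nhds hτ))] with y hτ
    have hτ0 := hτ.ne'
    have e1 : HasDerivAt (fun t => c₂ + c₃ * t) c₃ y.1 := by
      simpa using ((hasDerivAt_id y.1).const_mul c₃).const_add c₂
    have d1 := HasDerivAt.const_mul_rpow 1 (-n / 2) e1 hτ
    simp only [one_mul] at d1
    have d2 : HasDerivAt (fun t => c₃ * y.2 ^ 2 / (4 * (c₂ + c₃ * t)))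
        (-(c₃ ^ 2 * y.2 ^ 2 / (4 * (c₂ + c₃ * y.1) ^ 2))) y.1 := by
      refine ((hasDerivAt_const y.1 (c₃ * y.2 ^ 2)).div (e1.const_mul 4)
        (mul_ne_zero (by norm_num) hτ0)).congr_deriv ?_
      field_simp; ring
    have d3 : HasDerivAt (fun r => c₁ - c₃ * r ^ 2 / (4 * (c₂ + c₃ * y.1)) + φ y.1)
        (-(c₃ * y.2 / (2 * (c₂ + c₃ * y.1)))) y.2 := by
      refine (((((hasDerivAt_id y.2).pow 2).const_mul c₃).div_const
        (4 * (c₂ + c₃ * y.1))).const_sub c₁).add_const (φ y.1) |>.congr_deriv ?_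
      simp; field_simp; ring
    have hρ2 : ((c₂ + c₃ * y.1) ^ (-n / 2)) ^ (2 / n) = (c₂ + c₃ * y.1)⁻¹ := by
      rw [← Real.rpow_mul hτ.le, show -n / 2 * (2 / n) = -1 by field_simp, Real.rpow_neg_one]
    have hρ4 : ((c₂ + c₃ * y.1) ^ (-n / 2)) ^ (4 / n) = ((c₂ + c₃ * y.1)⁻¹) ^ 2 := by
      rw [← hρ2]; exact rpow_eq_sq_rpow (Real.rpow_pos_of_pos hτ _) (by ring)
    refine ⟨_, _, _, _, d1, hasDerivAt_const _ _, (d2.const_sub c₁).add (hφ' y.1 hτ), d3, ?_⟩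
    simp only [hρ2, hρ4]
    refine ⟨by field_simp, by field_simp, by simp, by simp; field_simp⟩

/-- Again the modulus encodes time: `ρ^{p/2}` is a constant times `r` over `s (c₂ + (n-4) t)`, so
both derivatives of the phase are functions of `r` and `ρ`. The sign `s` makes the base of the power
positive. -/
theorem isExactAt_rational {n p k K s c₁ c₂ : ℝ} {z : ℝ × ℝ} (hn : n ≠ 2)
    (hpn : p = 2 / (2 - n)) (hK : 0 < K) (hKp : k * K ^ p = n * (n - 2) / 2) (hz : 0 < z.2)
    (hs : s = 1 ∨ s = -1) (hτ : 0 < s * (c₂ + (n - 4) * z.1)) :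
    IsExactAt .timeTranslation n p k
      (fun t r => ((K * (s * (c₂ + (n - 4) * t) / r) ^ (n - 2) : ℝ) : ℂ) *
        Complex.exp (Complex.I * ((c₁ + (1 - n / 2) * r ^ 2 / (c₂ + (n - 4) * t) : ℝ) : ℂ))) z := by
  have hn2 : 2 - n ≠ 0 := sub_ne_zero.2 hn.symm
  have hp : p ≠ 0 := by rw [hpn]; exact div_ne_zero two_ne_zero hn2
  have hs2 : s ^ 2 = 1 := by rcases hs with rfl | rfl <;> norm_num
  have hτ0 : c₂ + (n - 4) * z.1 ≠ 0 := right_ne_zero_of_mul hτ.ne'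
  have hw : 0 < s * (c₂ + (n - 4) * z.1) / z.2 := div_pos hτ hz
  have hz0 := hz.ne'
  have hcw : ContDiffAt ℝ 2 (fun y : ℝ × ℝ => s * (c₂ + (n - 4) * y.1) / y.2) z := by
    fun_prop (disch := assumption)
  have hKe : K ^ p = (K ^ (p / 2)) ^ 2 := rpow_eq_sq_rpow hK (by ring)
  have hKe0 : K ^ (p / 2) ≠ 0 := (Real.rpow_pos_of_pos hK _).ne'
  -- `C` is read off from `Φ_r = C ρ^{p/2}`, with `s = 1/s`.
  obtain ⟨C, hC⟩ : ∃ C, C = (2 - n) * s / K ^ (p / 2) := ⟨_, rfl⟩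
  refine IsExactAt.of_polar (A := fun t r => K * (s * (c₂ + (n - 4) * t) / r) ^ (n - 2))
    (Φ := fun t r => c₁ + (1 - n / 2) * r ^ 2 / (c₂ + (n - 4) * t)) hp (by simp) hz
    (mul_pos hK (Real.rpow_pos_of_pos hw _)) (contDiffAt_const.mul (hcw.rpow_const_of_ne hw.ne'))
    (by fun_prop (disch := assumption))
    (fun x => (2 - n) * x⁻¹) (fun _ => 0) (fun _ => 0) (fun _ => C)
    (fun x ρ => C * (4 - n) * x⁻¹ * ρ ^ (p / 2))
    (fun _ ρ => (C ^ 2 - k) * ρ ^ p) (e := p / 2)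
    (div_ne_zero hp two_ne_zero) ?_ ?_
  · filter_upwards [eventually_ne_nhds hz0] with x hx ρ hρ
    have hix := hasDerivAt_inv hx
    refine ⟨_, _, _, _, _, _, _, _, _, _,
      (HasJet.of_hasDerivAt (hix.const_mul _)).add
        (HasJet.mul_rpow (hasDerivAt_const x 0) hρ _),
      (HasJet.of_hasDerivAt (hasDerivAt_const x 0)).add
        (HasJet.mul_rpow (hasDerivAt_const x _) hρ _),
      HasJet.mul_rpow (hix.const_mul _) hρ _,
      HasJet.mul_rpow (hasDerivAt_const x _) hρ _, ?_⟩
    have hR : ρ ^ p = (ρ ^ (p / 2)) ^ 2 := rpow_eq_sq_rpow hρ (by ring)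
    -- Expressing `k` by `C` removes `K` and `s` and leaves a polynomial identity in `ρ^{p/2}`.
    have hk : k = -n * C ^ 2 / (2 * (2 - n)) := by
      have : k * (K ^ (p / 2)) ^ 2 = n * (n - 2) / 2 := hKe ▸ hKp
      rw [hC]
      field_simp
      linear_combination 2 * this + (2 * n - n ^ 2) * hs2
    constructor <;> simp only [coeffScale, coeffMixed, coeffX, coeffEuler, coeffRadial, hR] <;>
      generalize ρ ^ (p / 2) = R <;> simp only [hpn, hk] <;> field_simp <;> ring
  · have hcτ : ContinuousAt (fun y : ℝ × ℝ => s * (c₂ + (n - 4) * y.1)) z := by fun_prop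
    filter_upwards [eventually_snd (lt_mem_nhds hz), hcτ.eventually (lt_mem_nhds hτ)] with y hr hτ
    have hr0 := hr.ne'
    have hτ0 : c₂ + (n - 4) * y.1 ≠ 0 := right_ne_zero_of_mul hτ.ne'
    have hs0 : s ≠ 0 := left_ne_zero_of_mul hτ.ne'
    have hw : 0 < s * (c₂ + (n - 4) * y.1) / y.2 := div_pos hτ hr
    have e1 : HasDerivAt (fun t => c₂ + (n - 4) * t) (n - 4) y.1 := by
      simpa using ((hasDerivAt_id y.1).const_mul (n - 4)).const_add c₂
    have e2 : HasDerivAt (fun r => s * (c₂ + (n - 4) * y.1) / r)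
        (-(s * (c₂ + (n - 4) * y.1) / y.2 ^ 2)) y.2 := by
      refine ((hasDerivAt_const y.2 _).div (hasDerivAt_id y.2) hr0).congr_deriv ?_
      simp; field_simp
    have d1 := HasDerivAt.const_mul_rpow K (n - 2) ((e1.const_mul s).div_const y.2) hw
    have d2 := HasDerivAt.const_mul_rpow K (n - 2) e2 hw
    have d3 : HasDerivAt (fun t => c₁ + (1 - n / 2) * y.2 ^ 2 / (c₂ + (n - 4) * t))
        (-((1 - n / 2) * (n - 4) * y.2 ^ 2 / (c₂ + (n - 4) * y.1) ^ 2)) y.1 := by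
      refine (((hasDerivAt_const y.1 _).div e1 hτ0).const_add c₁).congr_deriv ?_
      field_simp; ring
    have d4 : HasDerivAt (fun r => c₁ + (1 - n / 2) * r ^ 2 / (c₂ + (n - 4) * y.1))
        ((2 - n) * y.2 / (c₂ + (n - 4) * y.1)) y.2 := by
      refine (((((hasDerivAt_id y.2).pow 2).const_mul (1 - n / 2)).div_const
        (c₂ + (n - 4) * y.1)).const_add c₁).congr_deriv ?_
      simp; field_simp
    have hρ : (K * (s * (c₂ + (n - 4) * y.1) / y.2) ^ (n - 2)) ^ (p / 2) =
        K ^ (p / 2) * (s * (c₂ + (n - 4) * y.1) / y.2)⁻¹ := by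
      rw [Real.mul_rpow hK.le (Real.rpow_pos_of_pos hw _).le, ← Real.rpow_mul hw.le,
        show (n - 2) * (p / 2) = -1 by rw [hpn]; field_simp; ring, Real.rpow_neg_one]
    have hρp : (K * (s * (c₂ + (n - 4) * y.1) / y.2) ^ (n - 2)) ^ p =
        (K ^ (p / 2) * (s * (c₂ + (n - 4) * y.1) / y.2)⁻¹) ^ 2 := by
      rw [← hρ]; exact rpow_eq_sq_rpow (mul_pos hK (Real.rpow_pos_of_pos hw _)) (by ring)
    refine ⟨_, _, _, _, d1, d2, d3, d4, ?_⟩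
    simp only [hρ, hρp]
    have hk : k * (K ^ (p / 2)) ^ 2 = n * (n - 2) / 2 := hKe ▸ hKp
    have hA : (s * (c₂ + (n - 4) * y.1) / y.2) ^ (n - 2) ≠ 0 := (Real.rpow_pos_of_pos hw _).ne'
    generalize (s * (c₂ + (n - 4) * y.1) / y.2) ^ (n - 2) = A at hA ⊢
    generalize K ^ (p / 2) = κ at *
    rw [hC]
    refine ⟨?_, ?_, ?_, ?_⟩
    · field_simp; ring
    · field_simp
      rw [hs2]
      linear_combination 2 * hk
    · field_simp; ring
    · simp; field_simp

/-- Static solutions `K (r + c₂ r^{3-n})^{(2-n)/(3-n)}`. -/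
theorem isExactAt_static {n p k K s c₁ c₂ : ℝ} {z : ℝ × ℝ} (hn2 : n ≠ 2) (hn3 : n ≠ 3)
    (hpn : p = 2 * (3 - n) / (n - 2)) (hK : 0 < K)
    (hKp : k * K ^ p = (2 - n) ^ 3 / (3 - n) ^ 2) (hz : 0 < z.2)
    (hs : s = 1 ∨ s = -1) (hw : 0 < s * (z.2 + c₂ * z.2 ^ (3 - n))) :
    IsExactAt .timeTranslation n p k
      (fun _ r => ((K * (s * (r + c₂ * r ^ (3 - n))) ^ ((2 - n) / (3 - n)) : ℝ) : ℂ) *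
        Complex.exp (Complex.I * (c₁ : ℂ))) z := by
  have h2n : n - 2 ≠ 0 := sub_ne_zero.2 hn2
  have h3n : 3 - n ≠ 0 := sub_ne_zero.2 hn3.symm
  have hp : p ≠ 0 := by rw [hpn]; exact div_ne_zero (mul_ne_zero two_ne_zero h3n) h2n
  have hs2 : s ^ 2 = 1 := by rcases hs with rfl | rfl <;> norm_num
  have hz0 := hz.ne'
  have hcw : ContDiffAt ℝ 2 (fun y : ℝ × ℝ => s * (y.2 + c₂ * y.2 ^ (3 - n))) z :=
    contDiffAt_const.mul (contDiffAt_snd.add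
      (contDiffAt_const.mul (contDiffAt_snd.rpow_const_of_ne hz0)))
  have hKe : K ^ p = (K ^ (p / 2)) ^ 2 := rpow_eq_sq_rpow hK (by ring)
  have hKe0 : K ^ (p / 2) ≠ 0 := (Real.rpow_pos_of_pos hK _).ne'
  -- With `w = r + c₂ r^{3-n}` one has `w'/w = (3-n)/r - (2-n)/w`. Since `ρ^{p/2} = K^{p/2}/(s w)`,
  -- the amplitude satisfies the Bernoulli equation `A' = (2-n) A/r + C A^{1+p/2}` with this `C`,
  -- whatever `c₂` is.
  obtain ⟨C, hC⟩ : ∃ C, C = (2 - n) / (3 - n) * (n - 2) * s / K ^ (p / 2) := ⟨_, rfl⟩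
  refine IsExactAt.of_polar
    (A := fun _ r => K * (s * (r + c₂ * r ^ (3 - n))) ^ ((2 - n) / (3 - n)))
    (Φ := fun _ _ => c₁) hp (by simp) hz
    (mul_pos hK (Real.rpow_pos_of_pos hw _)) (contDiffAt_const.mul (hcw.rpow_const_of_ne hw.ne'))
    contDiffAt_const
    (fun x => (2 - n) * x⁻¹) (fun _ => C) (fun _ => 0) (fun _ => 0) (fun _ _ => 0) (fun _ _ => 0)
    (e := p / 2) (div_ne_zero hp two_ne_zero) ?_ ?_
  · filter_upwards [eventually_ne_nhds hz0] with x hx ρ hρ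
    refine ⟨_, _, _, _, _, _, _, _, _, _,
      (HasJet.of_hasDerivAt ((hasDerivAt_inv hx).const_mul _)).add
        (HasJet.mul_rpow (hasDerivAt_const x _) hρ _),
      (HasJet.of_hasDerivAt (hasDerivAt_const x 0)).add
        (HasJet.mul_rpow (hasDerivAt_const x 0) hρ _),
      HasJet.of_hasDerivAt (hasDerivAt_const x 0), HasJet.of_hasDerivAt (hasDerivAt_const x 0), ?_⟩
    have hR : ρ ^ p = (ρ ^ (p / 2)) ^ 2 := rpow_eq_sq_rpow hρ (by ring)
    have hk : k = -C ^ 2 / (n - 2) := by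
      have : k * (K ^ (p / 2)) ^ 2 = (2 - n) ^ 3 / (3 - n) ^ 2 := hKe ▸ hKp
      rw [hC]
      field_simp at this ⊢
      rw [hs2]
      linear_combination this
    constructor <;> simp only [coeffScale, coeffMixed, coeffX, coeffEuler, coeffRadial, hR] <;>
      generalize ρ ^ (p / 2) = R <;> simp only [hpn, hk] <;> field_simp <;> ring
  · filter_upwards [eventually_snd (lt_mem_nhds hz),
      hcw.continuousAt.eventually (lt_mem_nhds hw)] with y hr hw
    have hr0 := hr.ne'
    have e1 : HasDerivAt (fun r => s * (r + c₂ * r ^ (3 - n)))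
        (s * (1 + c₂ * ((3 - n) * (y.2 ^ (3 - n) / y.2)))) y.2 := by
      refine ((hasDerivAt_id y.2).add ((Real.hasDerivAt_rpow_const (p := 3 - n)
        (Or.inl hr0)).const_mul c₂)).const_mul s |>.congr_deriv ?_
      rw [Real.rpow_sub_one hr0]
    have d1 := HasDerivAt.const_mul_rpow K ((2 - n) / (3 - n)) e1 hw
    have hρ : (K * (s * (y.2 + c₂ * y.2 ^ (3 - n))) ^ ((2 - n) / (3 - n))) ^ (p / 2) =
        K ^ (p / 2) * (s * (y.2 + c₂ * y.2 ^ (3 - n)))⁻¹ := by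
      rw [Real.mul_rpow hK.le (Real.rpow_pos_of_pos hw _).le, ← Real.rpow_mul hw.le,
        show (2 - n) / (3 - n) * (p / 2) = -1 by rw [hpn]; field_simp; ring, Real.rpow_neg_one]
    refine ⟨_, _, _, _, hasDerivAt_const _ _, d1, hasDerivAt_const _ _, hasDerivAt_const _ _, ?_⟩
    simp only [hρ]
    refine ⟨by simp, by simp, ?_, by simp⟩
    have hw0 := right_ne_zero_of_mul hw.ne'
    have hs0 := left_ne_zero_of_mul hw.ne'
    generalize (s * (y.2 + c₂ * y.2 ^ (3 - n))) ^ ((2 - n) / (3 - n)) = A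
    generalize K ^ (p / 2) = κ at *
    generalize y.2 ^ (3 - n) = q at *
    rw [hC]
    field_simp
    ring

/-- The amplitude `r^{2-n}` is harmonic and its flux `r^{n-1} A² Φ_r` is constant, so only `k A^p =
Φ_r²` remains. That balance fixes `p` and `K`. -/
theorem isExactAt_powerPhase {n p k K c₁ c₂ : ℝ} {z : ℝ × ℝ} (hn2 : n ≠ 2) (hn3 : n ≠ 3)
    (hpn : p = 2 * (3 - n) / (n - 2)) (hK : 0 < K)
    (hKp : k * K ^ p = c₂ ^ 2 * (n - 2) ^ 2) (hz : 0 < z.2) :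
    IsExactAt .timeTranslation n p k
      (fun _ r => ((K * r ^ (2 - n) : ℝ) : ℂ) *
        Complex.exp (Complex.I * ((c₁ + c₂ * r ^ (n - 2) : ℝ) : ℂ))) z := by
  have h2n : n - 2 ≠ 0 := sub_ne_zero.2 hn2
  have h3n : 3 - n ≠ 0 := sub_ne_zero.2 hn3.symm
  have hp : p ≠ 0 := by rw [hpn]; exact div_ne_zero (mul_ne_zero two_ne_zero h3n) h2n
  have hz0 := hz.ne'
  have hKe : K ^ p = (K ^ (p / 2)) ^ 2 := rpow_eq_sq_rpow hK (by ring)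
  have hKe0 : K ^ (p / 2) ≠ 0 := (Real.rpow_pos_of_pos hK _).ne'
  obtain ⟨C, hC⟩ : ∃ C, C = c₂ * (n - 2) / K ^ (p / 2) := ⟨_, rfl⟩
  refine IsExactAt.of_polar (A := fun _ r => K * r ^ (2 - n))
    (Φ := fun _ r => c₁ + c₂ * r ^ (n - 2)) hp (by simp) hz
    (mul_pos hK (Real.rpow_pos_of_pos hz _))
    (contDiffAt_const.mul (contDiffAt_snd.rpow_const_of_ne hz0))
    (contDiffAt_const.add (contDiffAt_const.mul (contDiffAt_snd.rpow_const_of_ne hz0)))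
    (fun x => (2 - n) * x⁻¹) (fun _ => 0) (fun _ => 0) (fun _ => C) (fun _ _ => 0) (fun _ _ => 0)
    (e := p / 2) (div_ne_zero hp two_ne_zero) ?_ ?_
  · filter_upwards [eventually_ne_nhds hz0] with x hx ρ hρ
    refine ⟨_, _, _, _, _, _, _, _, _, _,
      (HasJet.of_hasDerivAt ((hasDerivAt_inv hx).const_mul _)).add
        (HasJet.mul_rpow (hasDerivAt_const x 0) hρ _),
      (HasJet.of_hasDerivAt (hasDerivAt_const x 0)).add
        (HasJet.mul_rpow (hasDerivAt_const x _) hρ _),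
      HasJet.of_hasDerivAt (hasDerivAt_const x 0), HasJet.of_hasDerivAt (hasDerivAt_const x 0), ?_⟩
    have hR : ρ ^ p = (ρ ^ (p / 2)) ^ 2 := rpow_eq_sq_rpow hρ (by ring)
    have hk : k = C ^ 2 := by
      have : k * (K ^ (p / 2)) ^ 2 = c₂ ^ 2 * (n - 2) ^ 2 := hKe ▸ hKp
      rw [hC]
      field_simp
      linear_combination this
    constructor <;> simp only [coeffScale, coeffMixed, coeffX, coeffEuler, coeffRadial, hR] <;>
      generalize ρ ^ (p / 2) = R <;> simp only [hpn, hk] <;> field_simp <;> ring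
  · filter_upwards [eventually_snd (lt_mem_nhds hz)] with y hr
    have hr0 := hr.ne'
    have d1 := HasDerivAt.const_mul_rpow K (2 - n) (hasDerivAt_id y.2) hr
    have d2 := (HasDerivAt.const_mul_rpow c₂ (n - 2) (hasDerivAt_id y.2) hr).const_add c₁
    have hρ : (K * y.2 ^ (2 - n)) ^ (p / 2) = K ^ (p / 2) * (y.2 ^ (n - 2) / y.2) := by
      rw [Real.mul_rpow hK.le (Real.rpow_pos_of_pos hr _).le, ← Real.rpow_mul hr.le,
        show (2 - n) * (p / 2) = n - 2 - 1 by rw [hpn]; field_simp; ring, Real.rpow_sub_one hr0]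
    refine ⟨_, _, _, _, hasDerivAt_const _ _, d1, hasDerivAt_const _ _, d2, ?_⟩
    simp only [hρ]
    refine ⟨by simp, by simp, by simp, ?_⟩
    rw [hC]
    simp
    field_simp

/-- Pseudo-conformal images of the static solutions. -/
theorem isExactAt_conformalStatic {n p k K s c₁ c₂ : ℝ} {z : ℝ × ℝ} (hn : n ^ 2 = n + 4)
    (hpn : p = 4 / n) (hK : 0 < K)
    (hKp : k * K ^ p = -2 * n / (n + 3)) (hz : 0 < z.2) (ht : 0 < z.1)
    (hs : s = 1 ∨ s = -1) (hw : 0 < s * (z.2 + c₂ * z.1 ^ (n - 2) * z.2 ^ (3 - n))) :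
    IsExactAt .inversion n p k
      (fun t r => ((K * (s * (r + c₂ * t ^ (n - 2) * r ^ (3 - n))) ^ (-n / 2) : ℝ) : ℂ) *
        Complex.exp (Complex.I * ((c₁ - r ^ 2 / (4 * t) : ℝ) : ℂ))) z := by
  have hn0 : n ≠ 0 := by rintro rfl; norm_num at hn
  have hn3 : n + 3 ≠ 0 := by
    intro h; have : n = -3 := by linarith
    rw [this] at hn; norm_num at hn
  have hp : p ≠ 0 := by rw [hpn]; exact div_ne_zero (by norm_num) hn0
  have hs2 : s ^ 2 = 1 := by rcases hs with rfl | rfl <;> norm_num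
  have hz0 := hz.ne'
  have ht0 := ht.ne'
  have ht4 : 4 * z.1 ≠ 0 := mul_ne_zero (by norm_num) ht0
  have hcw : ContDiffAt ℝ 2
      (fun y : ℝ × ℝ => s * (y.2 + c₂ * y.1 ^ (n - 2) * y.2 ^ (3 - n))) z :=
    contDiffAt_const.mul (contDiffAt_snd.add
      ((contDiffAt_const.mul (contDiffAt_fst.rpow_const_of_ne ht0)).mul
        (contDiffAt_snd.rpow_const_of_ne hz0)))
  have hKe : K ^ p = (K ^ (2 / n)) ^ 2 := rpow_eq_sq_rpow hK (by rw [hpn]; ring)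
  have hKe0 : K ^ (2 / n) ≠ 0 := (Real.rpow_pos_of_pos hK _).ne'
  -- The static coefficient again: `n² = n + 4` gives `(2-n)/(3-n) = -n/2`.
  obtain ⟨C, hC⟩ : ∃ C, C = -n / 2 * (n - 2) * s / K ^ (2 / n) := ⟨_, rfl⟩
  refine IsExactAt.of_polar
    (A := fun t r => K * (s * (r + c₂ * t ^ (n - 2) * r ^ (3 - n))) ^ (-n / 2))
    (Φ := fun t r => c₁ - r ^ 2 / (4 * t)) hp (fun _ => ⟨hpn, ht0⟩) hz
    (mul_pos hK (Real.rpow_pos_of_pos hw _)) (contDiffAt_const.mul (hcw.rpow_const_of_ne hw.ne'))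
    (by fun_prop (disch := assumption))
    (fun _ => 2 - n) (fun _ => C) (fun _ => 0) (fun _ => 0) (fun _ _ => 0) (fun _ _ => 0)
    (e := 2 / n) (div_ne_zero two_ne_zero hn0) ?_ ?_
  · refine Eventually.of_forall fun x ρ hρ => ?_
    refine ⟨_, _, _, _, _, _, _, _, _, _,
      (HasJet.of_hasDerivAt (hasDerivAt_const x _)).add
        (HasJet.mul_rpow (hasDerivAt_const x _) hρ _),
      (HasJet.of_hasDerivAt (hasDerivAt_const x 0)).add
        (HasJet.mul_rpow (hasDerivAt_const x 0) hρ _),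
      HasJet.of_hasDerivAt (hasDerivAt_const x 0), HasJet.of_hasDerivAt (hasDerivAt_const x 0), ?_⟩
    have hR : ρ ^ p = (ρ ^ (2 / n)) ^ 2 := rpow_eq_sq_rpow hρ (by rw [hpn]; ring)
    have hk : k = -C ^ 2 * (n + 2) / n := by
      have : k * (K ^ (2 / n)) ^ 2 = -2 * n / (n + 3) := hKe ▸ hKp
      rw [hC]
      field_simp at this ⊢
      rw [hs2]
      -- Modulo `n² = n + 4` the factor `(n-2)²` is `8 - 3n` and `(n+2)(n+3)` is `6n + 10`; this
      -- reconciles the two expressions for `k`.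
      have h8 : (n - 2) ^ 2 * (n + 2) * (n + 3) = 8 := by
        linear_combination (n ^ 2 + 2 * n - 4) * hn
      apply mul_left_cancel₀ hn3
      linear_combination 4 * this + n * h8
    constructor <;> simp only [coeffScale, coeffMixed, coeffX, coeffEuler, coeffRadial, hR] <;>
      generalize ρ ^ (2 / n) = R <;> (try simp only [hk]) <;> field_simp <;>
      first | ring1 | linear_combination 2 * C * R * hn
  · filter_upwards [eventually_snd (lt_mem_nhds hz), eventually_fst (lt_mem_nhds ht),
      hcw.continuousAt.eventually (lt_mem_nhds hw)] with y hr ht hw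
    have hr0 := hr.ne'
    have ht0 := ht.ne'
    have e1 : HasDerivAt (fun r => s * (r + c₂ * y.1 ^ (n - 2) * r ^ (3 - n)))
        (s * (1 + c₂ * y.1 ^ (n - 2) * ((3 - n) * (y.2 ^ (3 - n) / y.2)))) y.2 := by
      refine ((hasDerivAt_id y.2).add ((Real.hasDerivAt_rpow_const (p := 3 - n)
        (Or.inl hr0)).const_mul (c₂ * y.1 ^ (n - 2)))).const_mul s |>.congr_deriv ?_
      rw [Real.rpow_sub_one hr0]
    have e2 : HasDerivAt (fun t => s * (y.2 + c₂ * t ^ (n - 2) * y.2 ^ (3 - n)))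
        (s * (c₂ * ((n - 2) * (y.1 ^ (n - 2) / y.1)) * y.2 ^ (3 - n))) y.1 := by
      refine ((((Real.hasDerivAt_rpow_const (p := n - 2)
        (Or.inl ht0)).const_mul c₂).mul_const (y.2 ^ (3 - n))).const_add y.2).const_mul s
        |>.congr_deriv ?_
      rw [Real.rpow_sub_one ht0]
    have d1 := HasDerivAt.const_mul_rpow K (-n / 2) e1 hw
    have d2 := HasDerivAt.const_mul_rpow K (-n / 2) e2 hw
    have d3 : HasDerivAt (fun t => c₁ - y.2 ^ 2 / (4 * t)) (y.2 ^ 2 / (4 * y.1 ^ 2)) y.1 := by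
      refine (((hasDerivAt_const y.1 (y.2 ^ 2)).div ((hasDerivAt_id y.1).const_mul 4)
        (by simpa using ht0)).const_sub c₁).congr_deriv ?_
      simp; field_simp
    have d4 : HasDerivAt (fun r => c₁ - r ^ 2 / (4 * y.1)) (-(y.2 / (2 * y.1))) y.2 := by
      refine ((((hasDerivAt_id y.2).pow 2).div_const (4 * y.1)).const_sub c₁).congr_deriv ?_
      simp; field_simp; norm_num
    have hρ : (y.2 ^ (n / 2) * (K * (s * (y.2 + c₂ * y.1 ^ (n - 2) * y.2 ^ (3 - n))) ^ (-n / 2)))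
        ^ (2 / n) =
        y.2 * (K ^ (2 / n) * (s * (y.2 + c₂ * y.1 ^ (n - 2) * y.2 ^ (3 - n)))⁻¹) := by
      have hwp := Real.rpow_pos_of_pos hw (-n / 2)
      rw [Real.mul_rpow (Real.rpow_pos_of_pos hr _).le (mul_pos hK hwp).le,
        Real.mul_rpow hK.le hwp.le, ← Real.rpow_mul hw.le, ← Real.rpow_mul hr.le,
        show -n / 2 * (2 / n) = -1 by field_simp, show n / 2 * (2 / n) = 1 by field_simp,
        Real.rpow_neg_one, Real.rpow_one]
    refine ⟨_, _, _, _, d2, d1, d3, d4, ?_⟩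
    simp only [hρ]
    have hw0 := right_ne_zero_of_mul hw.ne'
    have hs0 := left_ne_zero_of_mul hw.ne'
    generalize (s * (y.2 + c₂ * y.1 ^ (n - 2) * y.2 ^ (3 - n))) ^ (-n / 2) = A
    generalize K ^ (2 / n) = κ at *
    generalize y.2 ^ (3 - n) = q at *
    generalize y.1 ^ (n - 2) = q' at *
    rw [hC]
    refine ⟨?_, ?_, ?_, ?_⟩
    · field_simp; ring
    · field_simp; ring
    · field_simp
      linear_combination A * (y.2 + c₂ * q' * q) * hn
    · field_simp; ring

/-- The pseudo-conformal image, with weight `t^{-n/2}` and variable `r/t`, of the solution in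
`isExactAt_powerPhase`. The preimage is static, hence `G = 0`; the relation `n² = n + 4` makes the
two required powers `p` coincide. -/
theorem isExactAt_conformalPowerPhase {n p k K c₁ c₂ : ℝ} {z : ℝ × ℝ} (hn : n ^ 2 = n + 4)
    (hpn : p = 4 / n) (hK : 0 < K) (hKp : k * K ^ p = c₂ ^ 2 * (8 - 3 * n)) (hz : 0 < z.2)
    (ht : 0 < z.1) :
    IsExactAt .inversion n p k
      (fun t r => ((K * r ^ (2 - n) * t ^ (-2 + n / 2) : ℝ) : ℂ) *
        Complex.exp (Complex.I *
          ((c₁ - r ^ 2 / (4 * t) + c₂ * r ^ (n - 2) * t ^ (2 - n) : ℝ) : ℂ))) z := by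
  have hn0 : n ≠ 0 := by rintro rfl; norm_num at hn
  have hp : p ≠ 0 := by rw [hpn]; exact div_ne_zero (by norm_num) hn0
  have hz0 := hz.ne'
  have ht0 := ht.ne'
  have ht4 : 4 * z.1 ≠ 0 := mul_ne_zero (by norm_num) ht0
  have hKe : K ^ p = (K ^ (2 / n)) ^ 2 := rpow_eq_sq_rpow hK (by rw [hpn]; ring)
  have hKe0 : K ^ (2 / n) ≠ 0 := (Real.rpow_pos_of_pos hK _).ne'
  obtain ⟨C, hC⟩ : ∃ C, C = c₂ * (n - 2) / K ^ (2 / n) := ⟨_, rfl⟩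
  refine IsExactAt.of_polar
    (A := fun t r => K * r ^ (2 - n) * t ^ (-2 + n / 2))
    (Φ := fun t r => c₁ - r ^ 2 / (4 * t) + c₂ * r ^ (n - 2) * t ^ (2 - n)) hp
    (fun _ => ⟨hpn, ht0⟩) hz
    (mul_pos (mul_pos hK (Real.rpow_pos_of_pos hz _)) (Real.rpow_pos_of_pos ht _))
    ((contDiffAt_const.mul (contDiffAt_snd.rpow_const_of_ne hz0)).mul
      (contDiffAt_fst.rpow_const_of_ne ht0))
    ((by fun_prop (disch := assumption) :
      ContDiffAt ℝ 2 (fun y : ℝ × ℝ => c₁ - y.2 ^ 2 / (4 * y.1)) z).add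
      ((contDiffAt_const.mul (contDiffAt_snd.rpow_const_of_ne hz0)).mul
        (contDiffAt_fst.rpow_const_of_ne ht0)))
    (fun _ => 2 - n) (fun _ => 0) (fun _ => 0) (fun _ => C) (fun _ _ => 0) (fun _ _ => 0)
    (e := 2 / n) (div_ne_zero two_ne_zero hn0) ?_ ?_
  · refine Eventually.of_forall fun x ρ hρ => ?_
    refine ⟨_, _, _, _, _, _, _, _, _, _,
      (HasJet.of_hasDerivAt (hasDerivAt_const x _)).add
        (HasJet.mul_rpow (hasDerivAt_const x _) hρ _),
      (HasJet.of_hasDerivAt (hasDerivAt_const x 0)).add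
        (HasJet.mul_rpow (hasDerivAt_const x _) hρ _),
      HasJet.of_hasDerivAt (hasDerivAt_const x 0), HasJet.of_hasDerivAt (hasDerivAt_const x 0), ?_⟩
    have hR : ρ ^ p = (ρ ^ (2 / n)) ^ 2 := rpow_eq_sq_rpow hρ (by rw [hpn]; ring)
    have hk : k = C ^ 2 := by
      have : k * (K ^ (2 / n)) ^ 2 = c₂ ^ 2 * (8 - 3 * n) := hKe ▸ hKp
      rw [hC]
      field_simp
      linear_combination this - c₂ ^ 2 * hn
    constructor <;> simp only [coeffScale, coeffMixed, coeffX, coeffEuler, coeffRadial, hR] <;>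
      generalize ρ ^ (2 / n) = R <;> (try simp only [hk]) <;> field_simp <;>
      first | ring1 | linear_combination 2 * C * R * hn
  · filter_upwards [eventually_snd (lt_mem_nhds hz), eventually_fst (lt_mem_nhds ht)] with y hr ht
    have hr0 := hr.ne'
    have ht0 := ht.ne'
    have d1 := (HasDerivAt.const_mul_rpow K (2 - n) (hasDerivAt_id y.2) hr).mul_const
      (y.1 ^ (-2 + n / 2))
    have d2 := HasDerivAt.const_mul_rpow (K * y.2 ^ (2 - n)) (-2 + n / 2) (hasDerivAt_id y.1) ht
    have d3 : HasDerivAt (fun t => c₁ - y.2 ^ 2 / (4 * t)) (y.2 ^ 2 / (4 * y.1 ^ 2)) y.1 := by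
      refine (((hasDerivAt_const y.1 (y.2 ^ 2)).div ((hasDerivAt_id y.1).const_mul 4)
        (by simpa using ht0)).const_sub c₁).congr_deriv ?_
      simp; field_simp
    have d4 : HasDerivAt (fun r => c₁ - r ^ 2 / (4 * y.1)) (-(y.2 / (2 * y.1))) y.2 := by
      refine ((((hasDerivAt_id y.2).pow 2).div_const (4 * y.1)).const_sub c₁).congr_deriv ?_
      simp; field_simp; norm_num
    have d5 := (HasDerivAt.const_mul_rpow c₂ (n - 2) (hasDerivAt_id y.2) hr).mul_const
      (y.1 ^ (2 - n))
    have d6 := HasDerivAt.const_mul_rpow (c₂ * y.2 ^ (n - 2)) (2 - n) (hasDerivAt_id y.1) ht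
    have hρ : (y.2 ^ (n / 2) * (K * y.2 ^ (2 - n) * y.1 ^ (-2 + n / 2))) ^ (2 / n) =
        K ^ (2 / n) * (y.2 ^ (n - 2) * y.1 ^ (2 - n)) := by
      have h1 := Real.rpow_pos_of_pos hr (2 - n)
      have h2 := Real.rpow_pos_of_pos ht (-2 + n / 2)
      -- In this form the quadratic relation removes `n` from denominators in the exponents.
      have hnn : n - 1 = 4 / n := by field_simp; linear_combination hn
      rw [Real.mul_rpow (Real.rpow_pos_of_pos hr _).le (mul_pos (mul_pos hK h1) h2).le,
        Real.mul_rpow (mul_pos hK h1).le h2.le, Real.mul_rpow hK.le h1.le, ← Real.rpow_mul ht.le,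
        ← Real.rpow_mul hr.le, ← Real.rpow_mul hr.le,
        show (-2 + n / 2) * (2 / n) = 2 - n by
          rw [show 2 - n = 1 - (n - 1) by ring, hnn]; field_simp; ring,
        show n / 2 * (2 / n) = 1 by field_simp,
        show n - 2 = 1 + (2 - n) * (2 / n) by
          rw [show n - 2 = (n - 1) - 1 by ring, hnn]; field_simp; ring, Real.rpow_add hr]
      ring
    refine ⟨_, _, _, _, d2, d1, d3.add d6, d4.add d5, ?_⟩
    simp only [hρ]
    rw [hC]
    refine ⟨?_, ?_, ?_, ?_⟩
    · simp only [id_eq]; field_simp; ring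
    · simp only [id_eq]; field_simp; ring
    · simp; field_simp
    · simp; field_simp

/-- For `n = 3` the substitution `w = r u` gives `i w_t = w_rr + (k r/|w|) w`. If `|w|` depends on
`t` only, this is a Schrödinger equation with a linear potential, solved by a phase quadratic in
`r`. Here `|w| = c₂ t^{-1/2}`, the amplitude of the spreading kernel. -/
theorem isExactAt_coulombPhase {k c₁ c₂ : ℝ} {z : ℝ × ℝ} (hc : 0 < c₂) (hz : 0 < z.2)
    (ht : 0 < z.1) :
    IsExactAt .scaling 3 (-1) k
      (fun t r => ((c₂ / (r * t ^ (1 / 2 : ℝ)) : ℝ) : ℂ) *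
        Complex.exp (Complex.I *
          ((c₁ - r ^ 2 / (4 * t) - 2 * k * r * t ^ (3 / 2 : ℝ) / (5 * c₂)
          + k ^ 2 * t ^ 4 / (25 * c₂ ^ 2) : ℝ) : ℂ))) z := by
  have hz0 := hz.ne'
  have ht0 := ht.ne'
  have hc0 := hc.ne'
  have ht4 : 4 * z.1 ≠ 0 := mul_ne_zero (by norm_num) ht0
  have hh := Real.rpow_pos_of_pos ht (1 / 2)
  refine IsExactAt.of_polar (A := fun t r => c₂ / (r * t ^ (1 / 2 : ℝ)))
    (Φ := fun t r => c₁ - r ^ 2 / (4 * t) - 2 * k * r * t ^ (3 / 2 : ℝ) / (5 * c₂)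
          + k ^ 2 * t ^ 4 / (25 * c₂ ^ 2)) (by norm_num) (by simp) hz (div_pos hc (mul_pos hz hh))
    (contDiffAt_const.div (contDiffAt_snd.mul (contDiffAt_fst.rpow_const_of_ne ht0))
      (mul_pos hz hh).ne')
    (((by fun_prop (disch := assumption) :
      ContDiffAt ℝ 2 (fun y : ℝ × ℝ => c₁ - y.2 ^ 2 / (4 * y.1)) z).sub
      (((contDiffAt_const.mul contDiffAt_snd).mul
        (contDiffAt_fst.rpow_const_of_ne ht0)).div_const _)).add (by fun_prop))
    (fun _ => -1) (fun _ => 0) (fun x => -(1 / 2) * x⁻¹) (fun x => -(2 * k / 5) * x)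
    (fun x _ => -(1 / 2) * x⁻¹)
    (fun x ρ => (1 / 4 * (x⁻¹) ^ 2 + -(3 * k / 5) * ρ ^ (-1 : ℝ)) +
      4 * k ^ 2 / 25 * x ^ 2 * ρ ^ (-2 : ℝ))
    (e := -1) (by norm_num) ?_ ?_
  · have hx0 : z.1 / z.2 ^ 2 ≠ 0 := div_ne_zero ht0 (pow_ne_zero 2 hz0)
    simp only [invX]
    filter_upwards [eventually_ne_nhds hx0] with x hx ρ hρ
    have hix := (hasDerivAt_inv hx).const_mul (-(1 / 2) : ℝ)
    refine ⟨_, _, _, _, _, _, _, _, _, _,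
      (HasJet.of_hasDerivAt (hasDerivAt_const x _)).add
        (HasJet.mul_rpow (hasDerivAt_const x _) hρ _),
      (HasJet.of_hasDerivAt hix).add (HasJet.mul_rpow ((hasDerivAt_id x).const_mul _) hρ _),
      HasJet.of_hasDerivAt hix,
      ((HasJet.of_hasDerivAt (((hasDerivAt_inv hx).pow 2).const_mul _)).add
        (HasJet.mul_rpow (hasDerivAt_const x _) hρ _)).add
        (HasJet.mul_rpow (((hasDerivAt_id x).pow 2).const_mul _) hρ _), ?_⟩
    have hR : ρ ^ (-2 : ℝ) = (ρ ^ (-1 : ℝ)) ^ 2 := rpow_eq_sq_rpow hρ (by norm_num)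
    constructor <;> simp only [coeffScale, coeffMixed, coeffX, coeffEuler, coeffRadial, hR] <;>
      generalize ρ ^ (-1 : ℝ) = R <;> simp <;> field_simp <;> ring
  · filter_upwards [eventually_snd (lt_mem_nhds hz), eventually_fst (lt_mem_nhds ht)] with y hr ht
    have hr0 := hr.ne'
    have ht0 := ht.ne'
    have hh := Real.rpow_pos_of_pos ht (1 / 2)
    have hh0 := hh.ne'
    have h2 : (y.1 ^ (1 / 2 : ℝ)) ^ 2 = y.1 := by
      rw [← Real.rpow_natCast, ← Real.rpow_mul ht.le]; norm_num
    have h3 : y.1 ^ (3 / 2 : ℝ) = y.1 * y.1 ^ (1 / 2 : ℝ) := by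
      rw [show (3 / 2 : ℝ) = 1 + 1 / 2 by norm_num, Real.rpow_add ht, Real.rpow_one]
    have e1 := HasDerivAt.const_mul_rpow y.2 (1 / 2) (hasDerivAt_id y.1) ht
    have e2 := HasDerivAt.const_mul_rpow (2 * k * y.2) (3 / 2) (hasDerivAt_id y.1) ht
    have d1 := (hasDerivAt_const y.1 c₂).div e1 (mul_pos hr hh).ne'
    have d2 := (hasDerivAt_const y.2 c₂).div ((hasDerivAt_id y.2).mul_const (y.1 ^ (1 / 2 : ℝ)))
      (mul_pos hr hh).ne'
    have d3 : HasDerivAt (fun t => c₁ - y.2 ^ 2 / (4 * t)) (y.2 ^ 2 / (4 * y.1 ^ 2)) y.1 := by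
      refine (((hasDerivAt_const y.1 (y.2 ^ 2)).div ((hasDerivAt_id y.1).const_mul 4)
        (by simpa using ht0)).const_sub c₁).congr_deriv ?_
      simp; field_simp
    have d4 : HasDerivAt (fun r => c₁ - r ^ 2 / (4 * y.1)) (-(y.2 / (2 * y.1))) y.2 := by
      refine ((((hasDerivAt_id y.2).pow 2).div_const (4 * y.1)).const_sub c₁).congr_deriv ?_
      simp; field_simp; norm_num
    have d5 := (d3.sub (e2.div_const (5 * c₂))).add
      ((((hasDerivAt_id y.1).pow 4).const_mul (k ^ 2)).div_const (25 * c₂ ^ 2))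
    have d6 := (d4.sub ((((hasDerivAt_id y.2).const_mul (2 * k)).mul_const
      (y.1 ^ (3 / 2 : ℝ))).div_const (5 * c₂))).add_const (k ^ 2 * y.1 ^ 4 / (25 * c₂ ^ 2))
    refine ⟨_, _, _, _, d1, d2, d5, d6, ?_⟩
    have hq : y.2 ^ ((2 : ℝ) / (-1)) = (y.2 ^ 2)⁻¹ := by
      rw [show (2 : ℝ) / (-1) = -(2 : ℕ) by norm_num, Real.rpow_neg hr.le, Real.rpow_natCast]
    have hρ : 0 < (y.2 ^ 2)⁻¹ * (c₂ / (y.2 * y.1 ^ (1 / 2 : ℝ))) := by positivity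
    have hR : ((y.2 ^ 2)⁻¹ * (c₂ / (y.2 * y.1 ^ (1 / 2 : ℝ)))) ^ (-2 : ℝ) =
        (((y.2 ^ 2)⁻¹ * (c₂ / (y.2 * y.1 ^ (1 / 2 : ℝ))))⁻¹) ^ 2 := by
      have h := rpow_eq_sq_rpow (p := -2) (e := -1) hρ (by norm_num)
      rwa [Real.rpow_neg_one] at h
    simp only [id_eq, hq, hR, h3, Real.rpow_neg_one]
    generalize y.1 ^ (1 / 2 : ℝ) = q at *
    refine ⟨?_, ?_, ?_, ?_⟩
    · simp; field_simp
    · simp; field_simp; rw [h2]; ring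
    · simp; field_simp
    · simp; field_simp; ring

/-- The same linear-potential mechanism for `w = r u` with constant `|w| = c₂`; the phase is then
linear in `r`. -/
theorem isExactAt_linearPhase {k c₁ c₂ : ℝ} {z : ℝ × ℝ} (hc : 0 < c₂) (hz : 0 < z.2) :
    IsExactAt .scaling 3 (-1) k
      (fun t r => ((c₂ / r : ℝ) : ℂ) *
        Complex.exp (Complex.I *
          ((c₁ - k * t * r / c₂ + k ^ 2 * t ^ 3 / (3 * c₂ ^ 2) : ℝ) : ℂ))) z := by
  have hz0 := hz.ne'
  have hc0 := hc.ne'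
  refine IsExactAt.of_polar (A := fun _ r => c₂ / r)
    (Φ := fun t r => c₁ - k * t * r / c₂ + k ^ 2 * t ^ 3 / (3 * c₂ ^ 2)) (by norm_num) (by simp) hz
    (div_pos hc hz) (contDiffAt_const.div contDiffAt_snd hz0) (by fun_prop)
    (fun _ => -1) (fun _ => 0) (fun _ => 0) (fun x => -k * x) (fun _ _ => 0)
    (fun x ρ => -k * ρ ^ (-1 : ℝ) + k ^ 2 * x ^ 2 * ρ ^ (-2 : ℝ))
    (e := -1) (by norm_num) ?_ ?_
  · refine Eventually.of_forall fun x ρ hρ => ?_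
    refine ⟨_, _, _, _, _, _, _, _, _, _,
      (HasJet.of_hasDerivAt (hasDerivAt_const x _)).add
        (HasJet.mul_rpow (hasDerivAt_const x _) hρ _),
      (HasJet.of_hasDerivAt (hasDerivAt_const x _)).add
        (HasJet.mul_rpow ((hasDerivAt_id x).const_mul _) hρ _),
      HasJet.of_hasDerivAt (hasDerivAt_const x _),
      (HasJet.mul_rpow (hasDerivAt_const x _) hρ _).add
        (HasJet.mul_rpow (((hasDerivAt_id x).pow 2).const_mul _) hρ _), ?_⟩
    have hR : ρ ^ (-2 : ℝ) = (ρ ^ (-1 : ℝ)) ^ 2 := rpow_eq_sq_rpow hρ (by norm_num)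
    constructor <;> simp only [coeffScale, coeffMixed, coeffX, coeffEuler, coeffRadial, hR] <;>
      generalize ρ ^ (-1 : ℝ) = R <;> simp <;> ring
  · filter_upwards [eventually_snd (lt_mem_nhds hz)] with y hr
    have hr0 := hr.ne'
    have d2 := (hasDerivAt_const y.2 c₂).div (hasDerivAt_id y.2) hr0
    have d3 := (((((hasDerivAt_id y.1).const_mul k).mul_const y.2).div_const c₂).const_sub c₁).add
      ((((hasDerivAt_id y.1).pow 3).const_mul (k ^ 2)).div_const (3 * c₂ ^ 2))
    have d4 := ((((hasDerivAt_id y.2).const_mul (k * y.1)).div_const c₂).const_sub c₁).add_const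
      (k ^ 2 * y.1 ^ 3 / (3 * c₂ ^ 2))
    refine ⟨_, _, _, _, hasDerivAt_const _ _, d2, d3, d4, ?_⟩
    have hq : y.2 ^ ((2 : ℝ) / (-1)) = (y.2 ^ 2)⁻¹ := by
      rw [show (2 : ℝ) / (-1) = -(2 : ℕ) by norm_num, Real.rpow_neg hr.le, Real.rpow_natCast]
    have hρ : 0 < (y.2 ^ 2)⁻¹ * (c₂ / y.2) := by positivity
    have hR : ((y.2 ^ 2)⁻¹ * (c₂ / y.2)) ^ (-2 : ℝ) = (((y.2 ^ 2)⁻¹ * (c₂ / y.2))⁻¹) ^ 2 := by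
      have h := rpow_eq_sq_rpow (p := -2) (e := -1) hρ (by norm_num)
      rwa [Real.rpow_neg_one] at h
    simp only [hq, hR, Real.rpow_neg_one]
    refine ⟨?_, ?_, ?_, ?_⟩
    · simp
    · simp; field_simp
    · simp; field_simp
    · simp; field_simp

/-- Pseudo-conformal image of the rational family, available since `2/(2-n) = 4/n = 3` at `n = 4/3`.
Under `t ↦ -1/t` the factor linear in time becomes `1 + c₂ t` over `t`, up to constants. -/
theorem isExactAt_conformalRational {k K s c₁ c₂ : ℝ} {z : ℝ × ℝ} (hK : 0 < K)
    (hKp : -16 * k * K ^ (3 : ℝ) = 1) (hz : 0 < z.2) (hs : s = 1 ∨ s = -1)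
    (hT : 0 < s * (z.1 * (1 + c₂ * z.1))) :
    IsExactAt .inversion (4 / 3) 3 k
      (fun t r => ((K * r ^ (2 / 3 : ℝ) * (s * (t * (1 + c₂ * t))) ^ (-2 / 3 : ℝ) : ℝ) : ℂ) *
        Complex.exp (Complex.I *
          ((c₁ - r ^ 2 * (1 + 2 * c₂ * t) / (8 * t * (1 + c₂ * t)) : ℝ) : ℂ))) z := by
  have hs2 : s ^ 2 = 1 := by rcases hs with rfl | rfl <;> norm_num
  have hz0 := hz.ne'
  have hT0 : z.1 * (1 + c₂ * z.1) ≠ 0 := right_ne_zero_of_mul hT.ne'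
  have ht0 : z.1 ≠ 0 := left_ne_zero_of_mul hT0
  have h8 : 8 * z.1 * (1 + c₂ * z.1) ≠ 0 := by
    rw [mul_assoc]; exact mul_ne_zero (by norm_num) hT0
  have hcw : ContDiffAt ℝ 2 (fun y : ℝ × ℝ => s * (y.1 * (1 + c₂ * y.1))) z := by fun_prop
  have hKe : K ^ (3 : ℝ) = (K ^ (3 / 2 : ℝ)) ^ 2 := rpow_eq_sq_rpow hK (by norm_num)
  have hKe0 : K ^ (3 / 2 : ℝ) ≠ 0 := (Real.rpow_pos_of_pos hK _).ne'
  -- With `T = t (1 + c₂ t)` the invariant phase derivative is `r²/(4T)`, while `ρ^{3/2} = K^{3/2}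
  -- r²/(s T)`.
  obtain ⟨C, hC⟩ : ∃ C, C = s / (4 * K ^ (3 / 2 : ℝ)) := ⟨_, rfl⟩
  have hk : k = -C ^ 2 := by
    rw [hKe] at hKp
    rw [hC]
    field_simp
    rw [hs2]
    linear_combination -hKp
  refine IsExactAt.of_polar
    (A := fun t r => K * r ^ (2 / 3 : ℝ) * (s * (t * (1 + c₂ * t))) ^ (-2 / 3 : ℝ))
    (Φ := fun t r => c₁ - r ^ 2 * (1 + 2 * c₂ * t) / (8 * t * (1 + c₂ * t))) (by norm_num)
    (fun _ => ⟨by norm_num, ht0⟩) hz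
    (mul_pos (mul_pos hK (Real.rpow_pos_of_pos hz _)) (Real.rpow_pos_of_pos hT _))
    ((contDiffAt_const.mul (contDiffAt_snd.rpow_const_of_ne hz0)).mul
      (hcw.rpow_const_of_ne hT.ne'))
    (by fun_prop (disch := assumption))
    (fun _ => 2 / 3) (fun _ => 0) (fun _ => 0) (fun _ => C)
    (fun _ ρ => C * (8 / 3) * ρ ^ (3 / 2 : ℝ)) (fun _ ρ => 2 * C ^ 2 * ρ ^ (3 : ℝ))
    (e := 3 / 2) (by norm_num) ?_ ?_
  · refine Eventually.of_forall fun x ρ hρ => ?_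
    refine ⟨_, _, _, _, _, _, _, _, _, _,
      (HasJet.of_hasDerivAt (hasDerivAt_const x _)).add
        (HasJet.mul_rpow (hasDerivAt_const x _) hρ _),
      (HasJet.of_hasDerivAt (hasDerivAt_const x _)).add
        (HasJet.mul_rpow (hasDerivAt_const x _) hρ _),
      HasJet.mul_rpow (hasDerivAt_const x _) hρ _,
      HasJet.mul_rpow (hasDerivAt_const x _) hρ _, ?_⟩
    have hR : ρ ^ (3 : ℝ) = (ρ ^ (3 / 2 : ℝ)) ^ 2 := rpow_eq_sq_rpow hρ (by norm_num)
    constructor <;> simp only [coeffScale, coeffMixed, coeffX, coeffEuler, coeffRadial, hR, hk] <;>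
      generalize ρ ^ (3 / 2 : ℝ) = R <;> ring
  · filter_upwards [eventually_snd (lt_mem_nhds hz),
      hcw.continuousAt.eventually (lt_mem_nhds hT)] with y hr hT
    have hr0 := hr.ne'
    have hT0 : y.1 * (1 + c₂ * y.1) ≠ 0 := right_ne_zero_of_mul hT.ne'
    have hs0 : s ≠ 0 := left_ne_zero_of_mul hT.ne'
    have ht0 : y.1 ≠ 0 := left_ne_zero_of_mul hT0
    have ht1 : 1 + c₂ * y.1 ≠ 0 := right_ne_zero_of_mul hT0
    have h8 : 8 * y.1 * (1 + c₂ * y.1) ≠ 0 := by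
      rw [mul_assoc]; exact mul_ne_zero (by norm_num) hT0
    have e0 : HasDerivAt (fun t => 1 + c₂ * t) c₂ y.1 := by
      simpa using ((hasDerivAt_id y.1).const_mul c₂).const_add 1
    have e1 : HasDerivAt (fun t => s * (t * (1 + c₂ * t))) (s * (1 + 2 * c₂ * y.1)) y.1 := by
      refine (((hasDerivAt_id y.1).mul e0).const_mul s).congr_deriv ?_
      simp only [id_eq]; ring
    have e2 : HasDerivAt (fun t => y.2 ^ 2 * (1 + 2 * c₂ * t)) (y.2 ^ 2 * (2 * c₂)) y.1 := by
      simpa using (((hasDerivAt_id y.1).const_mul (2 * c₂)).const_add 1).const_mul (y.2 ^ 2)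
    have e3 : HasDerivAt (fun t => 8 * t * (1 + c₂ * t)) (8 * (1 + 2 * c₂ * y.1)) y.1 := by
      refine (((hasDerivAt_id y.1).const_mul 8).mul e0).congr_deriv ?_
      simp only [id_eq]; ring
    have d1 := HasDerivAt.const_mul_rpow (K * y.2 ^ (2 / 3 : ℝ)) (-2 / 3) e1 hT
    have d2 := (HasDerivAt.const_mul_rpow K (2 / 3) (hasDerivAt_id y.2) hr).mul_const
      ((s * (y.1 * (1 + c₂ * y.1))) ^ (-2 / 3 : ℝ))
    have d3 := (e2.div e3 h8).const_sub c₁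
    have d4 := ((((hasDerivAt_id y.2).pow 2).mul_const (1 + 2 * c₂ * y.1)).div_const
      (8 * y.1 * (1 + c₂ * y.1))).const_sub c₁
    have hρ0 : 0 < y.2 ^ ((4 / 3 : ℝ) / 2) * (K * y.2 ^ (2 / 3 : ℝ) *
        (s * (y.1 * (1 + c₂ * y.1))) ^ (-2 / 3 : ℝ)) :=
      mul_pos (Real.rpow_pos_of_pos hr _) (mul_pos (mul_pos hK (Real.rpow_pos_of_pos hr _))
        (Real.rpow_pos_of_pos hT _))
    have hρ : (y.2 ^ ((4 / 3 : ℝ) / 2) * (K * y.2 ^ (2 / 3 : ℝ) *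
        (s * (y.1 * (1 + c₂ * y.1))) ^ (-2 / 3 : ℝ))) ^ (3 / 2 : ℝ) =
        y.2 * (K ^ (3 / 2 : ℝ) * y.2 * (s * (y.1 * (1 + c₂ * y.1)))⁻¹) := by
      have h1 := Real.rpow_pos_of_pos hr (2 / 3)
      have h2 := Real.rpow_pos_of_pos hT (-2 / 3)
      rw [Real.mul_rpow (Real.rpow_pos_of_pos hr _).le (mul_pos (mul_pos hK h1) h2).le,
        Real.mul_rpow (mul_pos hK h1).le h2.le, Real.mul_rpow hK.le h1.le, ← Real.rpow_mul hT.le,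
        ← Real.rpow_mul hr.le, ← Real.rpow_mul hr.le]
      norm_num [Real.rpow_neg_one]
    have hρ3 := rpow_eq_sq_rpow (p := 3) hρ0 (show (3 : ℝ) = 3 / 2 * 2 by norm_num)
    rw [hρ] at hρ3
    refine ⟨_, _, _, _, d1, d2, d3, d4, ?_⟩
    simp only [id_eq, hρ, hρ3]
    rw [hC]
    generalize (s * (y.1 * (1 + c₂ * y.1))) ^ (-2 / 3 : ℝ) = A
    generalize K ^ (3 / 2 : ℝ) = κ at *
    refine ⟨?_, ?_, ?_, ?_⟩
    · field_simp; ring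
    · field_simp; ring
    · simp; field_simp
    · simp; field_simp; ring

/-! ### Global form of the closed-form solutions -/

theorem PolarSolution.of_isExactAt {S : SymmetryGroup} {n p k : ℝ} {Ω : Set (ℝ × ℝ)}
    {A Φ : ℝ → ℝ → ℝ}
    (h : ∀ z ∈ Ω, (∀ᶠ y in 𝓝 z, y ∈ Ω) ∧ ContinuousAt (fun y : ℝ × ℝ => A y.1 y.2) z ∧
      (0 < A z.1 z.2 → IsExactAt S n p k
        (fun t r => (A t r : ℂ) * Complex.exp (Complex.I * (Φ t r : ℂ))) z)) :
    PolarSolution S n p k Ω A Φ :=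
  ExactSolution.of_isExactAt fun z hz =>
    ⟨(h z hz.1).1.and ((h z hz.1).2.1.eventually (lt_mem_nhds hz.2)), (h z hz.1).2.2 hz.2⟩

theorem exists_sign {w : ℝ} (hw : w ≠ 0) : ∃ σ : ℝ, (σ = 1 ∨ σ = -1) ∧ 0 < σ * w := by
  rcases hw.lt_or_gt with h | h
  · exact ⟨-1, Or.inr rfl, by linarith⟩
  · exact ⟨1, Or.inl rfl, by linarith⟩

/-- Principal powers of nonzero reals have locally constant phase. -/
theorem ofReal_cpow_of_sign {σ w : ℝ} (s : ℝ) (hσ : σ = 1 ∨ σ = -1) (h : 0 < σ * w) :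
    (w : ℂ) ^ (s : ℂ) = (((σ * w) ^ s : ℝ) : ℂ) *
      Complex.exp (Complex.I * ((Real.pi * s * (1 - σ) / 2 : ℝ) : ℂ)) := by
  rcases hσ with rfl | rfl
  · rw [one_mul] at h ⊢
    rw [Complex.ofReal_cpow h.le]
    simp
  · have hw : w ≤ 0 := by linarith
    rw [Complex.ofReal_cpow_of_nonpos hw, Complex.ofReal_cpow h.le]
    push_cast
    rw [neg_one_mul]
    congr 2
    ring

theorem exactSolution_rational {n p k σ c₁ c₂ : ℝ} (hk : k ≠ 0) (hσ : σ = 1 ∨ σ = -1) (hn : n ≠ 2)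
    (hp : p = 2 / (2 - n)) (hpos : 0 < n * (n - 2) / k) :
    ExactSolution .timeTranslation n p k {z | 0 < z.2 ∧ c₂ + (n - 4) * z.1 ≠ 0}
      (fun t r =>
        ((σ * Real.sqrt (n * (n - 2) / (2 * k)) : ℝ) : ℂ) ^ ((2 - n : ℝ) : ℂ)
          * (((c₂ + (n - 4) * t) / r : ℝ) : ℂ) ^ ((n - 2 : ℝ) : ℂ)
          * Complex.exp (Complex.I *
              ((c₁ + (1 - n / 2) * r ^ 2 / (c₂ + (n - 4) * t) : ℝ) : ℂ))) := by
  refine ExactSolution.of_isExactAt fun z ⟨hz, hτ⟩ => ?_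
  have hc : ContinuousAt (fun y : ℝ × ℝ => c₂ + (n - 4) * y.1) z := by fun_prop
  refine ⟨(eventually_snd (lt_mem_nhds hz)).and (hc.eventually_ne hτ), ?_⟩
  obtain ⟨s, hs, hsτ⟩ := exists_sign hτ
  have hn2 : 2 - n ≠ 0 := sub_ne_zero.2 hn.symm
  have hX : 0 < n * (n - 2) / (2 * k) := by
    have : n * (n - 2) / (2 * k) = n * (n - 2) / k / 2 := by field_simp
    rw [this]; positivity
  have hq := Real.sqrt_pos.2 hX
  have hKp : k * (Real.sqrt (n * (n - 2) / (2 * k)) ^ (2 - n)) ^ p = n * (n - 2) / 2 := by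
    rw [← Real.rpow_mul hq.le, show (2 - n) * p = (2 : ℕ) by rw [hp]; push_cast; field_simp,
      Real.rpow_natCast, Real.sq_sqrt hX.le]
    field_simp
  -- The phases of the two principal powers are locally constant and are absorbed into `c₁`.
  have h := isExactAt_rational (s := s) (c₂ := c₂)
    (c₁ := c₁ + Real.pi * (2 - n) * (1 - σ) / 2 + Real.pi * (n - 2) * (1 - s) / 2) hn hp
    (Real.rpow_pos_of_pos hq _) hKp hz hs hsτ
  refine h.congr ?_
  filter_upwards [eventually_snd (lt_mem_nhds hz),
    (continuousAt_const.mul hc).eventually (lt_mem_nhds hsτ)] with y hr hτ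
  have hσσ : σ * σ = 1 := by rcases hσ with rfl | rfl <;> norm_num
  have h1 := ofReal_cpow_of_sign (w := σ * Real.sqrt (n * (n - 2) / (2 * k))) (2 - n) hσ
    (by rwa [← mul_assoc, hσσ, one_mul])
  have h2 := ofReal_cpow_of_sign (w := (c₂ + (n - 4) * y.1) / y.2) (n - 2) hs
    (by rw [← mul_div_assoc]; exact div_pos hτ hr)
  rw [← mul_assoc, hσσ, one_mul] at h1
  rw [← mul_div_assoc] at h2
  rw [h1, h2]
  push_cast
  simp only [mul_add, Complex.exp_add]
  ring

theorem exactSolution_static {n p k c₁ c₂ : ℝ} (hn2 : n ≠ 2) (hn3 : n ≠ 3)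
    (hp : p = 2 * (3 - n) / (n - 2)) (hk : 0 < k * (2 - n)) :
    ExactSolution .timeTranslation n p k {z | 0 < z.2 ∧ z.2 + c₂ * z.2 ^ (3 - n) ≠ 0}
      (fun _ r =>
        (((k * (n - 3) ^ 2 / (2 - n) ^ 3) ^ ((2 - n) / (6 - 2 * n)) : ℝ) : ℂ)
          * ((r + c₂ * r ^ (3 - n) : ℝ) : ℂ) ^ (((2 - n) / (3 - n) : ℝ) : ℂ)
          * Complex.exp (Complex.I * (c₁ : ℂ))) := by
  refine ExactSolution.of_isExactAt fun z ⟨hz, hw⟩ => ?_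
  have hc : ContinuousAt (fun y : ℝ × ℝ => y.2 + c₂ * y.2 ^ (3 - n)) z :=
    continuousAt_snd.add (continuousAt_const.mul (continuousAt_snd.rpow_const (Or.inl hz.ne')))
  refine ⟨(eventually_snd (lt_mem_nhds hz)).and (hc.eventually_ne hw), ?_⟩
  obtain ⟨s, hs, hsw⟩ := exists_sign hw
  have h2n : n - 2 ≠ 0 := sub_ne_zero.2 hn2
  have h2n' : 2 - n ≠ 0 := sub_ne_zero.2 hn2.symm
  have h3n : 3 - n ≠ 0 := sub_ne_zero.2 hn3.symm
  have h3n' : n - 3 ≠ 0 := sub_ne_zero.2 hn3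
  have h62 : 6 - 2 * n ≠ 0 := by
    rw [show 6 - 2 * n = 2 * (3 - n) by ring]; exact mul_ne_zero two_ne_zero h3n
  have hk0 : k ≠ 0 := left_ne_zero_of_mul hk.ne'
  have hX : 0 < k * (n - 3) ^ 2 / (2 - n) ^ 3 := by
    have : k * (n - 3) ^ 2 / (2 - n) ^ 3 = k * (2 - n) * ((n - 3) / (2 - n) ^ 2) ^ 2 := by
      field_simp
    rw [this]; positivity
  have hKp : k * ((k * (n - 3) ^ 2 / (2 - n) ^ 3) ^ ((2 - n) / (6 - 2 * n))) ^ p =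
      (2 - n) ^ 3 / (3 - n) ^ 2 := by
    rw [← Real.rpow_mul hX.le, show (2 - n) / (6 - 2 * n) * p = -1 by
      rw [hp, show 6 - 2 * n = 2 * (3 - n) by ring]; field_simp; ring, Real.rpow_neg_one,
      show (3 - n) ^ 2 = (n - 3) ^ 2 by ring]
    field_simp
  have h := isExactAt_static (s := s) (c₂ := c₂)
    (c₁ := c₁ + Real.pi * ((2 - n) / (3 - n)) * (1 - s) / 2) hn2 hn3 hp
    (Real.rpow_pos_of_pos hX _) hKp hz hs hsw
  refine h.congr ?_
  filter_upwards [(continuousAt_const.mul hc).eventually (lt_mem_nhds hsw)] with y hw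
  rw [ofReal_cpow_of_sign ((2 - n) / (3 - n)) hs hw]
  push_cast
  simp only [mul_add, Complex.exp_add]
  ring

theorem polarSolution_powerPhase {n p k c₁ c₂ : ℝ} (hn2 : n ≠ 2) (hn3 : n ≠ 3)
    (hp : p = 2 * (3 - n) / (n - 2)) (hk : 0 < k) (hc₂ : c₂ ≠ 0) :
    PolarSolution .timeTranslation n p k {z | 0 < z.2}
      (fun _ r => (c₂ ^ 2 * (n - 2) ^ 2 / k) ^ ((n - 2) / (6 - 2 * n)) * r ^ (2 - n))
      (fun _ r => c₁ + c₂ * r ^ (n - 2)) := by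
  refine PolarSolution.of_isExactAt fun z (hz : 0 < z.2) => ⟨eventually_snd (lt_mem_nhds hz),
    continuousAt_const.mul (continuousAt_snd.rpow_const (Or.inl hz.ne')), fun _ => ?_⟩
  have h2n : n - 2 ≠ 0 := sub_ne_zero.2 hn2
  have h3n : 3 - n ≠ 0 := sub_ne_zero.2 hn3.symm
  have hX : 0 < c₂ ^ 2 * (n - 2) ^ 2 / k := by positivity
  refine isExactAt_powerPhase hn2 hn3 hp (Real.rpow_pos_of_pos hX _) ?_ hz
  rw [← Real.rpow_mul hX.le, show (n - 2) / (6 - 2 * n) * p = 1 by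
      rw [hp, show 6 - 2 * n = 2 * (3 - n) by ring]; field_simp, Real.rpow_one]
  field_simp

theorem polarSolution_planeWave {n p k c₁ c₂ : ℝ} (hp : p ≠ 0) (hk : k ≠ 0) (hc : 0 < c₂ / k) :
    PolarSolution .timeTranslation n p k {z | 0 < z.2} (fun _ _ => (c₂ / k) ^ (1 / p))
      (fun t _ => c₁ - c₂ * t) := by
  refine PolarSolution.of_isExactAt fun z (hz : 0 < z.2) => ⟨eventually_snd (lt_mem_nhds hz),
    continuousAt_const, fun h => isExactAt_planeWave hp hz h ?_⟩
  rw [← Real.rpow_mul hc.le, one_div_mul_cancel hp, Real.rpow_one]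
  field_simp

theorem polarSolution_chirped {n p k c₁ c₂ c₃ : ℝ} {φ : ℝ → ℝ} (hp : p ≠ 0) (hn : n ≠ 0)
    (hφ : ∀ t, 0 < c₂ + c₃ * t → ContDiffAt ℝ 2 φ t ∧
      HasDerivAt φ (-k * ((c₂ + c₃ * t) ^ (-n / 2)) ^ p) t) :
    PolarSolution .timeTranslation n p k {z | 0 < z.2 ∧ 0 < c₂ + c₃ * z.1}
      (fun t _ => (c₂ + c₃ * t) ^ (-n / 2))
      (fun t r => c₁ - c₃ * r ^ 2 / (4 * (c₂ + c₃ * t)) + φ t) := by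
  refine PolarSolution.of_isExactAt fun z ⟨hz, hτ⟩ => ?_
  have hc : ContinuousAt (fun y : ℝ × ℝ => c₂ + c₃ * y.1) z := by fun_prop
  exact ⟨(eventually_snd (lt_mem_nhds hz)).and (hc.eventually (lt_mem_nhds hτ)),
    hc.rpow_const (Or.inl hτ.ne'),
    fun h => isExactAt_chirped hp hn hz hτ (hφ _ hτ).1 fun t ht => (hφ t ht).2⟩

theorem polarSolution_chirped_power {n p k c₁ c₂ c₃ : ℝ} (hp : p ≠ 0) (hpn : p ≠ 2 / n)
    (hn : n ≠ 0) (hc₃ : c₃ ≠ 0) :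
    PolarSolution .timeTranslation n p k {z | 0 < z.2 ∧ 0 < c₂ + c₃ * z.1}
      (fun t _ => (c₂ + c₃ * t) ^ (-n / 2))
      (fun t r => c₁ - c₃ * r ^ 2 / (4 * (c₂ + c₃ * t))
        + 2 * k / (c₃ * (n * p - 2)) * (c₂ + c₃ * t) ^ (1 - n * p / 2)) := by
  refine polarSolution_chirped hp hn fun t ht => ⟨?_, ?_⟩
  · have hc : ContDiffAt ℝ 2 (fun t : ℝ => c₂ + c₃ * t) t := by fun_prop
    exact contDiffAt_const.mul (hc.rpow_const_of_ne ht.ne')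
  · have e1 : HasDerivAt (fun t => c₂ + c₃ * t) c₃ t := by
      simpa using ((hasDerivAt_id t).const_mul c₃).const_add c₂
    refine (HasDerivAt.const_mul_rpow _ _ e1 ht).congr_deriv ?_
    have hnp : n * p - 2 ≠ 0 := by
      intro h; apply hpn; field_simp; linarith
    have h0 := ht.ne'
    rw [← Real.rpow_mul ht.le, show 1 - n * p / 2 = -n / 2 * p + 1 by ring, Real.rpow_add ht,
      Real.rpow_one]
    field_simp
    ring

theorem polarSolution_chirped_log {n p k c₁ c₂ c₃ : ℝ} (hp : p ≠ 0) (hpn : p = 2 / n)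
    (hn : n ≠ 0) (hc₃ : c₃ ≠ 0) :
    PolarSolution .timeTranslation n p k {z | 0 < z.2 ∧ 0 < c₂ + c₃ * z.1}
      (fun t _ => (c₂ + c₃ * t) ^ (-n / 2))
      (fun t r => c₁ - c₃ * r ^ 2 / (4 * (c₂ + c₃ * t)) - k / c₃ * Real.log |c₂ + c₃ * t|) := by
  simp only [sub_eq_add_neg (_ - _) (_ * _), Real.log_abs]
  refine polarSolution_chirped hp hn fun t ht => ⟨?_, ?_⟩
  · have hc : ContDiffAt ℝ 2 (fun t : ℝ => c₂ + c₃ * t) t := by fun_prop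
    exact (contDiffAt_const.mul (hc.log ht.ne')).neg
  · have e1 : HasDerivAt (fun t => c₂ + c₃ * t) c₃ t := by
      simpa using ((hasDerivAt_id t).const_mul c₃).const_add c₂
    refine ((e1.log ht.ne').const_mul _).neg.congr_deriv ?_
    have h0 := ht.ne'
    rw [← Real.rpow_mul ht.le, show -n / 2 * p = -1 by rw [hpn]; field_simp, Real.rpow_neg_one]
    field_simp

theorem polarSolution_coulombPhase {k c₁ c₂ : ℝ} (hc : 0 < c₂) :
    PolarSolution .scaling 3 (-1) k {z | 0 < z.2 ∧ 0 < z.1}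
      (fun t r => c₂ / (r * t ^ (1 / 2 : ℝ)))
      (fun t r => c₁ - r ^ 2 / (4 * t) - 2 * k * r * t ^ (3 / 2 : ℝ) / (5 * c₂)
        + k ^ 2 * t ^ 4 / (25 * c₂ ^ 2)) :=
  PolarSolution.of_isExactAt fun _ ⟨hz, ht⟩ =>
    ⟨(eventually_snd (lt_mem_nhds hz)).and (eventually_fst (lt_mem_nhds ht)),
      continuousAt_const.div (continuousAt_snd.mul (continuousAt_fst.rpow_const (Or.inl ht.ne')))
        (mul_pos hz (Real.rpow_pos_of_pos ht _)).ne', fun _ => isExactAt_coulombPhase hc hz ht⟩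

theorem polarSolution_linearPhase {k c₁ c₂ : ℝ} (hc : 0 < c₂) :
    PolarSolution .scaling 3 (-1) k {z | 0 < z.2} (fun _ r => c₂ / r)
      (fun t r => c₁ - k * t * r / c₂ + k ^ 2 * t ^ 3 / (3 * c₂ ^ 2)) :=
  PolarSolution.of_isExactAt fun z (hz : 0 < z.2) =>
    ⟨eventually_snd (lt_mem_nhds hz), continuousAt_const.div continuousAt_snd hz.ne',
      fun _ => isExactAt_linearPhase hc hz⟩

/-- The quadratic relation is what the pseudo-conformal families use; both of its roots occur. -/
theorem sq_eq_of_sqrt_seventeen {n ε : ℝ} (hε : ε = 1 ∨ ε = -1)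
    (hn : n = (1 + ε * Real.sqrt 17) / 2) : n ^ 2 = n + 4 := by
  have h17 : Real.sqrt 17 ^ 2 = 17 := Real.sq_sqrt (by norm_num)
  have hε2 : ε ^ 2 = 1 := by rcases hε with rfl | rfl <;> norm_num
  rw [hn]
  linear_combination (ε ^ 2 / 4) * h17 + 17 / 4 * hε2

theorem eight_div_sqrt_seventeen {ε : ℝ} (hε : ε = 1 ∨ ε = -1) :
    8 / (1 + ε * Real.sqrt 17) = (ε * Real.sqrt 17 - 1) / 2 := by
  have h17 : Real.sqrt 17 ^ 2 = 17 := Real.sq_sqrt (by norm_num)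
  have hε2 : ε ^ 2 = 1 := by rcases hε with rfl | rfl <;> norm_num
  have hm : (ε * Real.sqrt 17 - 1) * (1 + ε * Real.sqrt 17) = 16 := by
    linear_combination ε ^ 2 * h17 + 17 * hε2
  have h0 : 1 + ε * Real.sqrt 17 ≠ 0 := by intro h; rw [h] at hm; norm_num at hm
  field_simp
  linear_combination -hm

theorem exactSolution_conformalStatic {n p k σ c₁ c₂ : ℝ} (hσ : σ = 1 ∨ σ = -1)
    (hn : n ^ 2 = n + 4) (hp : p = 4 / n) (hk : k * n < 0) :
    ExactSolution .inversion n p k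
      {z | 0 < z.2 ∧ 0 < z.1 ∧
        z.2 + c₂ * z.1 ^ (-1 + 4 / n) * z.2 ^ (2 * (1 - 2 / n)) ≠ 0}
      (fun t r =>
        ((σ * Real.sqrt (-k * (1 + 3 / n) / 2) : ℝ) : ℂ) ^ ((-n / 2 : ℝ) : ℂ)
          * ((r + c₂ * t ^ (-1 + 4 / n) * r ^ (2 * (1 - 2 / n)) : ℝ) : ℂ)
              ^ ((-n / 2 : ℝ) : ℂ)
          * Complex.exp (Complex.I * ((c₁ - r ^ 2 / (4 * t) : ℝ) : ℂ))) := by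
  have hn0 : n ≠ 0 := right_ne_zero_of_mul hk.ne
  have hk0 : k ≠ 0 := left_ne_zero_of_mul hk.ne
  have hnn : 4 / n = n - 1 := by field_simp; linear_combination -hn
  have hn3 : 0 < n + 3 := by nlinarith
  -- The stated exponents are the static ones, rewritten with `4/n = n - 1`.
  rw [show -1 + 4 / n = n - 2 by rw [hnn]; ring,
    show 2 * (1 - 2 / n) = 3 - n by rw [show 2 * (1 - 2 / n) = 2 - 4 / n by ring, hnn]; ring]
  refine ExactSolution.of_isExactAt fun z ⟨hz, ht, hw⟩ => ?_
  have hc : ContinuousAt (fun y : ℝ × ℝ => y.2 + c₂ * y.1 ^ (n - 2) * y.2 ^ (3 - n)) z :=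
    continuousAt_snd.add ((continuousAt_const.mul (continuousAt_fst.rpow_const (Or.inl ht.ne'))).mul
      (continuousAt_snd.rpow_const (Or.inl hz.ne')))
  refine ⟨(eventually_snd (lt_mem_nhds hz)).and ((eventually_fst (lt_mem_nhds ht)).and
    (hc.eventually_ne hw)), ?_⟩
  obtain ⟨s, hs, hsw⟩ := exists_sign hw
  have hX : 0 < -k * (1 + 3 / n) / 2 := by
    have : -k * (1 + 3 / n) / 2 = (-(k * n)) * (n + 3) / (2 * n ^ 2) := by field_simp
    rw [this]
    have : 0 < -(k * n) := by linarith
    positivity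
  have hq := Real.sqrt_pos.2 hX
  have hKp : k * (Real.sqrt (-k * (1 + 3 / n) / 2) ^ (-n / 2)) ^ p = -2 * n / (n + 3) := by
    rw [← Real.rpow_mul hq.le, show -n / 2 * p = -(2 : ℕ) by rw [hp]; push_cast; field_simp; norm_num,
      Real.rpow_neg hq.le, Real.rpow_natCast, Real.sq_sqrt hX.le]
    field_simp
  have h := isExactAt_conformalStatic (s := s) (c₂ := c₂)
    (c₁ := c₁ + Real.pi * (-n / 2) * (1 - σ) / 2 + Real.pi * (-n / 2) * (1 - s) / 2) hn hp
    (Real.rpow_pos_of_pos hq _) hKp hz ht hs hsw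
  refine h.congr ?_
  filter_upwards [(continuousAt_const.mul hc).eventually (lt_mem_nhds hsw)] with y hw
  have hσσ : σ * σ = 1 := by rcases hσ with rfl | rfl <;> norm_num
  have h1 := ofReal_cpow_of_sign (w := σ * Real.sqrt (-k * (1 + 3 / n) / 2)) (-n / 2) hσ
    (by rwa [← mul_assoc, hσσ, one_mul])
  rw [← mul_assoc, hσσ, one_mul] at h1
  rw [h1, ofReal_cpow_of_sign (-n / 2) hs hw]
  push_cast
  simp only [sub_eq_add_neg, mul_add, Complex.exp_add]
  ring

theorem polarSolution_conformalPowerPhase {n p k c₁ c₂ : ℝ} (hn : n ^ 2 = n + 4) (hp : p = 4 / n)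
    (hk : 0 < k) (hc₂ : c₂ ≠ 0) :
    PolarSolution .inversion n p k {z | 0 < z.2 ∧ 0 < z.1}
      (fun t r => (c₂ ^ 2 * (8 - 3 * n) / k) ^ (n / 4) * r ^ (2 - n) * t ^ (-2 + n / 2))
      (fun t r => c₁ - r ^ 2 / (4 * t) + c₂ * r ^ (n - 2) * t ^ (2 - n)) := by
  have hn0 : n ≠ 0 := by rintro rfl; norm_num at hn
  have hn2 : n - 2 ≠ 0 := by
    intro h; rw [show n = 2 by linarith] at hn; norm_num at hn
  -- The constant `8 - 3n` is `(n-2)²` in disguise, so the image has the same balance constant as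
  -- the static solution.
  have h8 : 0 < 8 - 3 * n := by
    rw [show 8 - 3 * n = (n - 2) ^ 2 by linear_combination -hn]; positivity
  refine PolarSolution.of_isExactAt fun z ⟨hz, ht⟩ =>
    ⟨(eventually_snd (lt_mem_nhds hz)).and (eventually_fst (lt_mem_nhds ht)),
    (continuousAt_const.mul (continuousAt_snd.rpow_const (Or.inl hz.ne'))).mul
      (continuousAt_fst.rpow_const (Or.inl ht.ne')), fun _ => ?_⟩
  have hX : 0 < c₂ ^ 2 * (8 - 3 * n) / k := by positivity
  refine isExactAt_conformalPowerPhase hn hp (Real.rpow_pos_of_pos hX _) ?_ hz ht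
  rw [← Real.rpow_mul hX.le, show n / 4 * p = 1 by rw [hp]; field_simp, Real.rpow_one]
  field_simp

theorem exactSolution_conformalRational {k c₁ c₂ : ℝ} (hk : k < 0) :
    ExactSolution .inversion (4 / 3) 3 k {z | 0 < z.2 ∧ z.1 * (1 + c₂ * z.1) ≠ 0}
      (fun t r =>
        (((-16 * k) ^ (-1 / 3 : ℝ) * r ^ (2 / 3 : ℝ) : ℝ) : ℂ)
          * ((t * (1 + c₂ * t) : ℝ) : ℂ) ^ ((-2 / 3 : ℝ) : ℂ)
          * Complex.exp (Complex.I *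
              ((c₁ - r ^ 2 * (1 + 2 * c₂ * t) / (8 * t * (1 + c₂ * t)) : ℝ) : ℂ))) := by
  refine ExactSolution.of_isExactAt fun z ⟨hz, hw⟩ => ?_
  have hc : ContinuousAt (fun y : ℝ × ℝ => y.1 * (1 + c₂ * y.1)) z := by fun_prop
  refine ⟨(eventually_snd (lt_mem_nhds hz)).and (hc.eventually_ne hw), ?_⟩
  obtain ⟨s, hs, hsw⟩ := exists_sign hw
  have hX : 0 < -16 * k := by linarith
  have hKp : -16 * k * ((-16 * k) ^ (-1 / 3 : ℝ)) ^ (3 : ℝ) = 1 := by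
    rw [← Real.rpow_mul hX.le, show (-1 / 3 : ℝ) * 3 = -1 by norm_num, Real.rpow_neg_one]
    exact mul_inv_cancel₀ hX.ne'
  have h := isExactAt_conformalRational (s := s) (c₂ := c₂)
    (c₁ := c₁ + Real.pi * (-2 / 3) * (1 - s) / 2) (Real.rpow_pos_of_pos hX _) hKp hz hs hsw
  refine h.congr ?_
  filter_upwards [(continuousAt_const.mul hc).eventually (lt_mem_nhds hsw)] with y hw
  rw [ofReal_cpow_of_sign (-2 / 3) hs hw]
  push_cast
  simp only [sub_eq_add_neg, mul_add, Complex.exp_add]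
  ring

/-! ### Linear homogeneous equations on the half-line -/

/-- On `(0, ∞)`, `f'' = P f' + Q f`. -/
def SolvesPos (P Q f : ℝ → ℝ) : Prop :=
  ∃ f' : ℝ → ℝ, ∀ x, 0 < x → HasDerivAt f (f' x) x ∧ HasDerivAt f' (P x * f' x + Q x * f x) x

theorem SolvesPos.add {P Q f g : ℝ → ℝ} (hf : SolvesPos P Q f) (hg : SolvesPos P Q g) :
    SolvesPos P Q (fun x => f x + g x) := by
  obtain ⟨f', hf⟩ := hf
  obtain ⟨g', hg⟩ := hg
  exact ⟨fun x => f' x + g' x, fun x hx => ⟨(hf x hx).1.add (hg x hx).1,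
    ((hf x hx).2.add (hg x hx).2).congr_deriv (by ring)⟩⟩

theorem SolvesPos.const_mul {P Q f : ℝ → ℝ} (hf : SolvesPos P Q f) (c : ℝ) :
    SolvesPos P Q (fun x => c * f x) := by
  obtain ⟨f', hf⟩ := hf
  exact ⟨fun x => c * f' x, fun x hx => ⟨(hf x hx).1.const_mul c,
    ((hf x hx).2.const_mul c).congr_deriv (by ring)⟩⟩

/-- The Bessel equation `f'' + f'/x + (q - ν²/x²) f = 0`. -/
def BesselEquation (ν q : ℝ) (f : ℝ → ℝ) : Prop :=
  SolvesPos (fun x => -1 / x) (fun x => ν ^ 2 / x ^ 2 - q) f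

theorem BesselEquation.comp_mul {ν q w : ℝ} {f : ℝ → ℝ} (hf : BesselEquation ν q f) (hw : 0 < w) :
    BesselEquation ν (q * w ^ 2) (fun x => f (w * x)) := by
  obtain ⟨f', hf⟩ := hf
  refine ⟨fun x => w * f' (w * x), fun x hx => ?_⟩
  have hl : HasDerivAt (fun x => w * x) w x := by simpa using (hasDerivAt_id x).const_mul w
  obtain ⟨h1, h2⟩ := hf (w * x) (mul_pos hw hx)
  refine ⟨(h1.comp x hl).congr_deriv (by ring), ((h2.comp x hl).const_mul w).congr_deriv ?_⟩
  field_simp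

/-! ### Power series with factorially small coefficients -/

theorem summable_of_factorial_bound {a : ℕ → ℝ} {C : ℝ} (ha : ∀ m, |a m| ≤ C / m.factorial)
    (x : ℝ) : Summable fun m => a m * x ^ m := by
  refine Summable.of_norm_bounded ((Real.summable_pow_div_factorial |x|).mul_left C) fun m => ?_
  rw [norm_mul, norm_pow, Real.norm_eq_abs, Real.norm_eq_abs]
  calc |a m| * |x| ^ m ≤ C / m.factorial * |x| ^ m := by gcongr; exact ha m
    _ = C * (|x| ^ m / m.factorial) := by ring

theorem succ_mul_factorial_bound {a : ℕ → ℝ} {C : ℝ} (ha : ∀ m, |a m| ≤ C / m.factorial) (m : ℕ) :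
    |(m + 1 : ℝ) * a (m + 1)| ≤ C / m.factorial := by
  have h0 : (0 : ℝ) < m + 1 := by positivity
  rw [abs_mul, abs_of_pos h0]
  calc (m + 1 : ℝ) * |a (m + 1)| ≤ (m + 1) * (C / (m + 1).factorial) := by gcongr; exact ha _
    _ = C / m.factorial := by rw [Nat.factorial_succ]; push_cast; field_simp

/-- The differentiated series is dominated on the ball of radius `|x| + 1` by a series of
exponential type; the index is then shifted, as the term `m = 0` vanishes. -/
theorem hasDerivAt_tsum_of_factorial_bound {a : ℕ → ℝ} {C : ℝ} (ha : ∀ m, |a m| ≤ C / m.factorial)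
    (x : ℝ) :
    HasDerivAt (fun y => ∑' m, a m * y ^ m) (∑' m : ℕ, (m + 1) * a (m + 1) * x ^ m) x := by
  have hu : Summable fun m : ℕ => |a m| * m * (|x| + 1) ^ (m - 1) := by
    rw [← summable_nat_add_iff 1]
    have := summable_of_factorial_bound (a := fun m => |(m + 1 : ℝ) * a (m + 1)|) (C := C)
      (fun m => by rw [abs_abs]; exact succ_mul_factorial_bound ha m) (|x| + 1)
    refine this.congr fun m => ?_
    have h0 : (0 : ℝ) < m + 1 := by positivity
    rw [abs_mul, abs_of_pos h0]
    push_cast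
    ring
  have hx : x ∈ Metric.ball (0 : ℝ) (|x| + 1) := by simp
  have hb : ∀ (m : ℕ) (y : ℝ), y ∈ Metric.ball (0 : ℝ) (|x| + 1) →
      ‖a m * (m * y ^ (m - 1))‖ ≤ |a m| * m * (|x| + 1) ^ (m - 1) := by
    intro m y hy
    rw [mem_ball_zero_iff, Real.norm_eq_abs] at hy
    rw [norm_mul, norm_mul, norm_pow, Real.norm_eq_abs, Real.norm_eq_abs, Real.norm_eq_abs,
      Nat.abs_cast, mul_assoc]
    gcongr
  have h := hasDerivAt_tsum_of_isPreconnected (g := fun m y => a m * y ^ m)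
    (g' := fun m y => a m * (m * y ^ (m - 1))) hu Metric.isOpen_ball
    (convex_ball (0 : ℝ) _).isPreconnected
    (fun m y _ => (hasDerivAt_pow m y).const_mul (a m)) hb hx (summable_of_factorial_bound ha x) hx
  refine h.congr_deriv ?_
  have hs : Summable fun m : ℕ => a m * (m * x ^ (m - 1)) :=
    Summable.of_norm_bounded hu fun m => hb m x hx
  rw [hs.tsum_eq_zero_add]
  simp only [Nat.cast_zero, zero_mul, mul_zero, zero_add, Nat.add_sub_cancel]
  refine tsum_congr fun m => ?_
  push_cast
  ring

/-! ### The Bessel functions `J` and `I` -/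

/-- `∑ εᵐ wᵐ / (m! Γ(m + ν + 1))`. -/
noncomputable def besselSeries (ε ν w : ℝ) : ℝ :=
  ∑' m : ℕ, ε ^ m / ((m.factorial : ℝ) * Real.Gamma (m + ν + 1)) * w ^ m

theorem gamma_le_gamma_nat_add {ν : ℝ} (hν : 0 ≤ ν) (m : ℕ) :
    Real.Gamma (ν + 1) ≤ Real.Gamma (m + ν + 1) := by
  induction m with
  | zero => simp
  | succ m ih =>
    have h0 : (0 : ℝ) ≤ m := Nat.cast_nonneg m
    have h1 : 0 < (m : ℝ) + ν + 1 := by positivity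
    have hg := Real.Gamma_pos_of_pos h1
    rw [show ((m + 1 : ℕ) : ℝ) + ν + 1 = (m + ν + 1) + 1 by push_cast; ring,
      Real.Gamma_add_one h1.ne']
    nlinarith

theorem besselSeries_bound {ε ν : ℝ} (hε : |ε| = 1) (hν : 0 ≤ ν) (m : ℕ) :
    |ε ^ m / ((m.factorial : ℝ) * Real.Gamma (m + ν + 1))| ≤
      1 / Real.Gamma (ν + 1) / m.factorial := by
  have hg := Real.Gamma_pos_of_pos (show 0 < ν + 1 by positivity)
  have hgm := gamma_le_gamma_nat_add hν m
  have hm : (0 : ℝ) < m.factorial := by positivity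
  rw [abs_div, abs_pow, hε, one_pow, abs_of_pos (mul_pos hm (hg.trans_le hgm)), div_div]
  gcongr 1 / ?_
  rw [mul_comm]
  gcongr

/-- The factor `m + 1` cancels in `(m + 1)!`, and the shift of the index raises the order of the
Gamma function by one. -/
theorem hasDerivAt_besselSeries {ε ν : ℝ} (hε : |ε| = 1) (hν : 0 ≤ ν) (w : ℝ) :
    HasDerivAt (besselSeries ε ν) (ε * besselSeries ε (ν + 1) w) w := by
  refine (hasDerivAt_tsum_of_factorial_bound (besselSeries_bound hε hν) w).congr_deriv ?_
  rw [besselSeries, ← tsum_mul_left]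
  refine tsum_congr fun m => ?_
  rw [show ((m + 1 : ℕ) : ℝ) + ν + 1 = m + (ν + 1) + 1 by push_cast; ring, Nat.factorial_succ]
  have hg := Real.Gamma_pos_of_pos (show 0 < (m : ℝ) + (ν + 1) + 1 by positivity)
  push_cast
  field_simp
  ring

/-- Coefficientwise this is `Γ(m+ν+2) = (m+ν+1) Γ(m+ν+1)`: the part `ν + 1` of the factor gives
order `ν + 1`, and the part `m`, after an index shift, gives order `ν + 2`. -/
theorem besselSeries_recurrence {ε ν : ℝ} (hε : |ε| = 1) (hν : 0 ≤ ν) (w : ℝ) :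
    besselSeries ε ν w =
      (ν + 1) * besselSeries ε (ν + 1) w + ε * w * besselSeries ε (ν + 2) w := by
  have hs : ∀ μ : ℝ, 0 ≤ μ →
      Summable fun m : ℕ => ε ^ m / ((m.factorial : ℝ) * Real.Gamma (m + μ + 1)) * w ^ m :=
    fun μ hμ => summable_of_factorial_bound (besselSeries_bound hε hμ) w
  have h2 : Summable fun m : ℕ =>
      m * (ε ^ m / ((m.factorial : ℝ) * Real.Gamma (m + ν + 2)) * w ^ m) := by
    rw [← summable_nat_add_iff 1]
    refine ((hs (ν + 2) (by linarith)).mul_left (ε * w)).congr fun m => ?_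
    rw [show ((m + 1 : ℕ) : ℝ) + ν + 2 = m + (ν + 2) + 1 by push_cast; ring, Nat.factorial_succ]
    have hg := Real.Gamma_pos_of_pos (show 0 < (m : ℝ) + (ν + 2) + 1 by positivity)
    push_cast
    field_simp
    ring
  have e2 : ε * w * besselSeries ε (ν + 2) w =
      ∑' m : ℕ, m * (ε ^ m / ((m.factorial : ℝ) * Real.Gamma (m + ν + 2)) * w ^ m) := by
    rw [h2.tsum_eq_zero_add, besselSeries, ← tsum_mul_left]
    simp only [Nat.cast_zero, zero_mul, zero_add]
    refine tsum_congr fun m => ?_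
    rw [show ((m + 1 : ℕ) : ℝ) + ν + 2 = m + (ν + 2) + 1 by push_cast; ring, Nat.factorial_succ]
    have hg := Real.Gamma_pos_of_pos (show 0 < (m : ℝ) + (ν + 2) + 1 by positivity)
    push_cast
    field_simp
    ring
  rw [e2, besselSeries, besselSeries, ← tsum_mul_left,
    ← ((hs (ν + 1) (by linarith)).mul_left (ν + 1)).tsum_add h2]
  refine tsum_congr fun m => ?_
  have h0 : 0 < (m : ℝ) + ν + 1 := by positivity
  have hg := Real.Gamma_pos_of_pos h0
  rw [show (m : ℝ) + (ν + 1) + 1 = (m + ν + 1) + 1 by ring, show (m : ℝ) + ν + 2 = (m + ν + 1) + 1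
    by ring, Real.Gamma_add_one h0.ne']
  generalize Real.Gamma (m + ν + 1) = g at hg
  field_simp
  ring

theorem hasDerivAt_rpow_mul_besselSeries {ε ν x : ℝ} (hε : |ε| = 1) (hν : 0 ≤ ν) (hx : 0 < x) :
    HasDerivAt (fun x => (x / 2) ^ ν * besselSeries ε ν ((x / 2) ^ 2))
      (ν / x * ((x / 2) ^ ν * besselSeries ε ν ((x / 2) ^ 2))
        + ε * ((x / 2) ^ (ν + 1) * besselSeries ε (ν + 1) ((x / 2) ^ 2))) x := by
  have hl : HasDerivAt (fun x : ℝ => x / 2) (1 / 2) x := (hasDerivAt_id x).div_const 2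
  have hx2 : 0 < x / 2 := by positivity
  have h1 := hl.rpow_const (p := ν) (Or.inl hx2.ne')
  have h2 := (hasDerivAt_besselSeries hε hν ((x / 2) ^ 2)).comp x (hl.pow 2)
  refine (h1.mul h2).congr_deriv ?_
  simp only [Function.comp_apply, Pi.pow_apply]
  rw [Real.rpow_sub_one hx2.ne', Real.rpow_add_one hx2.ne']
  generalize besselSeries ε ν ((x / 2) ^ 2) = S
  generalize besselSeries ε (ν + 1) ((x / 2) ^ 2) = S1
  field_simp
  norm_num
  ring

/-- With `f_ν` the function in question, `f_ν' = (ν/x) f_ν + ε f_{ν+1}`. Using this twice and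
removing order `ν + 2` by the three-term recurrence gives the equation; `ε = -1` is the ordinary
case and `ε = 1` the modified one. -/
theorem besselEquation_series {ε ν : ℝ} (hε : |ε| = 1) (hν : 0 ≤ ν) :
    BesselEquation ν (-ε) (fun x => (x / 2) ^ ν * besselSeries ε ν ((x / 2) ^ 2)) := by
  refine ⟨_, fun x hx => ⟨hasDerivAt_rpow_mul_besselSeries hε hν hx, ?_⟩⟩
  have hν1 : 0 ≤ ν + 1 := by linarith
  have h1 := hasDerivAt_rpow_mul_besselSeries hε hν hx
  have h2 := hasDerivAt_rpow_mul_besselSeries hε hν1 hx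
  have hd : HasDerivAt (fun x : ℝ => ν / x) (-ν / x ^ 2) x :=
    ((hasDerivAt_const x ν).div (hasDerivAt_id x) hx.ne').congr_deriv (by simp)
  refine ((hd.mul h1).add (h2.const_mul ε)).congr_deriv ?_
  have hx2 : 0 < x / 2 := by positivity
  have hr := besselSeries_recurrence hε hν ((x / 2) ^ 2)
  have hε2 : ε ^ 2 = 1 := by rw [← sq_abs, hε, one_pow]
  have e1 : (x / 2) ^ (ν + 1) = (x / 2) ^ ν * (x / 2) := Real.rpow_add_one hx2.ne' ν
  have e2 : (x / 2) ^ (ν + 1 + 1) = (x / 2) ^ ν * (x / 2) ^ 2 := by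
    rw [Real.rpow_add_one hx2.ne', e1]; ring
  beta_reduce
  rw [e2, e1, show ν + 1 + 1 = ν + 2 by ring]
  generalize besselSeries ε ν ((x / 2) ^ 2) = S at hr ⊢
  generalize besselSeries ε (ν + 1) ((x / 2) ^ 2) = S1 at hr ⊢
  generalize besselSeries ε (ν + 2) ((x / 2) ^ 2) = S2 at hr ⊢
  generalize (x / 2) ^ ν = b
  subst hr
  field_simp
  ring

theorem besselJ_eq (ν x : ℝ) :
    besselJ ν x = (x / 2) ^ ν * besselSeries (-1) ν ((x / 2) ^ 2) := by
  simp only [besselJ, besselSeries, pow_mul]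

theorem besselI_eq (ν x : ℝ) : besselI ν x = (x / 2) ^ ν * besselSeries 1 ν ((x / 2) ^ 2) := by
  simp only [besselI, besselSeries, pow_mul, one_pow]

theorem besselEquation_besselJ {ν : ℝ} (hν : 0 ≤ ν) : BesselEquation ν 1 (besselJ ν) := by
  have h := besselEquation_series (ε := -1) (by norm_num) hν
  rw [neg_neg] at h
  exact (funext (besselJ_eq ν)).symm ▸ h

theorem besselEquation_besselI {ν : ℝ} (hν : 0 ≤ ν) : BesselEquation ν (-1) (besselI ν) :=
  (funext (besselI_eq ν)).symm ▸ besselEquation_series (ε := 1) (by norm_num) hν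

/-! ### Parameter integrals -/

/-- A continuous function with exponential decay at `+∞`. -/
def ExpDecay (h : ℝ → ℝ) : Prop :=
  Continuous h ∧ ∃ C ε : ℝ, 0 < ε ∧ ∀ s, 0 ≤ s → |h s| ≤ C * Real.exp (-(ε * s))

/-- A continuous function of at most exponential growth at `+∞`. -/
def ExpBounded (f : ℝ → ℝ) : Prop :=
  Continuous f ∧ ∃ C M : ℝ, 0 ≤ C ∧ ∀ s, 0 ≤ s → |f s| ≤ C * Real.exp (M * s)

theorem ExpDecay.integrableOn {h : ℝ → ℝ} (hh : ExpDecay h) : IntegrableOn h (Set.Ioi 0) := by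
  obtain ⟨hc, C, ε, hε, hb⟩ := hh
  have hi : IntegrableOn (fun s => C * Real.exp (-(ε * s))) (Set.Ioi 0) := by
    have := (exp_neg_integrableOn_Ioi 0 hε).const_mul C
    simp only [neg_mul] at this
    exact this
  refine Integrable.mono' hi hc.aestronglyMeasurable ?_
  filter_upwards [ae_restrict_mem measurableSet_Ioi] with s hs
  exact hb s (le_of_lt hs)

theorem ExpDecay.tendsto {h : ℝ → ℝ} (hh : ExpDecay h) : Tendsto h atTop (𝓝 0) := by
  obtain ⟨hc, C, ε, hε, hb⟩ := hh
  have hl : Tendsto (fun s : ℝ => C * Real.exp (-(ε * s))) atTop (𝓝 0) := by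
    have := (Real.tendsto_exp_neg_atTop_nhds_zero.comp (tendsto_id.const_mul_atTop hε)).const_mul C
    simpa using this
  exact squeeze_zero_norm' ((eventually_ge_atTop 0).mono hb) hl

theorem ExpDecay.integral_eq {B b : ℝ → ℝ} (hB : ExpDecay B) (hb : ExpDecay b)
    (hd : ∀ s, HasDerivAt B (b s) s) : ∫ s in Set.Ioi 0, b s = -B 0 := by
  rw [integral_Ioi_of_hasDerivAt_of_tendsto hB.1.continuousWithinAt (fun s _ => hd s)
    hb.integrableOn hB.tendsto, zero_sub]

theorem ExpDecay.congr {f g : ℝ → ℝ} (hf : ExpDecay f) (h : ∀ s, f s = g s) : ExpDecay g :=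
  funext h ▸ hf

theorem ExpDecay.add {f g : ℝ → ℝ} (hf : ExpDecay f) (hg : ExpDecay g) :
    ExpDecay (fun s => f s + g s) := by
  obtain ⟨hfc, C, ε, hε, hb⟩ := hf
  obtain ⟨hgc, D, δ, hδ, hb'⟩ := hg
  refine ⟨hfc.add hgc, |C| + |D|, min ε δ, lt_min hε hδ, fun s hs => (abs_add_le _ _).trans ?_⟩
  rw [add_mul]
  refine add_le_add ((hb s hs).trans ?_) ((hb' s hs).trans ?_)
  · gcongr
    · exact le_abs_self C
    · exact min_le_left _ _
  · gcongr
    · exact le_abs_self D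
    · exact min_le_right _ _

theorem ExpDecay.const_mul {f : ℝ → ℝ} (hf : ExpDecay f) (c : ℝ) : ExpDecay (fun s => c * f s) := by
  obtain ⟨hfc, C, ε, hε, hb⟩ := hf
  refine ⟨hfc.const_mul c, |c| * C, ε, hε, fun s hs => ?_⟩
  rw [abs_mul, mul_assoc]
  exact mul_le_mul_of_nonneg_left (hb s hs) (abs_nonneg c)

/-- The mechanism behind all integral representations below: when a differential operator turns the
integrand into an `s`-derivative, only the boundary term at `0` remains. -/
theorem ExpDecay.integral_linear {f₀ f₁ f₂ B : ℝ → ℝ} {a b c : ℝ} (h₂ : ExpDecay f₂)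
    (h₁ : ExpDecay f₁) (h₀ : ExpDecay f₀) (hB : ExpDecay B)
    (hd : ∀ s, HasDerivAt B (a * f₂ s + b * f₁ s + c * f₀ s) s) :
    a * (∫ s in Set.Ioi 0, f₂ s) + b * (∫ s in Set.Ioi 0, f₁ s) + c * (∫ s in Set.Ioi 0, f₀ s) =
      -B 0 := by
  have h2 := h₂.const_mul a
  have h1 := h₁.const_mul b
  have h0 := h₀.const_mul c
  rw [← integral_const_mul, ← integral_const_mul, ← integral_const_mul,
    ← integral_add h2.integrableOn h1.integrableOn,
    ← integral_add (h2.add h1).integrableOn h0.integrableOn]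
  exact hB.integral_eq ((h2.add h1).add h0) hd

theorem ExpBounded.mul {f g : ℝ → ℝ} (hf : ExpBounded f) (hg : ExpBounded g) :
    ExpBounded (fun s => f s * g s) := by
  obtain ⟨hfc, C, M, hC, hb⟩ := hf
  obtain ⟨hgc, D, N, hD, hb'⟩ := hg
  refine ⟨hfc.mul hgc, C * D, M + N, by positivity, fun s hs => ?_⟩
  rw [abs_mul, add_mul, Real.exp_add]
  calc |f s| * |g s| ≤ (C * Real.exp (M * s)) * (D * Real.exp (N * s)) :=
        mul_le_mul (hb s hs) (hb' s hs) (abs_nonneg _) (by positivity)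
    _ = _ := by ring

theorem ExpBounded.add {f g : ℝ → ℝ} (hf : ExpBounded f) (hg : ExpBounded g) :
    ExpBounded (fun s => f s + g s) := by
  obtain ⟨hfc, C, M, hC, hb⟩ := hf
  obtain ⟨hgc, D, N, hD, hb'⟩ := hg
  refine ⟨hfc.add hgc, C + D, max M N, by positivity, fun s hs => (abs_add_le _ _).trans ?_⟩
  rw [add_mul]
  refine add_le_add ((hb s hs).trans ?_) ((hb' s hs).trans ?_)
  · gcongr
    exact le_max_left _ _
  · gcongr
    exact le_max_right _ _

theorem expBounded_const (c : ℝ) : ExpBounded (fun _ => c) :=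
  ⟨continuous_const, |c|, 0, abs_nonneg c, fun s _ => by simp⟩

theorem expBounded_exp (ν : ℝ) : ExpBounded (fun s => Real.exp (ν * s)) :=
  ⟨by fun_prop, 1, ν, zero_le_one, fun s _ => by rw [abs_of_pos (Real.exp_pos _), one_mul]⟩

theorem expBounded_cosh (ν : ℝ) : ExpBounded (fun s => Real.cosh (ν * s)) := by
  have h := ((expBounded_exp ν).add (expBounded_exp (-ν))).mul (expBounded_const (1 / 2))
  refine (funext fun s => ?_ : (fun s => Real.cosh (ν * s)) = _) ▸ h
  rw [Real.cosh_eq, neg_mul]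
  ring

theorem expBounded_sinh (ν : ℝ) : ExpBounded (fun s => Real.sinh (ν * s)) := by
  have h := ((expBounded_exp ν).add ((expBounded_exp (-ν)).mul (expBounded_const (-1)))).mul
    (expBounded_const (1 / 2))
  refine (funext fun s => ?_ : (fun s => Real.sinh (ν * s)) = _) ▸ h
  rw [Real.sinh_eq, neg_mul]
  ring

/-- Quadratic growth of `q` beats every exponential `exp(Ms)` and still leaves decay at rate one. -/
theorem ExpBounded.expDecay {f q : ℝ → ℝ} {x : ℝ} (hf : ExpBounded f) (hq : Continuous q)
    (hq2 : ∀ s, 0 ≤ s → s ^ 2 / 4 ≤ q s) (hx : 0 < x) :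
    ExpDecay (fun s => f s * Real.exp (-(x * q s))) := by
  obtain ⟨hfc, C, M, hC, hb⟩ := hf
  refine ⟨by fun_prop, C * Real.exp ((M + 1) ^ 2 / x), 1, one_pos, fun s hs => ?_⟩
  rw [abs_mul, abs_of_pos (Real.exp_pos _), mul_assoc, ← Real.exp_add]
  calc |f s| * Real.exp (-(x * q s)) ≤ C * Real.exp (M * s) * Real.exp (-(x * q s)) := by
        gcongr; exact hb s hs
    _ = C * Real.exp (M * s + -(x * q s)) := by rw [mul_assoc, ← Real.exp_add]
    _ ≤ _ := by
      refine mul_le_mul_of_nonneg_left (Real.exp_le_exp.2 ?_) hC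
      have h1 : x * (s ^ 2 / 4) ≤ x * q s := mul_le_mul_of_nonneg_left (hq2 s hs) hx.le
      -- Completing the square in `x s²/4 - (M+1) s` accounts for the constant `(M+1)²/x`.
      have h2 : 0 ≤ x / 4 * (s - 2 * (M + 1) / x) ^ 2 := by positivity
      have h3 : x / 4 * (s - 2 * (M + 1) / x) ^ 2 = x * (s ^ 2 / 4) - (M + 1) * s + (M + 1) ^ 2 / x := by
        field_simp
        ring
      linarith

theorem sq_div_four_le_sinh {s : ℝ} (hs : 0 ≤ s) : s ^ 2 / 4 ≤ Real.sinh s := by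
  have h1 := Real.quadratic_le_exp_of_nonneg hs
  have h2 : Real.exp (-s) ≤ 1 := Real.exp_le_one_iff.2 (by linarith)
  rw [Real.sinh_eq]
  linarith

theorem sq_div_four_le_cosh {s : ℝ} (hs : 0 ≤ s) : s ^ 2 / 4 ≤ Real.cosh s :=
  (sq_div_four_le_sinh hs).trans (Real.sinh_lt_cosh s).le

/-- Differentiation of a Laplace-type integral. -/
theorem hasDerivAt_laplace {g q : ℝ → ℝ} (hq0 : ∀ s, 0 ≤ s → 0 ≤ q s)
    (h0 : ∀ x, 0 < x → ExpDecay (fun s => g s * Real.exp (-(x * q s))))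
    (h1 : ∀ x, 0 < x → ExpDecay (fun s => q s * g s * Real.exp (-(x * q s)))) {x : ℝ} (hx : 0 < x) :
    HasDerivAt (fun x => ∫ s in Set.Ioi 0, g s * Real.exp (-(x * q s)))
      (-∫ s in Set.Ioi 0, q s * g s * Real.exp (-(x * q s))) x := by
  have hmem : Set.Ioi (x / 2) ∈ 𝓝 x := Ioi_mem_nhds (by linarith)
  have hneg : ∀ y : ℝ, (fun s => -(q s * g s * Real.exp (-(y * q s)))) =
    fun s => g s * (Real.exp (-(y * q s)) * -(q s)) := fun y => funext fun s => by ring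
  have h := hasDerivAt_integral_of_dominated_loc_of_deriv_le
    (μ := volume.restrict (Set.Ioi (0 : ℝ)))
    (F := fun x s => g s * Real.exp (-(x * q s)))
    (F' := fun x s => -(q s * g s * Real.exp (-(x * q s))))
    -- Since `q ≥ 0`, the kernel at the parameter `x/2` dominates all those at larger parameters.
    (bound := fun s => |q s * g s * Real.exp (-(x / 2 * q s))|) hmem
    (by filter_upwards [hmem] with y hy
        exact (h0 y (lt_trans (by linarith) hy)).1.aestronglyMeasurable)
    (h0 x hx).integrableOn (h1 x hx).1.neg.aestronglyMeasurable ?_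
    (h1 (x / 2) (by linarith)).integrableOn.abs ?_
  · exact h.2.congr_deriv (integral_neg _)
  · filter_upwards [ae_restrict_mem measurableSet_Ioi] with s hs y hy
    rw [norm_neg, Real.norm_eq_abs, abs_mul, abs_mul (q s * g s), abs_of_pos (Real.exp_pos _),
      abs_of_pos (Real.exp_pos _)]
    gcongr
    · exact hq0 s (le_of_lt hs)
    · exact le_of_lt hy
  · filter_upwards with s y _
    have hl : HasDerivAt (fun y => -(y * q s)) (-(q s)) y :=
      ((hasDerivAt_id y).mul_const (q s)).neg.congr_deriv (by rw [one_mul])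
    exact (hl.exp.const_mul (g s)).congr_deriv (by ring)

/-- Differentiation of an oscillatory integral. -/
theorem hasDerivAt_integral_sin {μ : Measure ℝ} {w τ θ : ℝ → ℝ} (hw : Integrable w μ)
    (hτ : Continuous τ) (hθ : Continuous θ) (h1 : ∀ s, |τ s| ≤ 1) (x : ℝ) :
    HasDerivAt (fun x => ∫ s, w s * Real.sin (x * τ s + θ s) ∂μ)
      (∫ s, w s * τ s * Real.cos (x * τ s + θ s) ∂μ) x := by
  have hm : ∀ y, AEStronglyMeasurable (fun s => w s * Real.sin (y * τ s + θ s)) μ := fun y =>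
    hw.1.mul (by fun_prop : Continuous fun s => Real.sin (y * τ s + θ s)).aestronglyMeasurable
  refine (hasDerivAt_integral_of_dominated_loc_of_deriv_le (μ := μ)
    (F := fun x s => w s * Real.sin (x * τ s + θ s))
    (F' := fun x s => w s * τ s * Real.cos (x * τ s + θ s)) (bound := fun s => |w s|)
    (s := Set.univ) univ_mem (Eventually.of_forall hm) ?_ ?_ ?_ hw.abs ?_).2
  · refine Integrable.mono' hw.abs (hm x) (Eventually.of_forall fun s => ?_)
    rw [norm_mul]
    exact mul_le_of_le_one_right (norm_nonneg _) (Real.abs_sin_le_one _)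
  · exact (hw.1.mul hτ.aestronglyMeasurable).mul
      (by fun_prop : Continuous fun s => Real.cos (x * τ s + θ s)).aestronglyMeasurable
  · refine Eventually.of_forall fun s y _ => ?_
    rw [norm_mul, norm_mul, mul_assoc]
    exact mul_le_of_le_one_right (norm_nonneg _)
      (mul_le_one₀ (h1 s) (norm_nonneg _) (Real.abs_cos_le_one _))
  · refine Eventually.of_forall fun s y _ => ?_
    have hl : HasDerivAt (fun y => y * τ s + θ s) (τ s) y := by
      simpa using ((hasDerivAt_id y).mul_const (τ s)).add_const (θ s)
    exact (hl.sin.const_mul (w s)).congr_deriv (by ring)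

theorem hasDerivAt_integral_cos {μ : Measure ℝ} {w τ θ : ℝ → ℝ} (hw : Integrable w μ)
    (hτ : Continuous τ) (hθ : Continuous θ) (h1 : ∀ s, |τ s| ≤ 1) (x : ℝ) :
    HasDerivAt (fun x => ∫ s, w s * Real.cos (x * τ s + θ s) ∂μ)
      (-∫ s, w s * τ s * Real.sin (x * τ s + θ s) ∂μ) x := by
  have h := hasDerivAt_integral_sin hw hτ (hθ.add_const (Real.pi / 2)) h1 x
  simpa only [← add_assoc, Real.sin_add_pi_div_two, Real.cos_add_pi_div_two, mul_neg,
    integral_neg] using h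

theorem integrable_mul_of_abs_le_one {μ : Measure ℝ} {w τ : ℝ → ℝ} (hw : Integrable w μ)
    (hτ : Continuous τ) (h1 : ∀ s, |τ s| ≤ 1) : Integrable (fun s => w s * τ s) μ :=
  hw.mul_bdd hτ.aestronglyMeasurable (c := 1) (Eventually.of_forall h1)

/-! ### Laplace-type solutions of second-order equations -/

/-- The kernel `g e^{-xq}` and its first two `x`-derivatives decay exponentially. -/
structure LaplaceKernel (g q : ℝ → ℝ) : Prop where
  nonneg : ∀ s, 0 ≤ s → 0 ≤ q s
  decay : ∀ x, 0 < x → ExpDecay (fun s => g s * Real.exp (-(x * q s)))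
  decay_one : ∀ x, 0 < x → ExpDecay (fun s => q s * g s * Real.exp (-(x * q s)))
  decay_two : ∀ x, 0 < x → ExpDecay (fun s => q s * (q s * g s) * Real.exp (-(x * q s)))

theorem ExpBounded.laplaceKernel {g q : ℝ → ℝ} (hg : ExpBounded g) (hq : ExpBounded q)
    (hq2 : ∀ s, 0 ≤ s → s ^ 2 / 4 ≤ q s) : LaplaceKernel g q where
  nonneg s hs := le_trans (by positivity) (hq2 s hs)
  decay _ hx := hg.expDecay hq.1 hq2 hx
  decay_one _ hx := (hq.mul hg).expDecay hq.1 hq2 hx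
  decay_two _ hx := (hq.mul (hq.mul hg)).expDecay hq.1 hq2 hx

theorem LaplaceKernel.hasDerivAt {g q : ℝ → ℝ} (h : LaplaceKernel g q) {x : ℝ} (hx : 0 < x) :
    HasDerivAt (fun x => ∫ s in Set.Ioi 0, g s * Real.exp (-(x * q s)))
      (-∫ s in Set.Ioi 0, q s * g s * Real.exp (-(x * q s))) x :=
  hasDerivAt_laplace h.nonneg h.decay h.decay_one hx

theorem LaplaceKernel.hasDerivAt_deriv {g q : ℝ → ℝ} (h : LaplaceKernel g q) {x : ℝ} (hx : 0 < x) :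
    HasDerivAt (fun x => -∫ s in Set.Ioi 0, q s * g s * Real.exp (-(x * q s)))
      (∫ s in Set.Ioi 0, q s * (q s * g s) * Real.exp (-(x * q s))) x := by
  have := (hasDerivAt_laplace (g := fun s => q s * g s) h.nonneg h.decay_one h.decay_two hx).neg
  rwa [neg_neg] at this

/-- Each `x`-derivative of the Laplace integral brings down a factor `-q`, so a second-order
operator acts on the integrand as a quadratic polynomial in `q`; `B` is a primitive of the result.
-/
theorem LaplaceKernel.operator_eq {g q B : ℝ → ℝ} (h : LaplaceKernel g q) {x a b c : ℝ} (hx : 0 < x)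
    (hB : ExpDecay B)
    (hd : ∀ s, HasDerivAt B ((a * q s ^ 2 + b * q s + c) * (g s * Real.exp (-(x * q s)))) s) :
    a * (∫ s in Set.Ioi 0, q s * (q s * g s) * Real.exp (-(x * q s)))
      + b * (∫ s in Set.Ioi 0, q s * g s * Real.exp (-(x * q s)))
      + c * (∫ s in Set.Ioi 0, g s * Real.exp (-(x * q s))) = -B 0 :=
  (h.decay_two x hx).integral_linear (h.decay_one x hx) (h.decay x hx) hB
    fun s => (hd s).congr_deriv (by ring)

/-! ### The Bessel functions `K` and `Y` -/

theorem hasDerivAt_exp_neg_mul {q : ℝ → ℝ} {q' s : ℝ} (x : ℝ) (hq : HasDerivAt q q' s) :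
    HasDerivAt (fun s => Real.exp (-(x * q s))) (Real.exp (-(x * q s)) * -(x * q')) s :=
  (hq.const_mul x).neg.exp

theorem hasDerivAt_const_mul_id (ν s : ℝ) : HasDerivAt (fun s => ν * s) ν s := by
  simpa using (hasDerivAt_id s).const_mul ν

/-- The modified Bessel operator maps the integrand to the derivative of `-(x sinh s cosh νs + ν
sinh νs) exp(-x cosh s)`, which vanishes at `s = 0` and at infinity. -/
theorem besselEquation_besselK (ν : ℝ) : BesselEquation ν (-1) (besselK ν) := by
  have hq : ExpBounded Real.cosh := by simpa using expBounded_cosh 1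
  have hsh : ExpBounded Real.sinh := by simpa using expBounded_sinh 1
  have hk : LaplaceKernel (fun s => Real.cosh (ν * s)) Real.cosh :=
    (expBounded_cosh ν).laplaceKernel hq fun _ => sq_div_four_le_cosh
  have he : besselK ν =
      fun x => ∫ s in Set.Ioi 0, Real.cosh (ν * s) * Real.exp (-(x * Real.cosh s)) :=
    funext fun x => by simp only [besselK, mul_comm]
  rw [he]
  refine ⟨_, fun x hx => ⟨hk.hasDerivAt hx, (hk.hasDerivAt_deriv hx).congr_deriv ?_⟩⟩
  have hB : ExpDecay fun s => (x * Real.sinh s * Real.cosh (ν * s) + ν * Real.sinh (ν * s)) *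
      Real.exp (-(x * Real.cosh s)) :=
    ((((expBounded_const x).mul hsh).mul (expBounded_cosh ν)).add
      ((expBounded_const ν).mul (expBounded_sinh ν))).expDecay hq.1
        (fun _ => sq_div_four_le_cosh) hx
  have h := hk.operator_eq (a := x ^ 2) (b := -x) (c := -(x ^ 2 + ν ^ 2)) hx (hB.const_mul (-1)) ?_
  · simp only [Real.sinh_zero, mul_zero, zero_mul, add_zero, neg_zero] at h
    beta_reduce
    generalize (∫ s in Set.Ioi (0 : ℝ), Real.cosh s * (_ * _) * Real.exp _) = y₂ at h ⊢
    generalize (∫ s in Set.Ioi (0 : ℝ), Real.cosh s * _ * _) = y₁ at h ⊢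
    generalize (∫ s in Set.Ioi (0 : ℝ), _ * Real.exp _) = y₀ at h ⊢
    field_simp
    linear_combination h
  · intro s
    have hl := hasDerivAt_const_mul_id ν s
    refine ((((((Real.hasDerivAt_sinh s).const_mul x).mul hl.cosh).add (hl.sinh.const_mul ν)).mul
      (hasDerivAt_exp_neg_mul x (Real.hasDerivAt_cosh s))).const_mul (-1)).congr_deriv ?_
    simp only [Pi.add_apply, Pi.mul_apply]
    linear_combination (-(x ^ 2 * Real.cosh (ν * s) * Real.exp (-(x * Real.cosh s)))) *
      Real.cosh_sq s

/-- Neither integral satisfies the homogeneous equation. The Bessel operator, multiplied by `x²`,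
leaves `(x + ν) + (x - ν) cos νπ` from both the oscillatory and the Laplace integral; as they enter
with opposite signs, the defects cancel for every `ν`. -/
theorem besselEquation_besselY (ν : ℝ) : BesselEquation ν 1 (besselY ν) := by
  have hq : ExpBounded Real.sinh := by simpa using expBounded_sinh 1
  have hch : ExpBounded Real.cosh := by simpa using expBounded_cosh 1
  have hmexp : ExpBounded fun s => Real.exp (-(ν * s)) := by simpa using expBounded_exp (-ν)
  have hk : LaplaceKernel
      (fun s => Real.exp (ν * s) + Real.exp (-(ν * s)) * Real.cos (ν * Real.pi)) Real.sinh :=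
    ((expBounded_exp ν).add (hmexp.mul (expBounded_const _))).laplaceKernel hq
      fun _ => sq_div_four_le_sinh
  set μ := volume.restrict (Set.Ioc 0 Real.pi) with hμ
  have hw : Integrable (fun _ : ℝ => (1 : ℝ)) μ := integrable_const _
  have hθ : Continuous fun s : ℝ => -(ν * s) := by fun_prop
  have hs1 : ∀ s, |Real.sin s| ≤ 1 := Real.abs_sin_le_one
  have hw1 := integrable_mul_of_abs_le_one hw Real.continuous_sin hs1
  have he : besselY ν = fun x =>
      (1 / Real.pi) * (∫ s, 1 * Real.sin (x * Real.sin s + -(ν * s)) ∂μ)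
      - (1 / Real.pi) * ∫ s in Set.Ioi (0 : ℝ),
        (Real.exp (ν * s) + Real.exp (-(ν * s)) * Real.cos (ν * Real.pi)) *
          Real.exp (-(x * Real.sinh s)) := funext fun x => by
    simp only [besselY, intervalIntegral.integral_of_le Real.pi_pos.le, one_mul, ← sub_eq_add_neg]
    rfl
  rw [he]
  refine ⟨_, fun x hx => ⟨((hasDerivAt_integral_sin hw Real.continuous_sin hθ hs1 x).const_mul _).sub
    ((hk.hasDerivAt hx).const_mul _),
    (((hasDerivAt_integral_cos hw1 Real.continuous_sin hθ hs1 x).const_mul _).sub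
    ((hk.hasDerivAt_deriv hx).const_mul _)).congr_deriv ?_⟩⟩
  have hB : ExpDecay fun s => ((x * Real.cosh s + ν) * Real.exp (ν * s) +
      (x * Real.cosh s + -ν) * Real.exp (-(ν * s)) * Real.cos (ν * Real.pi)) *
      Real.exp (-(x * Real.sinh s)) :=
    (((((expBounded_const x).mul hch).add (expBounded_const ν)).mul (expBounded_exp ν)).add
      (((((expBounded_const x).mul hch).add (expBounded_const (-ν))).mul hmexp).mul
        (expBounded_const _))).expDecay hq.1 (fun _ => sq_div_four_le_sinh) hx
  have h2 := hk.operator_eq (a := x ^ 2) (b := -x) (c := x ^ 2 - ν ^ 2) hx (hB.const_mul (-1)) ?_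
  · have h1 : -(x ^ 2) * (∫ s, 1 * Real.sin s * Real.sin s * Real.sin (x * Real.sin s + -(ν * s)) ∂μ)
        + x * (∫ s, 1 * Real.sin s * Real.cos (x * Real.sin s + -(ν * s)) ∂μ)
        + (x ^ 2 - ν ^ 2) * (∫ s, 1 * Real.sin (x * Real.sin s + -(ν * s)) ∂μ) =
        (x - ν) * Real.cos (ν * Real.pi) + (x + ν) := by
      have hint : ∀ f : ℝ → ℝ, Continuous f → Integrable f μ := fun f hf =>
        (hf.integrableOn_Icc (a := 0) (b := Real.pi)).mono_set Set.Ioc_subset_Icc_self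
      rw [← integral_const_mul, ← integral_const_mul, ← integral_const_mul,
        ← integral_add (hint _ (by fun_prop)) (hint _ (by fun_prop)),
        ← integral_add (hint _ (by fun_prop)) (hint _ (by fun_prop)), hμ,
        ← intervalIntegral.integral_of_le Real.pi_pos.le,
        intervalIntegral.integral_eq_sub_of_hasDerivAt
          (f := fun s => -((x * Real.cos s + ν) * Real.cos (x * Real.sin s + -(ν * s)))) ?_
          (Continuous.intervalIntegrable (by fun_prop) _ _)]
      · simp
        ring
      · intro s _
        have hψ : HasDerivAt (fun s => x * Real.sin s + -(ν * s)) (x * Real.cos s + -ν) s :=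
          ((Real.hasDerivAt_sin s).const_mul x).add (hasDerivAt_const_mul_id ν s).neg
        refine ((((Real.hasDerivAt_cos s).const_mul x).add_const ν).mul hψ.cos).neg.congr_deriv ?_
        linear_combination (x ^ 2 * Real.sin (x * Real.sin s + -(ν * s))) * Real.sin_sq_add_cos_sq s
    simp only [Real.sinh_zero, Real.cosh_zero, mul_zero, neg_zero, Real.exp_zero, mul_one,
      one_mul] at h1 h2 ⊢
    generalize (∫ s, Real.sin s * Real.sin s * _ ∂μ) = w₂ at h1 ⊢
    generalize (∫ s, Real.sin s * Real.cos _ ∂μ) = w₁ at h1 ⊢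
    generalize (∫ s, Real.sin _ ∂μ) = w₀ at h1 ⊢
    generalize (∫ s in Set.Ioi (0 : ℝ), Real.sinh s * (_ * _) * Real.exp _) = y₂ at h2 ⊢
    generalize (∫ s in Set.Ioi (0 : ℝ), Real.sinh s * _ * _) = y₁ at h2 ⊢
    generalize (∫ s in Set.Ioi (0 : ℝ), _ * Real.exp _) = y₀ at h2 ⊢
    have hπ := Real.pi_pos
    generalize Real.cos (ν * Real.pi) = e at h1 h2
    field_simp
    linear_combination h1 - h2
  · intro s
    have hl := hasDerivAt_const_mul_id ν s
    have hc := (Real.hasDerivAt_cosh s).const_mul x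
    refine (((((hc.add_const ν).mul hl.exp).add
      (((hc.add_const (-ν)).mul hl.neg.exp).mul_const (Real.cos (ν * Real.pi)))).mul
      (hasDerivAt_exp_neg_mul x (Real.hasDerivAt_sinh s))).const_mul (-1)).congr_deriv ?_
    simp only [Pi.add_apply, Pi.mul_apply, Pi.neg_apply]
    linear_combination (x ^ 2 * (Real.exp (ν * s) + Real.exp (-(ν * s)) * Real.cos (ν * Real.pi)) *
      Real.exp (-(x * Real.sinh s))) * Real.cosh_sq s

/-! ### The Coulomb wave functions of order one -/

theorem hasDerivAt_tanh (s : ℝ) : HasDerivAt Real.tanh (1 - Real.tanh s ^ 2) s := by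
  have hc := (Real.cosh_pos s).ne'
  have h := (Real.hasDerivAt_sinh s).div (Real.hasDerivAt_cosh s) hc
  refine (h.congr_of_eventuallyEq (Eventually.of_forall Real.tanh_eq_sinh_div_cosh)).congr_deriv ?_
  rw [Real.tanh_eq_sinh_div_cosh]
  field_simp

theorem continuous_tanh : Continuous Real.tanh :=
  continuous_iff_continuousAt.2 fun s => (hasDerivAt_tanh s).continuousAt

theorem expDecay_sech_mul {f : ℝ → ℝ} (hf : Continuous f) {C : ℝ} (hC : ∀ s, |f s| ≤ C) :
    ExpDecay (fun s => 1 / Real.cosh s ^ 4 * f s) := by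
  refine ⟨(continuous_const.div (by fun_prop) fun s => (pow_pos (Real.cosh_pos s) 4).ne').mul hf,
    2 * C, 1, one_pos, fun s _ => ?_⟩
  have hc := Real.cosh_pos s
  have h1 : Real.exp s / 2 ≤ Real.cosh s := by
    rw [Real.cosh_eq]; linarith [Real.exp_pos (-s)]
  have h2 : Real.cosh s ≤ Real.cosh s ^ 4 := le_self_pow₀ (Real.one_le_cosh s) (by norm_num)
  have h3 : 1 / Real.cosh s ^ 4 ≤ 2 * Real.exp (-(1 * s)) := by
    rw [one_mul, Real.exp_neg, ← div_eq_mul_inv, div_le_div_iff₀ (by positivity) (Real.exp_pos s)]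
    linarith
  rw [abs_mul, abs_of_pos (by positivity : 0 < 1 / Real.cosh s ^ 4)]
  calc 1 / Real.cosh s ^ 4 * |f s| ≤ 2 * Real.exp (-(1 * s)) * C :=
        mul_le_mul h3 (hC s) (abs_nonneg _) (by positivity)
    _ = _ := by ring

/-- Half of the exponential absorbs the polynomial, the other half provides the decay. -/
theorem expDecay_polynomial_mul {f : ℝ → ℝ} (hf : Continuous f) {C x : ℝ} (hx : 0 < x)
    (hC : ∀ s, 0 ≤ s → |f s| ≤ C * (1 + s ^ 2) ^ 2) :
    ExpDecay (fun s => f s * Real.exp (-(x * s))) := by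
  have hC0 : 0 ≤ C := by
    have h := (abs_nonneg _).trans (hC 0 le_rfl)
    norm_num at h
    exact h
  refine ⟨by fun_prop, C * (1 + 16 / x ^ 2 + 384 / x ^ 4), x / 2, by positivity, fun s hs => ?_⟩
  -- From `u² ≤ 2 eᵘ` and `u⁴ ≤ 24 eᵘ`: the constants are `2·4·2 = 16` and `16·24 = 384`.
  set u := x / 2 * s with hu
  have hu0 : 0 ≤ u := by positivity
  have h1 := Real.add_one_le_exp u
  have h2 := Real.pow_div_factorial_le_exp u hu0 2
  have h4 := Real.pow_div_factorial_le_exp u hu0 4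
  norm_num [Nat.factorial] at h2 h4
  have hs2 : s ^ 2 = 4 / x ^ 2 * u ^ 2 := by rw [hu]; field_simp; norm_num
  have hs4 : s ^ 4 = 16 / x ^ 4 * u ^ 4 := by rw [hu]; field_simp; norm_num
  have hp : (1 + s ^ 2) ^ 2 ≤ (1 + 16 / x ^ 2 + 384 / x ^ 4) * Real.exp u := by
    have e2 : 4 / x ^ 2 * u ^ 2 ≤ 4 / x ^ 2 * (2 * Real.exp u) := by gcongr; linarith
    have e4 : 16 / x ^ 4 * u ^ 4 ≤ 16 / x ^ 4 * (24 * Real.exp u) := by gcongr; linarith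
    calc (1 + s ^ 2) ^ 2 = 1 + 2 * s ^ 2 + s ^ 4 := by ring
      _ ≤ Real.exp u + 2 * (4 / x ^ 2 * (2 * Real.exp u)) + 16 / x ^ 4 * (24 * Real.exp u) := by
        rw [hs2, hs4]; linarith
      _ = _ := by ring
  have he : Real.exp (-(x * s)) = Real.exp (-u) * Real.exp (-u) := by
    rw [← Real.exp_add]; congr 1; rw [hu]; ring
  rw [abs_mul, abs_of_pos (Real.exp_pos _), he]
  calc |f s| * (Real.exp (-u) * Real.exp (-u))
      ≤ C * ((1 + 16 / x ^ 2 + 384 / x ^ 4) * Real.exp u) * (Real.exp (-u) * Real.exp (-u)) := by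
        gcongr
        exact (hC s hs).trans (by gcongr)
    _ = C * (1 + 16 / x ^ 2 + 384 / x ^ 4) * Real.exp (-u) * (Real.exp u * Real.exp (-u)) := by ring
    _ = _ := by rw [← Real.exp_add]; simp

/-- The arctangent factor is bounded by `exp(|η|π)`, and `1 + s²` times `1`, `s` or `s²` is at most
`(1 + s²)²` for `s ≥ 0`. -/
theorem laplaceKernel_arctan (η : ℝ) :
    LaplaceKernel (fun s => (1 + s ^ 2) * Real.exp (2 * η * Real.arctan s)) (fun s => s) := by
  have hE : ∀ s, Real.exp (2 * η * Real.arctan s) ≤ Real.exp (|η| * Real.pi) := fun s => by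
    refine Real.exp_le_exp.2 ((le_abs_self _).trans ?_)
    have h : |Real.arctan s| ≤ Real.pi / 2 :=
      abs_le.2 ⟨(Real.neg_pi_div_two_lt_arctan s).le, (Real.arctan_lt_pi_div_two s).le⟩
    rw [abs_mul, abs_mul, abs_two]
    nlinarith [abs_nonneg η]
  have key : ∀ p : ℝ → ℝ, Continuous p → (∀ s, 0 ≤ s → |p s| ≤ (1 + s ^ 2) ^ 2) → ∀ x, 0 < x →
      ExpDecay (fun s => p s * Real.exp (2 * η * Real.arctan s) * Real.exp (-(x * s))) :=
    fun p hp hb x hx => expDecay_polynomial_mul (C := Real.exp (|η| * Real.pi)) (by fun_prop) hx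
      fun s hs => by
        rw [abs_mul, abs_of_pos (Real.exp_pos _), mul_comm]
        exact mul_le_mul (hE s) (hb s hs) (abs_nonneg _) (Real.exp_pos _).le
  refine ⟨fun s hs => hs, key _ (by fun_prop) fun s hs => ?_, fun x hx => ?_, fun x hx => ?_⟩
  · rw [abs_of_pos (by positivity)]; nlinarith [sq_nonneg s]
  · simp only [← mul_assoc]
    refine key _ (by fun_prop) (fun s hs => ?_) x hx
    rw [abs_of_nonneg (by positivity)]
    nlinarith [sq_nonneg (s - 1), sq_nonneg s]
  · simp only [← mul_assoc]
    refine key _ (by fun_prop) (fun s hs => ?_) x hx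
    rw [abs_of_nonneg (by positivity)]
    nlinarith [sq_nonneg s]

/-- The equation `ρ M'' + 4 M' + (ρ - 2η) M = 0`. -/
def CoulombAmplitudeEquation (η : ℝ) (M : ℝ → ℝ) : Prop :=
  SolvesPos (fun ρ => -4 / ρ) (fun ρ => -(1 - 2 * η / ρ)) M

/-- `∫₀^∞ sech⁴ s sin (ρ tanh s - 2 η s) ds`. -/
noncomputable def coulombSin (η ρ : ℝ) : ℝ :=
  ∫ s in Set.Ioi 0, 1 / Real.cosh s ^ 4 * Real.sin (ρ * Real.tanh s + -(2 * η * s))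

/-- `∫₀^∞ sech⁴ s cos (ρ tanh s - 2 η s) ds`. -/
noncomputable def coulombCos (η ρ : ℝ) : ℝ :=
  ∫ s in Set.Ioi 0, 1 / Real.cosh s ^ 4 * Real.cos (ρ * Real.tanh s + -(2 * η * s))

/-- `∫₀^∞ (1 + s²) exp (-ρ s + 2 η arctan s) ds`. -/
noncomputable def coulombExp (η ρ : ℝ) : ℝ :=
  ∫ s in Set.Ioi 0, (1 + s ^ 2) * Real.exp (2 * η * Real.arctan s) * Real.exp (-(ρ * s))

theorem abs_tanh_le_one (s : ℝ) : |Real.tanh s| ≤ 1 := (Real.abs_tanh_lt_one s).le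

theorem integrable_sech : Integrable (fun s => 1 / Real.cosh s ^ 4)
    (volume.restrict (Set.Ioi (0 : ℝ))) := by
  have h := (expDecay_sech_mul (continuous_const (y := (1 : ℝ))) (C := 1)
    fun _ => by simp).integrableOn
  simp only [mul_one] at h
  exact h

theorem hasDerivAt_sech (s : ℝ) :
    HasDerivAt (fun s => 1 / Real.cosh s ^ 4) (-4 * Real.tanh s * (1 / Real.cosh s ^ 4)) s := by
  have hc := (Real.cosh_pos s).ne'
  refine ((hasDerivAt_const s (1 : ℝ)).div ((Real.hasDerivAt_cosh s).pow 4)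
    (pow_ne_zero 4 hc)).congr_deriv ?_
  simp only [Pi.pow_apply]
  rw [Real.tanh_eq_sinh_div_cosh]
  field_simp
  norm_num
  ring

theorem hasDerivAt_phase (ρ η s : ℝ) :
    HasDerivAt (fun s => ρ * Real.tanh s + -(2 * η * s)) (ρ * (1 - Real.tanh s ^ 2) + -(2 * η)) s :=
  ((hasDerivAt_tanh s).const_mul ρ).add (hasDerivAt_const_mul_id (2 * η) s).neg

theorem expDecay_sech_mul_tanh {f : ℝ → ℝ} (hf : Continuous f) (h1 : ∀ s, |f s| ≤ 1) :
    ExpDecay (fun s => 1 / Real.cosh s ^ 4 * Real.tanh s * f s) := by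
  simp only [mul_assoc]
  refine expDecay_sech_mul (continuous_tanh.mul hf) (C := 1) fun s => ?_
  rw [abs_mul]
  exact mul_le_one₀ (abs_tanh_le_one s) (abs_nonneg _) (h1 s)

theorem expDecay_sech_mul_tanh_sq {f : ℝ → ℝ} (hf : Continuous f) (h1 : ∀ s, |f s| ≤ 1) :
    ExpDecay (fun s => 1 / Real.cosh s ^ 4 * Real.tanh s * Real.tanh s * f s) := by
  simp only [mul_assoc _ (Real.tanh _) (f _)]
  refine expDecay_sech_mul_tanh (continuous_tanh.mul hf) fun s => ?_
  rw [abs_mul]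
  exact mul_le_one₀ (abs_tanh_le_one s) (abs_nonneg _) (h1 s)

/-- The operator maps the integrand to the derivative of `sech⁴ s · sin(ρ tanh s - 2ηs)`; this
vanishes at both ends, so no inhomogeneity appears. -/
theorem coulombCos_equation (η : ℝ) : CoulombAmplitudeEquation η (coulombCos η) := by
  have hθ : Continuous fun s : ℝ => -(2 * η * s) := by fun_prop
  have ht := continuous_tanh
  have hw1 := integrable_mul_of_abs_le_one integrable_sech ht abs_tanh_le_one
  refine ⟨_, fun ρ hρ => ⟨hasDerivAt_integral_cos integrable_sech ht hθ abs_tanh_le_one ρ,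
    (hasDerivAt_integral_sin hw1 ht hθ abs_tanh_le_one ρ).neg.congr_deriv ?_⟩⟩
  have hs : ∀ s, |Real.sin (ρ * Real.tanh s + -(2 * η * s))| ≤ 1 := fun s => Real.abs_sin_le_one _
  have hc : ∀ s, |Real.cos (ρ * Real.tanh s + -(2 * η * s))| ≤ 1 := fun s => Real.abs_cos_le_one _
  have hcs : Continuous fun s => Real.sin (ρ * Real.tanh s + -(2 * η * s)) := by fun_prop
  have hcc : Continuous fun s => Real.cos (ρ * Real.tanh s + -(2 * η * s)) := by fun_prop
  have h := (expDecay_sech_mul_tanh_sq hcc hc).integral_linear (a := -ρ) (b := -4) (c := ρ - 2 * η)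
    (expDecay_sech_mul_tanh hcs hs) (expDecay_sech_mul hcc hc) (expDecay_sech_mul hcs hs) ?_
  · rw [← coulombCos] at h
    simp only [Real.tanh_zero, mul_zero, neg_zero, add_zero, Real.sin_zero] at h
    beta_reduce
    generalize (∫ s in Set.Ioi (0 : ℝ), _ * Real.tanh _ * Real.tanh _ * _) = y₂ at h ⊢
    generalize (∫ s in Set.Ioi (0 : ℝ), _ * Real.tanh _ * Real.sin _) = y₁ at h ⊢
    field_simp
    linear_combination h
  · intro s
    refine ((hasDerivAt_sech s).mul (hasDerivAt_phase ρ η s).sin).congr_deriv ?_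
    ring

/-- The sine integral solves the amplitude equation up to the constant `1`, which
`coulombExp` compensates. -/
theorem coulombExp_sub_coulombSin_equation (η : ℝ) :
    CoulombAmplitudeEquation η (fun ρ => coulombExp η ρ - coulombSin η ρ) := by
  have hθ : Continuous fun s : ℝ => -(2 * η * s) := by fun_prop
  have ht := continuous_tanh
  have hk := laplaceKernel_arctan η
  have hw1 := integrable_mul_of_abs_le_one integrable_sech ht abs_tanh_le_one
  refine ⟨_, fun ρ hρ => ⟨(hk.hasDerivAt hρ).sub
    (hasDerivAt_integral_sin integrable_sech ht hθ abs_tanh_le_one ρ),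
    ((hk.hasDerivAt_deriv hρ).sub
      (hasDerivAt_integral_cos hw1 ht hθ abs_tanh_le_one ρ)).congr_deriv ?_⟩⟩
  have hs : ∀ s, |Real.sin (ρ * Real.tanh s + -(2 * η * s))| ≤ 1 := fun s => Real.abs_sin_le_one _
  have hc : ∀ s, |Real.cos (ρ * Real.tanh s + -(2 * η * s))| ≤ 1 := fun s => Real.abs_cos_le_one _
  have hcs : Continuous fun s => Real.sin (ρ * Real.tanh s + -(2 * η * s)) := by fun_prop
  have hcc : Continuous fun s => Real.cos (ρ * Real.tanh s + -(2 * η * s)) := by fun_prop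
  have h := (expDecay_sech_mul_tanh_sq hcs hs).integral_linear (a := -ρ) (b := 4) (c := ρ - 2 * η)
    (expDecay_sech_mul_tanh hcc hc) (expDecay_sech_mul hcs hs)
    ((expDecay_sech_mul hcc hc).const_mul (-1)) ?_
  -- The primitive here has weight `(1 + s²)² = (1 + s²) + s² (1 + s²)`, a sum of two kernels
  -- already known to decay.
  · have hB : ExpDecay fun s => (1 + s ^ 2) ^ 2 * Real.exp (2 * η * Real.arctan s) *
        Real.exp (-(ρ * s)) := by
      refine ((hk.decay ρ hρ).add (hk.decay_two ρ hρ)).congr fun s => ?_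
      ring
    have h' := hk.operator_eq (a := ρ) (b := -4) (c := ρ - 2 * η) hρ (hB.const_mul (-1)) ?_
    · rw [← coulombSin] at h
      rw [← coulombExp] at h'
      simp at h h'
      beta_reduce
      simp
      generalize (∫ s in Set.Ioi (0 : ℝ), _ * Real.tanh _ * Real.tanh _ * _) = y₂ at h ⊢
      generalize (∫ s in Set.Ioi (0 : ℝ), _ * Real.tanh _ * Real.cos _) = y₁ at h ⊢
      generalize (∫ s in Set.Ioi (0 : ℝ), _ * (_ * _) * Real.exp _) = x₂ at h' ⊢
      generalize (∫ s in Set.Ioi (0 : ℝ), _ * _ * Real.exp _) = x₁ at h' ⊢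
      field_simp
      linear_combination h' - h
    · intro s
      have h1 : HasDerivAt (fun s : ℝ => (1 + s ^ 2) ^ 2) (4 * s * (1 + s ^ 2)) s := by
        refine (((hasDerivAt_pow 2 s).const_add 1).pow 2).congr_deriv ?_
        norm_num
        ring
      refine (((h1.mul ((Real.hasDerivAt_arctan s).const_mul (2 * η)).exp).mul
        (hasDerivAt_exp_neg_mul ρ (hasDerivAt_id s))).const_mul (-1)).congr_deriv ?_
      simp only [Pi.mul_apply, id_eq]
      have h0 : 1 + s ^ 2 ≠ 0 := by positivity
      field_simp
      ring
  · intro s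
    refine (((hasDerivAt_sech s).mul (hasDerivAt_phase ρ η s).cos).const_mul (-1)).congr_deriv ?_
    ring

/-- The Coulomb equation `W'' = -(1 - 2η/ρ - 2/ρ²) W`. -/
def CoulombEquation (η : ℝ) (W : ℝ → ℝ) : Prop :=
  SolvesPos (fun _ => 0) (fun ρ => -(1 - 2 * η / ρ - 2 / ρ ^ 2)) W

/-- The factor `ρ^{L+1}` with `L = 1` removes the first-order term and creates the centrifugal term
`L(L+1)/ρ² = 2/ρ²`. -/
theorem CoulombAmplitudeEquation.sq_mul {η : ℝ} {M : ℝ → ℝ} (h : CoulombAmplitudeEquation η M) :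
    CoulombEquation η (fun ρ => ρ ^ 2 * M ρ) := by
  obtain ⟨M', h⟩ := h
  refine ⟨fun ρ => 2 * (ρ * M ρ) + ρ ^ 2 * M' ρ, fun ρ hρ => ?_⟩
  obtain ⟨h1, h2⟩ := h ρ hρ
  have hsq : HasDerivAt (fun ρ : ℝ => ρ ^ 2) (2 * ρ) ρ := by simpa using hasDerivAt_pow 2 ρ
  have hid : HasDerivAt (fun ρ : ℝ => ρ) 1 ρ := hasDerivAt_id ρ
  refine ⟨(hsq.mul h1).congr_deriv (by ring), (((hid.mul h1).const_mul 2).add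
    (hsq.mul h2)).congr_deriv ?_⟩
  field_simp
  ring

theorem coulombF_eq (η : ℝ) : coulombF 1 η = fun ρ =>
    Real.exp (-(Real.pi * η)) / (((2 * 1 + 1).factorial : ℝ) * coulombC 1 η) *
      (ρ ^ 2 * coulombCos η ρ) := by
  funext ρ
  have e : ∀ s, Real.cos (ρ * Real.tanh s - 2 * η * s) / Real.cosh s ^ (2 * 1 + 2) =
      1 / Real.cosh s ^ 4 * Real.cos (ρ * Real.tanh s + -(2 * η * s)) := fun s => by
    rw [← sub_eq_add_neg]; ring
  simp only [coulombF, coulombPrefactor, coulombCos, e]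
  ring

/-- Splitting the defining integral requires its exponential part to converge, hence `ρ > 0`. -/
theorem coulombG_eq (η : ℝ) {ρ : ℝ} (hρ : 0 < ρ) : coulombG 1 η ρ =
    Real.exp (-(Real.pi * η)) / (((2 * 1 + 1).factorial : ℝ) * coulombC 1 η) *
      (ρ ^ 2 * (coulombExp η ρ - coulombSin η ρ)) := by
  have e : ∀ s, (1 + s ^ 2) ^ 1 * Real.exp (-(ρ * s) + 2 * η * Real.arctan s)
      - Real.sin (ρ * Real.tanh s - 2 * η * s) / Real.cosh s ^ (2 * 1 + 2) =
      (1 + s ^ 2) * Real.exp (2 * η * Real.arctan s) * Real.exp (-(ρ * s))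
      - 1 / Real.cosh s ^ 4 * Real.sin (ρ * Real.tanh s + -(2 * η * s)) := fun s => by
    rw [← sub_eq_add_neg, Real.exp_add]; ring
  have ht := continuous_tanh
  simp only [coulombG, coulombPrefactor, coulombExp, coulombSin, e]
  rw [integral_sub ((laplaceKernel_arctan η).decay ρ hρ).integrableOn
    (expDecay_sech_mul (by fun_prop) fun s => Real.abs_sin_le_one _).integrableOn]
  ring

theorem SolvesPos.congr {P Q f g : ℝ → ℝ} (hf : SolvesPos P Q f) (h : ∀ x, 0 < x → g x = f x) :
    SolvesPos P Q g := by
  obtain ⟨f', hf⟩ := hf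
  refine ⟨f', fun x hx => ?_⟩
  have he : g =ᶠ[𝓝 x] f := (lt_mem_nhds hx).mono h
  rw [h x hx]
  exact ⟨(hf x hx).1.congr_of_eventuallyEq he, (hf x hx).2⟩

theorem coulombEquation_coulombF (η : ℝ) : CoulombEquation η (coulombF 1 η) := by
  rw [coulombF_eq]
  exact (coulombCos_equation η).sq_mul.const_mul _

theorem coulombEquation_coulombG (η : ℝ) : CoulombEquation η (coulombG 1 η) :=
  ((coulombExp_sub_coulombSin_equation η).sq_mul.const_mul _).congr fun _ => coulombG_eq η

/-! ### Global forms of the solutions with `p = -1` -/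

theorem SolvesNear.continuousAt {P Q R y : ℝ → ℝ} {x₀ : ℝ} (h : SolvesNear P Q R y x₀) :
    ContinuousAt y x₀ := by
  obtain ⟨y', h⟩ := h
  exact h.self_of_nhds.1.continuousAt

theorem SolvesNear.congr {P Q R P' Q' R' y w : ℝ → ℝ} {x₀ : ℝ} (h : SolvesNear P Q R y x₀)
    (hP : ∀ᶠ x in 𝓝 x₀, P' x = P x) (hQ : ∀ᶠ x in 𝓝 x₀, Q' x = Q x)
    (hR : ∀ᶠ x in 𝓝 x₀, R' x = R x) (hy : ∀ᶠ x in 𝓝 x₀, w x = y x) :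
    SolvesNear P' Q' R' w x₀ := by
  obtain ⟨y', h⟩ := h
  refine ⟨y', ?_⟩
  filter_upwards [h, hP, hQ, hR, hy, hy.eventually_nhds] with x hx h1 h2 h3 h4 h5
  rw [h1, h2, h3, h4]
  exact ⟨hx.1.congr_of_eventuallyEq h5, hx.2⟩

theorem polarSolution_standingWave {n k c c₁ : ℝ} {Ω : Set (ℝ × ℝ)} {A : ℝ → ℝ} {Φ : ℝ → ℝ → ℝ}
    (h : ∀ z ∈ Ω, 0 < z.2 ∧ (∀ᶠ y in 𝓝 z, y ∈ Ω) ∧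
      SolvesNear (fun r => -(n - 1) / r) (fun _ => -c) (fun _ => -k) A z.2)
    (hΦ : ∀ t r, Φ t r = c₁ + c * t) :
    PolarSolution .timeTranslation n (-1) k Ω (fun _ r => A r) Φ := by
  refine PolarSolution.of_isExactAt fun z hz => ?_
  obtain ⟨h0, he, hA⟩ := h z hz
  refine ⟨he, ContinuousAt.comp (f := Prod.snd) hA.continuousAt continuousAt_snd, fun hA0 => ?_⟩
  exact (isExactAt_standingWave h0 hA0 hA (c₁ := c₁)).congr
    (Eventually.of_forall fun y => by rw [hΦ])

theorem polarSolution_conformalWave {k c c₁ : ℝ} {Ω : Set (ℝ × ℝ)} {B : ℝ → ℝ} {A Φ : ℝ → ℝ → ℝ}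
    (h : ∀ z ∈ Ω, 0 < z.2 ∧ z.1 ≠ 0 ∧ (∀ᶠ y in 𝓝 z, y ∈ Ω) ∧
      SolvesNear (fun y => 5 / y) (fun _ => -c) (fun _ => -k) B (z.2 / z.1))
    (hA : ∀ z ∈ Ω, A z.1 z.2 = z.1 ^ 2 * B (z.2 / z.1))
    (hΦ : ∀ t r, Φ t r = c₁ - c / t - r ^ 2 / (4 * t)) :
    PolarSolution .inversion (-4) (-1) k Ω A Φ := by
  refine PolarSolution.of_isExactAt fun z hz => ?_
  obtain ⟨h0, ht, he, hB⟩ := h z hz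
  have hd : ContinuousAt (fun y : ℝ × ℝ => y.2 / y.1) z := continuousAt_snd.div continuousAt_fst ht
  refine ⟨he, ?_, fun hA0 => ?_⟩
  · exact ((continuousAt_fst.pow 2).mul
      (ContinuousAt.comp (f := fun y : ℝ × ℝ => y.2 / y.1) hB.continuousAt hd)).congr
      (he.mono fun y hy => (hA y hy).symm)
  · rw [hA z hz] at hA0
    exact (isExactAt_conformalWave h0 ht hA0 hB (c₁ := c₁)).congr
      (he.mono fun y hy => by rw [hΦ, hA y hy])

theorem polarSolution_selfSimilar {k c c₁ : ℝ} {Ω : Set (ℝ × ℝ)} {B : ℝ → ℝ} {A Φ : ℝ → ℝ → ℝ}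
    (h : ∀ z ∈ Ω, 0 < z.2 ∧ z.1 ≠ 0 ∧ (∀ᶠ y in 𝓝 z, y ∈ Ω) ∧
      SolvesNear (fun ξ => 2 / ξ) (fun ξ => -(1 - 2 * c / ξ)) (fun ξ => -(2 * k) / ξ) B
        (z.2 ^ 2 / (8 * z.1)))
    (hA : ∀ z ∈ Ω, A z.1 z.2 = z.1 * B (z.2 ^ 2 / (8 * z.1)))
    (hΦ : ∀ t r, Φ t r = c₁ - r ^ 2 / (8 * t) - c * Real.log t) :
    PolarSolution .scaling (-4) (-1) k Ω A Φ := by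
  refine PolarSolution.of_isExactAt fun z hz => ?_
  obtain ⟨h0, ht, he, hB⟩ := h z hz
  have hd : ContinuousAt (fun y : ℝ × ℝ => y.2 ^ 2 / (8 * y.1)) z :=
    (continuousAt_snd.pow 2).div (continuousAt_const.mul continuousAt_fst) (by simpa using ht)
  refine ⟨he, ?_, fun hA0 => ?_⟩
  · exact (continuousAt_fst.mul
      (ContinuousAt.comp (f := fun y : ℝ × ℝ => y.2 ^ 2 / (8 * y.1)) hB.continuousAt hd)).congr
      (he.mono fun y hy => (hA y hy).symm)
  · rw [hA z hz] at hA0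
    exact (isExactAt_selfSimilar h0 ht hA0 hB (c₁ := c₁)).congr
      (he.mono fun y hy => by rw [hΦ, hA y hy])

/-! ### Elementary amplitudes -/

theorem polarSolution_static_power {n k c₁ c₂ c₃ : ℝ} (hn : n ≠ 0) :
    PolarSolution .timeTranslation n (-1) k {z | 0 < z.2}
      (fun _ r => -k * r ^ 2 / (2 * n) + c₃ * r ^ (2 - n) + c₂) (fun _ _ => c₁) := by
  refine polarSolution_standingWave (c := 0) (c₁ := c₁) (A := fun r =>
    -k * r ^ 2 / (2 * n) + c₃ * r ^ (2 - n) + c₂) (fun z hz => ⟨hz, eventually_snd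
    (lt_mem_nhds hz), ⟨fun r => -k * (2 * r) / (2 * n) + c₃ * ((2 - n) * r ^ (1 - n)), ?_⟩⟩)
    fun t r => by ring
  filter_upwards [lt_mem_nhds (show (0 : ℝ) < z.2 from hz)] with r hr
  have hsq : HasDerivAt (fun r : ℝ => r ^ 2) (2 * r) r := by simpa using hasDerivAt_pow 2 r
  have h1 : HasDerivAt (fun r : ℝ => r ^ (2 - n)) ((2 - n) * r ^ (1 - n)) r :=
    (Real.hasDerivAt_rpow_const (Or.inl hr.ne')).congr_deriv (by ring_nf)
  have h2 : HasDerivAt (fun r : ℝ => r ^ (1 - n)) ((1 - n) * r ^ (1 - n - 1)) r :=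
    Real.hasDerivAt_rpow_const (Or.inl hr.ne')
  refine ⟨(((hsq.const_mul (-k)).div_const (2 * n)).add (h1.const_mul c₃)).add_const c₂,
    (((((hasDerivAt_id r).const_mul 2).const_mul (-k)).div_const (2 * n)).add
      ((h2.const_mul (2 - n)).const_mul c₃)).congr_deriv ?_⟩
  rw [Real.rpow_sub_one hr.ne']
  field_simp
  ring

theorem polarSolution_static_log {k c₁ c₂ c₃ : ℝ} :
    PolarSolution .timeTranslation 2 (-1) k {z | 0 < z.2}
      (fun _ r => -k * r ^ 2 / 4 + c₃ * Real.log r + c₂) (fun _ _ => c₁) := by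
  refine polarSolution_standingWave (c := 0) (c₁ := c₁) (A := fun r =>
    -k * r ^ 2 / 4 + c₃ * Real.log r + c₂) (fun z hz => ⟨hz, eventually_snd
    (lt_mem_nhds hz), ⟨fun r => -k * (2 * r) / 4 + c₃ * r⁻¹, ?_⟩⟩) fun t r => by ring
  filter_upwards [lt_mem_nhds (show (0 : ℝ) < z.2 from hz)] with r hr
  have hsq : HasDerivAt (fun r : ℝ => r ^ 2) (2 * r) r := by simpa using hasDerivAt_pow 2 r
  refine ⟨(((hsq.const_mul (-k)).div_const 4).add
    ((Real.hasDerivAt_log hr.ne').const_mul c₃)).add_const c₂,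
    (((((hasDerivAt_id r).const_mul 2).const_mul (-k)).div_const 4).add
      ((hasDerivAt_inv hr.ne').const_mul c₃)).congr_deriv ?_⟩
  field_simp
  ring

theorem polarSolution_static_sq_mul_log {k c₁ c₂ c₃ : ℝ} :
    PolarSolution .timeTranslation 0 (-1) k {z | 0 < z.2}
      (fun _ r => -(k / 2) * r ^ 2 * Real.log r + c₃ * r ^ 2 + c₂) (fun _ _ => c₁) := by
  refine polarSolution_standingWave (c := 0) (c₁ := c₁) (A := fun r =>
    -(k / 2) * r ^ 2 * Real.log r + c₃ * r ^ 2 + c₂) (fun z hz => ⟨hz, eventually_snd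
    (lt_mem_nhds hz), ⟨fun r => -k * (r * Real.log r) + (2 * c₃ - k / 2) * r, ?_⟩⟩) fun t r => by ring
  filter_upwards [lt_mem_nhds (show (0 : ℝ) < z.2 from hz)] with r hr
  have hsq : HasDerivAt (fun r : ℝ => r ^ 2) (2 * r) r := by simpa using hasDerivAt_pow 2 r
  have hid : HasDerivAt (fun r : ℝ => r) 1 r := hasDerivAt_id r
  have hl := Real.hasDerivAt_log hr.ne'
  refine ⟨((((hsq.const_mul (-(k / 2))).mul hl).add (hsq.const_mul c₃)).add_const c₂).congr_deriv ?_,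
    (((hid.mul hl).const_mul (-k)).add (hid.const_mul (2 * c₃ - k / 2))).congr_deriv ?_⟩
  · field_simp
    ring
  · field_simp
    ring

theorem polarSolution_conformal_polynomial {k c₁ c₂ c₃ : ℝ} :
    PolarSolution .inversion (-4) (-1) k {z | 0 < z.2 ∧ z.1 ≠ 0}
      (fun t r => k / 8 * r ^ 2 + c₃ * r ^ 6 / t ^ 4 + c₂ * t ^ 2)
      (fun t r => c₁ - r ^ 2 / (4 * t)) := by
  refine polarSolution_conformalWave (c := 0) (c₁ := c₁)
    (B := fun y => k / 8 * y ^ 2 + c₃ * y ^ 6 + c₂)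
    (fun z ⟨hz, ht⟩ => ⟨hz, ht, (eventually_snd (lt_mem_nhds hz)).and
      (eventually_fst (eventually_ne_nhds ht)),
      ⟨fun y => k / 8 * (2 * y) + c₃ * (6 * y ^ 5), ?_⟩⟩) ?_ fun t r => by ring
  · filter_upwards [eventually_ne_nhds (div_ne_zero (ne_of_gt hz) ht)] with y hy
    have h2 : HasDerivAt (fun y : ℝ => y ^ 2) (2 * y) y := by simpa using hasDerivAt_pow 2 y
    have h6 : HasDerivAt (fun y : ℝ => y ^ 6) (6 * y ^ 5) y := by simpa using hasDerivAt_pow 6 y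
    have h5 : HasDerivAt (fun y : ℝ => y ^ 5) (5 * y ^ 4) y := by simpa using hasDerivAt_pow 5 y
    have hid : HasDerivAt (fun y : ℝ => y) 1 y := hasDerivAt_id y
    refine ⟨((h2.const_mul (k / 8)).add (h6.const_mul c₃)).add_const c₂,
      (((hid.const_mul 2).const_mul (k / 8)).add ((h5.const_mul 6).const_mul c₃)).congr_deriv ?_⟩
    field_simp
    ring
  · rintro ⟨t, r⟩ ⟨_, ht⟩
    replace ht : t ≠ 0 := ht
    simp only
    field_simp

/-! ### Bessel amplitudes -/

/-- Convergence up to `x₀` extends to nearby endpoints because the integrand is continuous there.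
Nothing is asked at the lower limit, which may be singular. -/
theorem eventually_hasDerivAt_integral {g : ℝ → ℝ} {a x₀ : ℝ}
    (hg : ∀ᶠ x in 𝓝 x₀, ContinuousAt g x) (hi : IntervalIntegrable g volume a x₀) :
    ∀ᶠ x in 𝓝 x₀, IntervalIntegrable g volume a x ∧ HasDerivAt (fun x => ∫ s in a..x, g s) (g x) x := by
  obtain ⟨ε, hε, hb⟩ := Metric.eventually_nhds_iff_ball.1 hg
  filter_upwards [Metric.ball_mem_nhds x₀ hε] with x hx
  have hsub : Set.uIcc x₀ x ⊆ Metric.ball x₀ ε :=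
    (convex_ball x₀ ε).ordConnected.uIcc_subset (Metric.mem_ball_self hε) hx
  have hix : IntervalIntegrable g volume a x :=
    hi.trans (ContinuousOn.intervalIntegrable fun s hs => (hb s (hsub hs)).continuousWithinAt)
  exact ⟨hix, intervalIntegral.integral_hasDerivAt_right hix
    (ContinuousAt.stronglyMeasurableAtFilter Metric.isOpen_ball hb x hx) (hb x hx)⟩

/-- Reduction of order: Wronskians of the Bessel equation are multiples of `1/x`, so `f ∫ z⁻¹ f⁻²`
is a second solution wherever `f ≠ 0`. -/
theorem BesselEquation.quadForm {ν q c₄ c₅ x₀ : ℝ} {f : ℝ → ℝ} (hf : BesselEquation ν q f)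
    (hx₀ : 0 < x₀) (hd : QuadFormDefined f c₄ c₅ x₀) :
    (∀ᶠ x in 𝓝 x₀, QuadFormDefined f c₄ c₅ x) ∧
      SolvesNear (fun x => -1 / x) (fun x => ν ^ 2 / x ^ 2 - q) (fun _ => 0)
        (GNLS.quadForm f c₄ c₅) x₀ := by
  obtain ⟨f', hf⟩ := hf
  -- For `c₅ = 0` the expression is `f` itself, and zeros of `f` do no harm.
  rcases hd with rfl | ⟨h4, hne, hi⟩
  · refine ⟨Eventually.of_forall fun _ => Or.inl rfl, f', ?_⟩
    have he : GNLS.quadForm f c₄ 0 = f := funext fun x => by simp [GNLS.quadForm]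
    rw [he]
    filter_upwards [lt_mem_nhds hx₀] with x hx
    exact ⟨(hf x hx).1, (hf x hx).2.congr_deriv (by ring)⟩
  have hev : ∀ᶠ x in 𝓝 x₀, 0 < x ∧ f x ≠ 0 :=
    (lt_mem_nhds hx₀).and ((hf x₀ hx₀).1.continuousAt.eventually_ne hne)
  have hc : ∀ᶠ x in 𝓝 x₀, ContinuousAt (fun z => z⁻¹ * ((f z) ^ 2)⁻¹) x := by
    filter_upwards [hev] with x hx
    exact (continuousAt_id.inv₀ hx.1.ne').mul
      (((hf x hx.1).1.continuousAt.pow 2).inv₀ (pow_ne_zero 2 hx.2))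
  have hI := eventually_hasDerivAt_integral hc hi
  refine ⟨?_, fun x => f' x * (1 + c₅ * ∫ z in c₄..x, z⁻¹ * ((f z) ^ 2)⁻¹) + c₅ / (x * f x), ?_⟩
  · filter_upwards [hev, hI] with x h1 h2
    exact Or.inr ⟨h4, h1.2, h2.1⟩
  · filter_upwards [hev, hI] with x ⟨hx, hfx⟩ ⟨_, hIx⟩
    obtain ⟨h1, h2⟩ := hf x hx
    have hid : HasDerivAt (fun x : ℝ => x) 1 x := hasDerivAt_id x
    have hq := (hIx.const_mul c₅).const_add 1
    refine ⟨(h1.mul hq).congr_deriv ?_, ((h2.mul hq).add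
      ((hasDerivAt_const x c₅).div (hid.mul h1) (mul_ne_zero hx.ne' hfx))).congr_deriv ?_⟩
    · field_simp
    · simp only [GNLS.quadForm, Pi.mul_apply]
      generalize (∫ z in c₄..x, z⁻¹ * ((f z) ^ 2)⁻¹) = w
      generalize f x = y at hfx ⊢
      field_simp
      ring

/-- Multiplication by `x^α` with `α² = ν²` cancels the term `ν²/x²`, and the constant `κ` with `qκ =
-k` is a particular solution. Only `α²` matters, so the order may be the absolute value of `α`. -/
theorem SolvesNear.const_add_rpow_mul {α ν q k κ x₀ : ℝ} {y : ℝ → ℝ}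
    (h : SolvesNear (fun x => -1 / x) (fun x => ν ^ 2 / x ^ 2 - q) (fun _ => 0) y x₀)
    (hx₀ : 0 < x₀) (hν : ν ^ 2 = α ^ 2) (hκ : q * κ = -k) :
    SolvesNear (fun x => (2 * α - 1) / x) (fun _ => -q) (fun _ => -k)
      (fun x => κ + x ^ α * y x) x₀ := by
  obtain ⟨y', h⟩ := h
  refine ⟨fun x => α * x ^ (α - 1) * y x + x ^ α * y' x, ?_⟩
  filter_upwards [h, lt_mem_nhds hx₀] with x ⟨h1, h2⟩ hx
  have ha : HasDerivAt (fun x : ℝ => x ^ α) (α * x ^ (α - 1)) x :=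
    Real.hasDerivAt_rpow_const (Or.inl hx.ne')
  have hb : HasDerivAt (fun x : ℝ => x ^ (α - 1)) ((α - 1) * x ^ (α - 1 - 1)) x :=
    Real.hasDerivAt_rpow_const (Or.inl hx.ne')
  refine ⟨(ha.mul h1).const_add κ, (((hb.const_mul α).mul h1).add (ha.mul h2)).congr_deriv ?_⟩
  rw [Real.rpow_sub_one hx.ne', Real.rpow_sub_one hx.ne', hν,
    show k = -(q * κ) by rw [hκ, neg_neg]]
  field_simp
  ring

theorem besselEquation_cylJY {ν c₂ c₃ c₆ : ℝ} (hν : 0 ≤ ν) (h : 0 < c₆) :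
    BesselEquation ν c₆ (cylJY ν c₂ c₃ c₆) := by
  have hs := Real.sqrt_pos.2 h
  have hJ := (besselEquation_besselJ hν).comp_mul hs
  have hY := (besselEquation_besselY ν).comp_mul hs
  rw [Real.sq_sqrt h.le, one_mul] at hJ hY
  exact (SolvesPos.const_mul hJ c₂).add (SolvesPos.const_mul hY c₃)

theorem besselEquation_cylIK {ν c₂ c₃ c₆ : ℝ} (hν : 0 ≤ ν) (h : 0 < c₆) :
    BesselEquation ν (-c₆) (cylIK ν c₂ c₃ c₆) := by
  have hs := Real.sqrt_pos.2 h
  have hI := (besselEquation_besselI hν).comp_mul hs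
  have hK := (besselEquation_besselK ν).comp_mul hs
  rw [Real.sq_sqrt h.le, neg_one_mul] at hI hK
  exact (SolvesPos.const_mul hI c₂).add (SolvesPos.const_mul hK c₃)

theorem polarSolution_standingWave_bessel {n k q κ c₁ c₄ c₅ : ℝ} {f : ℝ → ℝ} {Φ : ℝ → ℝ → ℝ}
    (hf : BesselEquation |1 - n / 2| q f) (hκ : q * κ = -k) (hΦ : ∀ t r, Φ t r = c₁ + q * t) :
    PolarSolution .timeTranslation n (-1) k {z | 0 < z.2 ∧ QuadFormDefined f c₄ c₅ z.2}
      (fun _ r => κ + r ^ (1 - n / 2) * quadForm f c₄ c₅ r) Φ := by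
  refine polarSolution_standingWave (c := q) (c₁ := c₁)
    (A := fun r => κ + r ^ (1 - n / 2) * quadForm f c₄ c₅ r) (fun z ⟨hz, hd⟩ => ?_) hΦ
  obtain ⟨he, hy⟩ := hf.quadForm hz hd
  refine ⟨hz, (eventually_snd (lt_mem_nhds hz)).and (eventually_snd he), ?_⟩
  exact (hy.const_add_rpow_mul hz (sq_abs _) hκ).congr
    (Eventually.of_forall fun x => by ring) (Eventually.of_forall fun _ => rfl)
    (Eventually.of_forall fun _ => rfl) (Eventually.of_forall fun _ => rfl)

theorem polarSolution_conformalWave_bessel {k q κ c₁ c₄ c₅ : ℝ} {f : ℝ → ℝ} {Φ : ℝ → ℝ → ℝ}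
    (hf : BesselEquation 3 q f) (hκ : q * κ = -k)
    (hΦ : ∀ t r, Φ t r = c₁ - q / t - r ^ 2 / (4 * t)) :
    PolarSolution .inversion (-4) (-1) k
      {z | 0 < z.2 ∧ 0 < z.1 ∧ QuadFormDefined f c₄ c₅ (z.2 / z.1)}
      (fun t r => κ * t ^ 2 + r ^ 3 / t * quadForm f c₄ c₅ (r / t)) Φ := by
  refine polarSolution_conformalWave (c := q) (c₁ := c₁)
    (B := fun y => κ + y ^ 3 * quadForm f c₄ c₅ y) (fun z ⟨hz, ht, hd⟩ => ?_) ?_ hΦ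
  · obtain ⟨he, hy⟩ := hf.quadForm (div_pos hz ht) hd
    have hc : ContinuousAt (fun y : ℝ × ℝ => y.2 / y.1) z :=
      continuousAt_snd.div continuousAt_fst ht.ne'
    refine ⟨hz, ht.ne', (eventually_snd (lt_mem_nhds hz)).and
      ((eventually_fst (lt_mem_nhds ht)).and (hc.eventually he)), ?_⟩
    refine (hy.const_add_rpow_mul (α := (3 : ℕ)) (div_pos hz ht) (by norm_num) hκ).congr
      (Eventually.of_forall fun x => by norm_num) (Eventually.of_forall fun _ => rfl)
      (Eventually.of_forall fun _ => rfl) (Eventually.of_forall fun x => ?_)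
    rw [Real.rpow_natCast]
  · rintro ⟨t, r⟩ ⟨_, ht, _⟩
    replace ht : t ≠ 0 := ht.ne'
    simp only
    generalize quadForm f c₄ c₅ (r / t) = y
    field_simp

/-! ### The self-similar solution with trigonometric integrals -/

/-- The difference quotient extends continuously across `0`, so the apparent singularity at the
lower limit is harmless. -/
theorem hasDerivAt_integral_div_id {f g : ℝ → ℝ} (hf : Differentiable ℝ f)
    (hg : ∀ s, g s = (f s - f 0) / s) {x : ℝ} (hx : x ≠ 0) :
    HasDerivAt (fun x => ∫ s in (0 : ℝ)..x, g s) (g x) x := by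
  have hc : Continuous (dslope f 0) := by
    rw [← continuousOn_univ, continuousOn_dslope univ_mem]
    exact ⟨hf.continuous.continuousOn, hf 0⟩
  have he : ∀ s, s ≠ 0 → dslope f 0 s = g s := fun s hs => by
    rw [dslope_of_ne f hs, slope_def_field, sub_zero, hg]
  have hi : IntervalIntegrable g volume 0 x := by
    refine (hc.intervalIntegrable 0 x).congr_uIoo fun s hs => he s ?_
    rintro rfl
    rw [Set.uIoo, Set.mem_Ioo] at hs
    rcases le_total 0 x with h | h
    · rw [min_eq_left h] at hs; exact lt_irrefl _ hs.1
    · rw [max_eq_left h] at hs; exact lt_irrefl _ hs.2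
  refine (eventually_hasDerivAt_integral ?_ hi).self_of_nhds.2
  filter_upwards [eventually_ne_nhds hx] with y hy
  exact hc.continuousAt.congr ((eventually_ne_nhds hy).mono he)

theorem hasDerivAt_sinIntegral {x : ℝ} (hx : x ≠ 0) :
    HasDerivAt sinIntegral (Real.sin x / x) x :=
  hasDerivAt_integral_div_id (g := fun s => Real.sin s / s) Real.differentiable_sin
    (fun s => by simp) hx

theorem hasDerivAt_cosIntegral {x : ℝ} (hx : x ≠ 0) :
    HasDerivAt cosIntegral (Real.cos x / x) x := by
  refine (((Real.hasDerivAt_log hx).const_add Real.eulerMascheroniConstant).add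
    (hasDerivAt_integral_div_id (g := fun s => (Real.cos s - 1) / s) Real.differentiable_cos
      (fun s => by simp) hx)).congr_deriv ?_
  field_simp
  ring

theorem hasDerivAt_trigDen (c₂ c₃ ξ : ℝ) :
    HasDerivAt (trigDen c₂ c₃) (ξ * (c₂ * Real.sin ξ - c₃ * Real.cos ξ)) ξ := by
  have hid : HasDerivAt (fun ξ : ℝ => ξ) 1 ξ := hasDerivAt_id ξ
  refine ((((hid.const_mul c₃).const_sub c₂).mul (Real.hasDerivAt_sin ξ)).sub
    (((hid.const_mul c₂).const_add c₃).mul (Real.hasDerivAt_cos ξ))).congr_deriv ?_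
  ring

/-- The numerator of `trigIntegrand`. -/
noncomputable def trigNum (c₂ c₃ ξ : ℝ) : ℝ :=
  ξ ^ 2 * (c₂ * sinIntegral ξ - c₃ * cosIntegral ξ) - trigDen c₂ c₃ ξ

theorem trigIntegrand_eq (c₂ c₃ ξ : ℝ) :
    trigIntegrand c₂ c₃ ξ = trigNum c₂ c₃ ξ / trigDen c₂ c₃ ξ ^ 2 := by
  have : ξ ^ 2 * (c₂ * sinIntegral ξ - c₃ * cosIntegral ξ) + (c₃ * ξ - c₂) * Real.sin ξ
      + (c₂ * ξ + c₃) * Real.cos ξ = trigNum c₂ c₃ ξ := by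
    rw [trigNum, trigDen]; ring
  rw [trigIntegrand, this]

/-- The numerator is built to satisfy `N' = 2(N + D)/ξ`, which is the condition that variation of
constants imposes; the derivatives of `Si` and `Ci` cancel `D'`. -/
theorem hasDerivAt_trigNum (c₂ c₃ : ℝ) {ξ : ℝ} (hξ : ξ ≠ 0) :
    HasDerivAt (trigNum c₂ c₃) ((2 * trigNum c₂ c₃ ξ + 2 * trigDen c₂ c₃ ξ) / ξ) ξ := by
  have hsq : HasDerivAt (fun ξ : ℝ => ξ ^ 2) (2 * ξ) ξ := by simpa using hasDerivAt_pow 2 ξ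
  refine ((hsq.mul (((hasDerivAt_sinIntegral hξ).const_mul c₂).sub
    ((hasDerivAt_cosIntegral hξ).const_mul c₃))).sub (hasDerivAt_trigDen c₂ c₃ ξ)).congr_deriv ?_
  rw [trigNum]
  simp only [Pi.sub_apply]
  field_simp
  ring

/-- `D = trigDen` solves the homogeneous equation. For `y = D I` with `I' = N/D²`, the operator
yields `(N' - 2N/ξ)/D = 2/ξ`, which times `-k` is the source. -/
theorem solvesNear_trig {k c₂ c₃ c₄ ξ₀ : ℝ} (h0 : ξ₀ ≠ 0) (hD : trigDen c₂ c₃ ξ₀ ≠ 0)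
    (hi : IntervalIntegrable (trigIntegrand c₂ c₃) volume c₄ ξ₀) :
    (∀ᶠ ξ in 𝓝 ξ₀, trigDen c₂ c₃ ξ ≠ 0 ∧ IntervalIntegrable (trigIntegrand c₂ c₃) volume c₄ ξ) ∧
      SolvesNear (fun ξ => 2 / ξ) (fun _ => -1) (fun ξ => -(2 * k) / ξ)
        (fun ξ => -k * (trigDen c₂ c₃ ξ * ∫ s in c₄..ξ, trigIntegrand c₂ c₃ s)) ξ₀ := by
  have hev : ∀ᶠ ξ in 𝓝 ξ₀, ξ ≠ 0 ∧ trigDen c₂ c₃ ξ ≠ 0 :=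
    (eventually_ne_nhds h0).and ((hasDerivAt_trigDen c₂ c₃ ξ₀).continuousAt.eventually_ne hD)
  have hc : ∀ᶠ ξ in 𝓝 ξ₀, ContinuousAt (trigIntegrand c₂ c₃) ξ := by
    filter_upwards [hev] with ξ hξ
    rw [funext (trigIntegrand_eq c₂ c₃)]
    exact (hasDerivAt_trigNum c₂ c₃ hξ.1).continuousAt.div
      ((hasDerivAt_trigDen c₂ c₃ ξ).continuousAt.pow 2) (pow_ne_zero 2 hξ.2)
  have hI := eventually_hasDerivAt_integral hc hi
  refine ⟨by filter_upwards [hev, hI] with ξ h1 h2 using ⟨h1.2, h2.1⟩, fun ξ =>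
    -k * (ξ * (c₂ * Real.sin ξ - c₃ * Real.cos ξ) * (∫ s in c₄..ξ, trigIntegrand c₂ c₃ s)
      + trigNum c₂ c₃ ξ / trigDen c₂ c₃ ξ), ?_⟩
  filter_upwards [hev, hI] with ξ ⟨hξ, hDξ⟩ ⟨_, hIξ⟩
  rw [trigIntegrand_eq] at hIξ
  have hid : HasDerivAt (fun ξ : ℝ => ξ) 1 ξ := hasDerivAt_id ξ
  have hd := hasDerivAt_trigDen c₂ c₃ ξ
  have hE := ((Real.hasDerivAt_sin ξ).const_mul c₂).sub ((Real.hasDerivAt_cos ξ).const_mul c₃)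
  refine ⟨((hd.mul hIξ).const_mul (-k)).congr_deriv ?_,
    ((((hid.mul hE).mul hIξ).add ((hasDerivAt_trigNum c₂ c₃ hξ).div hd hDξ)).const_mul
      (-k)).congr_deriv ?_⟩
  · field_simp
  · have hDe : trigDen c₂ c₃ ξ = (c₂ - c₃ * ξ) * Real.sin ξ - (c₃ + c₂ * ξ) * Real.cos ξ := rfl
    simp only [Pi.mul_apply, Pi.sub_apply]
    generalize (∫ s in c₄..ξ, trigIntegrand c₂ c₃ s) = w
    generalize trigNum c₂ c₃ ξ = N
    have hlin : (c₂ * Real.sin ξ - c₃ * Real.cos ξ) * w + ξ * (c₂ * Real.cos ξ + c₃ * Real.sin ξ) * w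
        = 2 * (c₂ * Real.sin ξ - c₃ * Real.cos ξ) * w - trigDen c₂ c₃ ξ * w := by rw [hDe]; ring
    generalize trigDen c₂ c₃ ξ = D at hDξ hlin ⊢
    field_simp
    linear_combination (-k * ξ * D ^ 2) * hlin

theorem polarSolution_selfSimilar_trig {k c₁ c₂ c₃ c₄ : ℝ} :
    PolarSolution .scaling (-4) (-1) k
      {z | 0 < z.2 ∧ z.1 ≠ 0 ∧ trigDen c₂ c₃ (z.2 ^ 2 / (8 * z.1)) ≠ 0 ∧
        IntervalIntegrable (trigIntegrand c₂ c₃) volume c₄ (z.2 ^ 2 / (8 * z.1))}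
      (fun t r => k / 8 *
        ((c₂ * r ^ 2 + 8 * c₃ * t) * Real.cos (r ^ 2 / (8 * t))
          + (c₃ * r ^ 2 - 8 * c₂ * t) * Real.sin (r ^ 2 / (8 * t)))
        * ∫ ξ in c₄..(r ^ 2 / (8 * t)), trigIntegrand c₂ c₃ ξ)
      (fun t r => c₁ - r ^ 2 / (8 * t)) := by
  refine polarSolution_selfSimilar (c := 0) (c₁ := c₁) (B := fun ξ =>
    -k * (trigDen c₂ c₃ ξ * ∫ s in c₄..ξ, trigIntegrand c₂ c₃ s))
    (fun z ⟨hz, ht, hD, hi⟩ => ?_) ?_ fun t r => by ring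
  · have ht8 : 8 * z.1 ≠ 0 := by simpa using ht
    obtain ⟨he, hs⟩ := solvesNear_trig (k := k) (div_ne_zero (pow_ne_zero 2 hz.ne') ht8) hD hi
    have hc : ContinuousAt (fun y : ℝ × ℝ => y.2 ^ 2 / (8 * y.1)) z :=
      (continuousAt_snd.pow 2).div (continuousAt_const.mul continuousAt_fst) ht8
    refine ⟨hz, ht, (eventually_snd (lt_mem_nhds hz)).and ((eventually_fst
      (eventually_ne_nhds ht)).and (hc.eventually he)), ?_⟩
    exact hs.congr (Eventually.of_forall fun _ => rfl)
      (Eventually.of_forall fun ξ => by ring) (Eventually.of_forall fun _ => rfl)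
      (Eventually.of_forall fun _ => rfl)
  · rintro ⟨t, r⟩ ⟨_, ht, _⟩
    replace ht : t ≠ 0 := ht
    simp only [trigDen]
    generalize (∫ s in c₄..(r ^ 2 / (8 * t)), trigIntegrand c₂ c₃ s) = w
    generalize Real.sin (r ^ 2 / (8 * t)) = S
    generalize Real.cos (r ^ 2 / (8 * t)) = C
    field_simp
    ring

/-! ### The self-similar solution with Coulomb wave functions -/

theorem hasDerivAt_integral_inv_sq_mul {W : ℝ → ℝ} (hW : ∀ x, 0 < x → ContinuousAt W x) {a x : ℝ}
    (ha : 0 < a) (hx : 0 < x) :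
    HasDerivAt (fun x => ∫ z in a..x, (z ^ 2)⁻¹ * W z) ((x ^ 2)⁻¹ * W x) x := by
  have hc : ∀ y, 0 < y → ContinuousAt (fun z => (z ^ 2)⁻¹ * W z) y := fun y hy =>
    ((continuousAt_id.pow 2).inv₀ (pow_ne_zero 2 hy.ne')).mul (hW y hy)
  refine (eventually_hasDerivAt_integral ((lt_mem_nhds hx).mono hc) ?_).self_of_nhds.2
  exact ContinuousOn.intervalIntegrable fun z hz =>
    (hc z (lt_of_lt_of_le (lt_min ha hx) hz.1)).continuousWithinAt

theorem CoulombEquation.continuousAt {η : ℝ} {W : ℝ → ℝ} (h : CoulombEquation η W) (x : ℝ)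
    (hx : 0 < x) : ContinuousAt W x := by
  obtain ⟨W', h⟩ := h
  exact (h x hx).1.continuousAt

/-- `c₃ Fi₁(c₂, ξ) + c₄ Gi₁(c₂, ξ)`. -/
noncomputable def coulombNum (c₂ c₃ c₄ c₆ ξ : ℝ) : ℝ :=
  c₃ * coulombFi c₆ 1 c₂ ξ + c₄ * coulombGi c₆ 1 c₂ ξ

theorem hasDerivAt_coulombNum (c₂ c₃ c₄ : ℝ) {c₆ ξ : ℝ} (hc₆ : 0 < c₆) (hξ : 0 < ξ) :
    HasDerivAt (coulombNum c₂ c₃ c₄ c₆) (coulombComb c₂ c₃ c₄ ξ / ξ ^ 2) ξ := by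
  refine (((hasDerivAt_integral_inv_sq_mul (coulombEquation_coulombF c₂).continuousAt hc₆
    hξ).const_mul c₃).add ((hasDerivAt_integral_inv_sq_mul
    (coulombEquation_coulombG c₂).continuousAt hc₆ hξ).const_mul c₄)).congr_deriv ?_
  rw [coulombComb]
  field_simp

theorem coulombEquation_coulombComb (c₂ c₃ c₄ : ℝ) : CoulombEquation c₂ (coulombComb c₂ c₃ c₄) :=
  (SolvesPos.const_mul (coulombEquation_coulombF c₂) c₃).add
    (SolvesPos.const_mul (coulombEquation_coulombG c₂) c₄)

/-- If `W` solves the Coulomb equation then `ξ W` solves the homogeneous self-similar equation.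
Multiplying it by an integral of `N/W²` produces the source `ξ N'/W = 1/ξ`, because `N' = W/ξ²`. -/
theorem solvesNear_coulomb {k c₂ c₃ c₄ c₅ c₆ ξ₀ : ℝ} (hc₆ : 0 < c₆) (h0 : 0 < ξ₀)
    (hW : coulombComb c₂ c₃ c₄ ξ₀ ≠ 0)
    (hi : IntervalIntegrable (coulombIntegrand c₂ c₃ c₄ c₆) volume c₅ ξ₀) :
    (∀ᶠ ξ in 𝓝 ξ₀, coulombComb c₂ c₃ c₄ ξ ≠ 0 ∧
      IntervalIntegrable (coulombIntegrand c₂ c₃ c₄ c₆) volume c₅ ξ) ∧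
      SolvesNear (fun ξ => 2 / ξ) (fun ξ => -(1 - 2 * c₂ / ξ)) (fun ξ => -(2 * k) / ξ)
        (fun ξ => -(2 * k) * (ξ * (coulombComb c₂ c₃ c₄ ξ *
          ∫ s in c₅..ξ, coulombIntegrand c₂ c₃ c₄ c₆ s))) ξ₀ := by
  have hWc := (coulombEquation_coulombComb c₂ c₃ c₄).continuousAt
  obtain ⟨W', hW'⟩ := coulombEquation_coulombComb c₂ c₃ c₄
  have hev : ∀ᶠ ξ in 𝓝 ξ₀, 0 < ξ ∧ coulombComb c₂ c₃ c₄ ξ ≠ 0 :=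
    (lt_mem_nhds h0).and ((hWc ξ₀ h0).eventually_ne hW)
  have hc : ∀ᶠ ξ in 𝓝 ξ₀, ContinuousAt (coulombIntegrand c₂ c₃ c₄ c₆) ξ := by
    filter_upwards [hev] with ξ hξ
    exact (hasDerivAt_coulombNum c₂ c₃ c₄ hc₆ hξ.1).continuousAt.div
      ((hWc ξ hξ.1).pow 2) (pow_ne_zero 2 hξ.2)
  have hI := eventually_hasDerivAt_integral hc hi
  refine ⟨by filter_upwards [hev, hI] with ξ h1 h2 using ⟨h1.2, h2.1⟩, fun ξ =>
    -(2 * k) * ((coulombComb c₂ c₃ c₄ ξ + ξ * W' ξ) *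
      (∫ s in c₅..ξ, coulombIntegrand c₂ c₃ c₄ c₆ s)
      + ξ * coulombNum c₂ c₃ c₄ c₆ ξ / coulombComb c₂ c₃ c₄ ξ), ?_⟩
  filter_upwards [hev, hI] with ξ ⟨hξ, hWξ⟩ ⟨_, hIξ⟩
  have hid : HasDerivAt (fun ξ : ℝ => ξ) 1 ξ := hasDerivAt_id ξ
  obtain ⟨h1, h2⟩ := hW' ξ hξ
  have hIe : coulombIntegrand c₂ c₃ c₄ c₆ ξ =
    coulombNum c₂ c₃ c₄ c₆ ξ / coulombComb c₂ c₃ c₄ ξ ^ 2 := rfl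
  rw [hIe] at hIξ
  refine ⟨((hid.mul (h1.mul hIξ)).const_mul (-(2 * k))).congr_deriv ?_,
    ((((h1.add (hid.mul h2)).mul hIξ).add
      ((hid.mul (hasDerivAt_coulombNum c₂ c₃ c₄ hc₆ hξ)).div h1 hWξ)).const_mul
      (-(2 * k))).congr_deriv ?_⟩
  · simp only [Pi.mul_apply]
    generalize (∫ s in c₅..ξ, coulombIntegrand c₂ c₃ c₄ c₆ s) = w
    generalize coulombNum c₂ c₃ c₄ c₆ ξ = N
    generalize coulombComb c₂ c₃ c₄ ξ = W at hWξ ⊢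
    field_simp
    ring
  · simp only [Pi.mul_apply, Pi.add_apply]
    generalize (∫ s in c₅..ξ, coulombIntegrand c₂ c₃ c₄ c₆ s) = w
    generalize coulombNum c₂ c₃ c₄ c₆ ξ = N
    generalize coulombComb c₂ c₃ c₄ ξ = W at hWξ ⊢
    field_simp
    ring

theorem polarSolution_selfSimilar_coulomb {k c₁ c₂ c₃ c₄ c₅ c₆ : ℝ} (hc₆ : 0 < c₆) :
    PolarSolution .scaling (-4) (-1) k
      {z | 0 < z.2 ∧ 0 < z.1 ∧ coulombComb c₂ c₃ c₄ (z.2 ^ 2 / (8 * z.1)) ≠ 0 ∧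
        IntervalIntegrable (coulombIntegrand c₂ c₃ c₄ c₆) volume c₅ (z.2 ^ 2 / (8 * z.1))}
      (fun t r => -(k * r ^ 2 / 4) * coulombComb c₂ c₃ c₄ (r ^ 2 / (8 * t))
        * ∫ ξ in c₅..(r ^ 2 / (8 * t)), coulombIntegrand c₂ c₃ c₄ c₆ ξ)
      (fun t r => c₁ - r ^ 2 / (8 * t) - c₂ * Real.log t) := by
  refine polarSolution_selfSimilar (c := c₂) (c₁ := c₁) (B := fun ξ => -(2 * k) * (ξ *
    (coulombComb c₂ c₃ c₄ ξ * ∫ s in c₅..ξ, coulombIntegrand c₂ c₃ c₄ c₆ s)))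
    (fun z ⟨hz, ht, hD, hi⟩ => ?_) ?_ fun t r => rfl
  · replace ht : 0 < z.1 := ht
    have ht8 : 0 < 8 * z.1 := by positivity
    obtain ⟨he, hs⟩ := solvesNear_coulomb (k := k) hc₆ (div_pos (pow_pos hz 2) ht8) hD hi
    have hc : ContinuousAt (fun y : ℝ × ℝ => y.2 ^ 2 / (8 * y.1)) z :=
      (continuousAt_snd.pow 2).div (continuousAt_const.mul continuousAt_fst) ht8.ne'
    exact ⟨hz, ht.ne', (eventually_snd (lt_mem_nhds hz)).and ((eventually_fst
      (lt_mem_nhds ht)).and (hc.eventually he)), hs⟩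
  · rintro ⟨t, r⟩ ⟨_, ht, _⟩
    replace ht : t ≠ 0 := ht.ne'
    simp only
    generalize (∫ s in c₅..(r ^ 2 / (8 * t)), coulombIntegrand c₂ c₃ c₄ c₆ s) = w
    generalize coulombComb c₂ c₃ c₄ (r ^ 2 / (8 * t)) = W
    field_simp
    ring

end GNLS

/-! ### Assembly of the families -/

theorem theorem1 (n p k : ℝ) (hn : n ≠ 1) (hp : p ≠ 0) (hk : k ≠ 0)
    (c₁ c₂ c₃ c₄ c₅ c₆ : ℝ) :
    -- 1
    (0 < c₂ / k →
      PolarSolution .timeTranslation n p k {z | 0 < z.2}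
        (fun _ _ => (c₂ / k) ^ (1 / p))
        (fun t _ => c₁ - c₂ * t)) ∧
    -- 2
    (p ≠ 2 / n → n ≠ 0 → c₃ ≠ 0 →
      PolarSolution .timeTranslation n p k {z | 0 < z.2 ∧ 0 < c₂ + c₃ * z.1}
        (fun t _ => (c₂ + c₃ * t) ^ (-n / 2))
        (fun t r => c₁ - c₃ * r ^ 2 / (4 * (c₂ + c₃ * t))
          + 2 * k / (c₃ * (n * p - 2)) * (c₂ + c₃ * t) ^ (1 - n * p / 2))) ∧
    -- 3
    (p = 2 / n → n ≠ 0 → c₃ ≠ 0 →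
      PolarSolution .timeTranslation n p k {z | 0 < z.2 ∧ 0 < c₂ + c₃ * z.1}
        (fun t _ => (c₂ + c₃ * t) ^ (-n / 2))
        (fun t r => c₁ - c₃ * r ^ 2 / (4 * (c₂ + c₃ * t))
          - k / c₃ * Real.log |c₂ + c₃ * t|)) ∧
    -- 4
    (∀ σ : ℝ, (σ = 1 ∨ σ = -1) → n ≠ 2 → p = 2 / (2 - n) → 0 < n * (n - 2) / k →
      ExactSolution .timeTranslation n p k {z | 0 < z.2 ∧ c₂ + (n - 4) * z.1 ≠ 0}
        (fun t r =>
          ((σ * Real.sqrt (n * (n - 2) / (2 * k)) : ℝ) : ℂ) ^ ((2 - n : ℝ) : ℂ)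
            * (((c₂ + (n - 4) * t) / r : ℝ) : ℂ) ^ ((n - 2 : ℝ) : ℂ)
            * Complex.exp (Complex.I *
                ((c₁ + (1 - n / 2) * r ^ 2 / (c₂ + (n - 4) * t) : ℝ) : ℂ)))) ∧
    -- 5
    (n ≠ 2 → n ≠ 3 → p = 2 * (3 - n) / (n - 2) → 0 < k * (2 - n) →
      ExactSolution .timeTranslation n p k {z | 0 < z.2 ∧ z.2 + c₂ * z.2 ^ (3 - n) ≠ 0}
        (fun _ r =>
          (((k * (n - 3) ^ 2 / (2 - n) ^ 3) ^ ((2 - n) / (6 - 2 * n)) : ℝ) : ℂ)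
            * ((r + c₂ * r ^ (3 - n) : ℝ) : ℂ) ^ (((2 - n) / (3 - n) : ℝ) : ℂ)
            * Complex.exp (Complex.I * (c₁ : ℂ)))) ∧
    -- 6
    (n ≠ 2 → n ≠ 3 → p = 2 * (3 - n) / (n - 2) → 0 < k → c₂ ≠ 0 →
      PolarSolution .timeTranslation n p k {z | 0 < z.2}
        (fun _ r => (c₂ ^ 2 * (n - 2) ^ 2 / k) ^ ((n - 2) / (6 - 2 * n)) * r ^ (2 - n))
        (fun _ r => c₁ + c₂ * r ^ (n - 2))) ∧
    -- 7
    (p = -1 → 0 < c₆ →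
      PolarSolution .timeTranslation n p k
        {z | 0 < z.2 ∧ QuadFormDefined (cylJY |1 - n / 2| c₂ c₃ c₆) c₄ c₅ z.2}
        (fun _ r => -k / c₆
          + r ^ (1 - n / 2) * quadForm (cylJY |1 - n / 2| c₂ c₃ c₆) c₄ c₅ r)
        (fun t _ => c₁ + c₆ * t)) ∧
    -- 8
    (p = -1 → 0 < c₆ →
      PolarSolution .timeTranslation n p k
        {z | 0 < z.2 ∧ QuadFormDefined (cylIK |1 - n / 2| c₂ c₃ c₆) c₄ c₅ z.2}
        (fun _ r => k / c₆
          + r ^ (1 - n / 2) * quadForm (cylIK |1 - n / 2| c₂ c₃ c₆) c₄ c₅ r)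
        (fun t _ => c₁ - c₆ * t)) ∧
    -- 9
    (p = -1 → n ≠ 0 → n ≠ 2 →
      PolarSolution .timeTranslation n p k {z | 0 < z.2}
        (fun _ r => -k * r ^ 2 / (2 * n) + c₃ * r ^ (2 - n) + c₂)
        (fun _ _ => c₁)) ∧
    -- 10
    (p = -1 → n = 3 → 0 < c₂ →
      PolarSolution .scaling n p k {z | 0 < z.2 ∧ 0 < z.1}
        (fun t r => c₂ / (r * t ^ (1 / 2 : ℝ)))
        (fun t r => c₁ - r ^ 2 / (4 * t) - 2 * k * r * t ^ (3 / 2 : ℝ) / (5 * c₂)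
          + k ^ 2 * t ^ 4 / (25 * c₂ ^ 2))) ∧
    -- 11
    (p = -1 → n = 3 → 0 < c₂ →
      PolarSolution .scaling n p k {z | 0 < z.2}
        (fun _ r => c₂ / r)
        (fun t r => c₁ - k * t * r / c₂ + k ^ 2 * t ^ 3 / (3 * c₂ ^ 2))) ∧
    -- 12
    (p = -1 → n = 2 →
      PolarSolution .timeTranslation n p k {z | 0 < z.2}
        (fun _ r => -k * r ^ 2 / 4 + c₃ * Real.log r + c₂)
        (fun _ _ => c₁)) ∧
    -- 13
    (p = -1 → n = 0 →
      PolarSolution .timeTranslation n p k {z | 0 < z.2}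
        (fun _ r => -(k / 2) * r ^ 2 * Real.log r + c₃ * r ^ 2 + c₂)
        (fun _ _ => c₁)) ∧
    -- 14
    (p = -1 → n = -4 →
      PolarSolution .inversion n p k {z | 0 < z.2 ∧ z.1 ≠ 0}
        (fun t r => k / 8 * r ^ 2 + c₃ * r ^ 6 / t ^ 4 + c₂ * t ^ 2)
        (fun t r => c₁ - r ^ 2 / (4 * t))) ∧
    -- 15
    (p = -1 → n = -4 → 0 < c₆ →
      PolarSolution .inversion n p k
        {z | 0 < z.2 ∧ 0 < z.1 ∧ QuadFormDefined (cylJY 3 c₂ c₃ c₆) c₄ c₅ (z.2 / z.1)}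
        (fun t r => -(k / c₆) * t ^ 2 + r ^ 3 / t * quadForm (cylJY 3 c₂ c₃ c₆) c₄ c₅ (r / t))
        (fun t r => c₁ - c₆ / t - r ^ 2 / (4 * t))) ∧
    -- 16
    (p = -1 → n = -4 → 0 < c₆ →
      PolarSolution .inversion n p k
        {z | 0 < z.2 ∧ 0 < z.1 ∧ QuadFormDefined (cylIK 3 c₂ c₃ c₆) c₄ c₅ (z.2 / z.1)}
        (fun t r => k / c₆ * t ^ 2 + r ^ 3 / t * quadForm (cylIK 3 c₂ c₃ c₆) c₄ c₅ (r / t))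
        (fun t r => c₁ + c₆ / t - r ^ 2 / (4 * t))) ∧
    -- 17
    (∀ ε σ : ℝ, (ε = 1 ∨ ε = -1) → (σ = 1 ∨ σ = -1) →
      8 / (1 + ε * Real.sqrt 17) = (ε * Real.sqrt 17 - 1) / 2 ∧
      (p = 8 / (1 + ε * Real.sqrt 17) → n = (1 + ε * Real.sqrt 17) / 2 → k * n < 0 →
        ExactSolution .inversion n p k
          {z | 0 < z.2 ∧ 0 < z.1 ∧
            z.2 + c₂ * z.1 ^ (-1 + 4 / n) * z.2 ^ (2 * (1 - 2 / n)) ≠ 0}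
          (fun t r =>
            ((σ * Real.sqrt (-k * (1 + 3 / n) / 2) : ℝ) : ℂ) ^ ((-n / 2 : ℝ) : ℂ)
              * ((r + c₂ * t ^ (-1 + 4 / n) * r ^ (2 * (1 - 2 / n)) : ℝ) : ℂ)
                  ^ ((-n / 2 : ℝ) : ℂ)
              * Complex.exp (Complex.I * ((c₁ - r ^ 2 / (4 * t) : ℝ) : ℂ))))) ∧
    -- 18
    (∀ ε : ℝ, (ε = 1 ∨ ε = -1) →
      p = 8 / (1 + ε * Real.sqrt 17) → n = (1 + ε * Real.sqrt 17) / 2 → 0 < k → c₂ ≠ 0 →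
        PolarSolution .inversion n p k {z | 0 < z.2 ∧ 0 < z.1}
          (fun t r => (c₂ ^ 2 * (8 - 3 * n) / k) ^ (n / 4) * r ^ (2 - n) * t ^ (-2 + n / 2))
          (fun t r => c₁ - r ^ 2 / (4 * t) + c₂ * r ^ (n - 2) * t ^ (2 - n))) ∧
    -- 19
    (p = 3 → n = 4 / 3 → k < 0 →
      ExactSolution .inversion n p k {z | 0 < z.2 ∧ z.1 * (1 + c₂ * z.1) ≠ 0}
        (fun t r =>
          (((-16 * k) ^ (-1 / 3 : ℝ) * r ^ (2 / 3 : ℝ) : ℝ) : ℂ)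
            * ((t * (1 + c₂ * t) : ℝ) : ℂ) ^ ((-2 / 3 : ℝ) : ℂ)
            * Complex.exp (Complex.I *
                ((c₁ - r ^ 2 * (1 + 2 * c₂ * t) / (8 * t * (1 + c₂ * t)) : ℝ) : ℂ)))) ∧
    -- 20
    (p = -1 → n = -4 →
      PolarSolution .scaling n p k
        {z | 0 < z.2 ∧ z.1 ≠ 0 ∧ trigDen c₂ c₃ (z.2 ^ 2 / (8 * z.1)) ≠ 0 ∧
          IntervalIntegrable (trigIntegrand c₂ c₃) volume c₄ (z.2 ^ 2 / (8 * z.1))}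
        (fun t r => k / 8 *
          ((c₂ * r ^ 2 + 8 * c₃ * t) * Real.cos (r ^ 2 / (8 * t))
            + (c₃ * r ^ 2 - 8 * c₂ * t) * Real.sin (r ^ 2 / (8 * t)))
          * ∫ ξ in c₄..(r ^ 2 / (8 * t)), trigIntegrand c₂ c₃ ξ)
        (fun t r => c₁ - r ^ 2 / (8 * t))) ∧
    -- 21
    (p = -1 → n = -4 → c₂ ≠ 0 → 0 ≤ c₅ → 0 < c₆ →
      PolarSolution .scaling n p k
        {z | 0 < z.2 ∧ 0 < z.1 ∧ coulombComb c₂ c₃ c₄ (z.2 ^ 2 / (8 * z.1)) ≠ 0 ∧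
          IntervalIntegrable (coulombIntegrand c₂ c₃ c₄ c₆) volume c₅ (z.2 ^ 2 / (8 * z.1))}
        (fun t r => -(k * r ^ 2 / 4) * coulombComb c₂ c₃ c₄ (r ^ 2 / (8 * t))
          * ∫ ξ in c₅..(r ^ 2 / (8 * t)), coulombIntegrand c₂ c₃ c₄ c₆ ξ)
        (fun t r => c₁ - r ^ 2 / (8 * t) - c₂ * Real.log t)) := by
  refine ⟨polarSolution_planeWave hp hk, polarSolution_chirped_power hp, polarSolution_chirped_log hp,
    fun σ hσ hn2 => exactSolution_rational hk hσ hn2, exactSolution_static,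
    polarSolution_powerPhase, ?_, ?_, ?_, ?_, ?_, ?_, ?_, ?_, ?_, ?_, ?_, ?_, ?_, ?_, ?_⟩
  -- The Bessel amplitudes differ in the sign of the frequency: `q = c₆` goes with `J, Y` and `q =
  -- -c₆` with `I, K`, and `qκ = -k` fixes the constant term.
  · rintro rfl h
    exact polarSolution_standingWave_bessel (besselEquation_cylJY (abs_nonneg _) h)
      (mul_div_cancel₀ _ h.ne') fun _ _ => rfl
  · rintro rfl h
    exact polarSolution_standingWave_bessel (besselEquation_cylIK (abs_nonneg _) h)
      (by rw [neg_mul, mul_div_cancel₀ _ h.ne']) fun t r => by ring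
  · rintro rfl h0 -
    exact polarSolution_static_power h0
  · rintro rfl rfl h
    exact polarSolution_coulombPhase h
  · rintro rfl rfl h
    exact polarSolution_linearPhase h
  · rintro rfl rfl
    exact polarSolution_static_log
  · rintro rfl rfl
    exact polarSolution_static_sq_mul_log
  · rintro rfl rfl
    exact polarSolution_conformal_polynomial
  · rintro rfl rfl h
    exact polarSolution_conformalWave_bessel (besselEquation_cylJY (by norm_num) h)
      (by rw [mul_neg, mul_div_cancel₀ _ h.ne']) fun _ _ => rfl
  · rintro rfl rfl h
    exact polarSolution_conformalWave_bessel (besselEquation_cylIK (by norm_num) h)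
      (by rw [neg_mul, mul_div_cancel₀ _ h.ne']) fun t r => by ring
  · intro ε σ hε hσ
    refine ⟨eight_div_sqrt_seventeen hε, fun hp8 hn8 hkn => ?_⟩
    exact exactSolution_conformalStatic hσ (sq_eq_of_sqrt_seventeen hε hn8)
      (by rw [hp8, hn8]; field_simp; norm_num) hkn
  · intro ε hε hp8 hn8 hk0 hc
    exact polarSolution_conformalPowerPhase (sq_eq_of_sqrt_seventeen hε hn8)
      (by rw [hp8, hn8]; field_simp; norm_num) hk0 hc
  · rintro rfl rfl h
    exact exactSolution_conformalRational h
  · rintro rfl rfl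
    exact polarSolution_selfSimilar_trig
  · rintro rfl rfl - - h
    exact polarSolution_selfSimilar_coulomb h
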